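/- A rooted planar map is a finite connected graph (loops and multiple edges allowed, at least one edge) embedded in the sphere, up to orientation-preserving homeomorphism, with a distinguished oriented edge, the root; the face to the right of the root is the root face, and the other faces are internal. For $\ell\ge 1$ let $\mathcal Q^{\ell}$ be the countable set of quadrangulations with boundary of semi-perimeter $\ell$: rooted planar maps whose root face has degree $2\ell$ and all of whose internal faces have degree $4$. Let $|F(\mathfrak q)|$ be the number of internal faces of $\mathfrak q$. A quadrangulation with holes is a rooted planar map with finitely many distinguished internal faces $h$ (the holes), each with a marked oriented boundary edge, such that the boundaries of the holes are simple and pairwise vertex-disjoint and all internal faces that are not holes have degree $4$. If $\mathfrak q_h\in\mathcal Q^{\ell_h}$ and the hole $h$ has degree $2\ell_h$ for every hole $h$ of $\mathfrak q$, then $\mathfrak q\circledcirc(\mathfrak q_h)_h$ denotes the map obtained by gluing $\mathfrak q_h$ into $h$ for every $h$: the root edge of $\mathfrak q_h$ is identified with the marked edge of $h$, and then the boundary edges of the root face of $\mathfrak q_h$ with those of $h$, in order; the root is that of $\mathfrak q$. Write $\mathfrak q\subset\mathfrak Q$ if $\mathfrak Q=\mathfrak q\circledcirc(\mathfrak q_h)_h$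 for some such $(\mathfrak q_h)_h$. Theorem. For every $\ell\ge 1$ let $\mathbb P^{\ell}$ be a probability measure on $\mathcal Q^{\ell}$. The following are equivalent. (1) There is $q\ge 0$ such that $(\mathbb P^\ell)_{\ell\ge1}$ is the family of $q$-Boltzmann laws: for every $\ell\ge 1$, $W_q^\ell:=\sum_{\mathfrak q\in\mathcal Q^\ell}q^{|F(\mathfrak q)|}<\infty$ and $\mathbb P^{\ell}(\mathfrak q)=q^{|F(\mathfrak q)|}/W_q^\ell$ for all $\mathfrak q\in\mathcal Q^\ell$ (with $0^0=1$). (2) $(\mathbb P^{\ell})_{\ell\ge1}$ has the Markov property: for every $\ell\ge1$ and every quadrangulation with holes $\mathfrak q$ with $\mathbb P^\ell(\mathfrak q\subset\mathfrak Q)>0$, the conditional law of $\mathfrak Q$ under $\mathbb P^{\ell}(\,\cdot\mid\mathfrak q\subset\mathfrak Q)$ is the law of $\mathfrak q\circledcirc(\mathfrak Q_h)_h$, where the $\mathfrak Q_h$ are independent and $\mathfrak Q_h$ has law $\mathbb P^{\ell_h}$, $2\ell_h$ being the degree of the hole $h$. Moreover each $\mathbb P^\ell$ is uniform given the number of faces: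 $\mathbb P^\ell(\mathfrak q_1)=\mathbb P^\ell(\mathfrak q_2)$ whenever $\mathfrak q_1,\mathfrak q_2\in\mathcal Q^\ell$ and $|F(\mathfrak q_1)|=|F(\mathfrak q_2)|$. (3) $(\mathbb P^{\ell})_{\ell\ge1}$ has the Markov property, and each $\mathbb P^\ell$ is invariant under rerooting: $\mathbb P^\ell(\mathfrak q_1)=\mathbb P^\ell(\mathfrak q_2)$ whenever $\mathfrak q_1,\mathfrak q_2\in\mathcal Q^\ell$ differ only by the position of the root edge on the boundary of the root face. In particular, every rerooting-invariant family with the Markov property is Boltzmann. -/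

import Mathlib

open scoped NNReal ENNReal

namespace PlanarQuad

/-- A rooted planar map with set of oriented edges (semi-edges, darts) `D`: a connected graph
embedded in the sphere, encoded as a rotation system of genus zero.
* `rev d` is the oriented edge `d` with the opposite orientation;
* `next d` is the oriented edge that follows `d` along the face lying to the right of `d`;
* `root` is the root edge.

Edges are the cycles of `rev`, faces are the cycles of `next`, and vertices are the cycles of
`next * rev`, which is the rotation of the oriented edges around their starting vertex. It is
always used with `D` finite. -/
structure RootedMap (D : Type) where
  rev : Equiv.Perm D
  next : Equiv.Perm D
  root : D
  rev_rev : ∀ d, rev (rev d) = d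
  rev_ne : ∀ d, rev d ≠ d
  connected : ∀ d, ∃ g ∈ Subgroup.closure ({rev, next} : Set (Equiv.Perm D)), g root = d
  euler :
    (Nat.card (Quotient (Equiv.Perm.SameCycle.setoid (next * rev))) : ℤ)
      - Nat.card (Quotient (Equiv.Perm.SameCycle.setoid rev))
      + Nat.card (Quotient (Equiv.Perm.SameCycle.setoid next)) = 2

namespace RootedMap

variable {D D' : Type}

/-- `d` and `d'` have the same face on their right. -/
def SameFace (M : RootedMap D) (d d' : D) : Prop := M.next.SameCycle d d'

/-- `d` and `d'` have the same starting vertex. -/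
def SameVertex (M : RootedMap D) (d d' : D) : Prop := (M.next * M.rev).SameCycle d d'

/-- The degree of the face to the right of `d`. -/
noncomputable def faceDegree (M : RootedMap D) (d : D) : ℕ := {d' | M.SameFace d d'}.ncard

/-- `d` is on the boundary of the root face, the face to the right of the root edge. -/
def OnRootFace (M : RootedMap D) (d : D) : Prop := M.SameFace M.root d

/-- The perimeter: the degree of the root face. -/
noncomputable def perimeter (M : RootedMap D) : ℕ := M.faceDegree M.root

/-- The number of internal faces, that is, of faces other than the root face. -/
noncomputable def numInnerFaces (M : RootedMap D) : ℕ :=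
  Nat.card {F : Quotient (Equiv.Perm.SameCycle.setoid M.next) //
    F ≠ Quotient.mk (Equiv.Perm.SameCycle.setoid M.next) M.root}

/-- Equality of rooted maps up to relabelling of the oriented edges. -/
def Iso (M : RootedMap D) (M' : RootedMap D') : Prop :=
  ∃ e : D ≃ D', (∀ d, e (M.rev d) = M'.rev (e d)) ∧ (∀ d, e (M.next d) = M'.next (e d)) ∧
    e M.root = M'.root

/-- `M'` is a copy of `M` that differs only by the position of the root edge on the boundary
of the root face. -/
def Rerooting (M : RootedMap D) (M' : RootedMap D') : Prop :=
  ∃ e : D ≃ D', (∀ d, e (M.rev d) = M'.rev (e d)) ∧ (∀ d, e (M.next d) = M'.next (e d)) ∧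
    M'.OnRootFace (e M.root)

end RootedMap

/-- A labelled quadrangulation with boundary of semi-perimeter `ℓ`: the root face has degree
`2 * ℓ` and every other face has degree `4`. -/
structure LabelledQuad (ℓ : ℕ) where
  size : ℕ
  map : RootedMap (Fin size)
  perimeter_eq : map.perimeter = 2 * ℓ
  faceDegree_eq : ∀ d, ¬ map.OnRootFace d → map.faceDegree d = 4

/-- Labelled quadrangulations are identified when they are isomorphic as rooted maps. -/
instance LabelledQuad.setoid (ℓ : ℕ) : Setoid (LabelledQuad ℓ) where
  r M M' := M.map.Iso M'.map
  iseqv :=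
    { refl := fun _ => ⟨Equiv.refl _, fun _ => rfl, fun _ => rfl, rfl⟩
      symm := by
        rintro M M' ⟨e, h1, h2, h3⟩
        refine ⟨e.symm, fun d => ?_, fun d => ?_, ?_⟩
        · rw [Equiv.symm_apply_eq, h1, Equiv.apply_symm_apply]
        · rw [Equiv.symm_apply_eq, h2, Equiv.apply_symm_apply]
        · rw [Equiv.symm_apply_eq, h3]
      trans := by
        rintro M M' M'' ⟨e, h1, h2, h3⟩ ⟨e', h1', h2', h3'⟩
        exact ⟨e.trans e', fun d => by simp [h1, h1'], fun d => by simp [h2, h2'],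
          by simp [h3, h3']⟩ }

/-- The set of quadrangulations with boundary of semi-perimeter `ℓ`. -/
def Quad (ℓ : ℕ) : Type := Quotient (LabelledQuad.setoid ℓ)

/-- A labelled representative; it is only used in notions that are invariant under
isomorphism. -/
noncomputable def Quad.rep {ℓ : ℕ} (m : Quad ℓ) : LabelledQuad ℓ :=
  Quotient.out (s := LabelledQuad.setoid ℓ) m

/-- The number of internal faces of a quadrangulation. -/
noncomputable def Quad.numFaces {ℓ : ℕ} (m : Quad ℓ) : ℕ := m.rep.map.numInnerFaces

/-- A quadrangulation with boundary and with `k` holes. Each hole is a face, other than the root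
face, with a marked oriented edge `mark i` on its boundary, which has the hole on its left. The
boundaries of the holes are simple and pairwise vertex-disjoint, and all faces other than the
root face and the holes have degree `4`. -/
structure HoledQuad (D : Type) (k : ℕ) extends RootedMap D where
  mark : Fin k → D
  hole_not_root : ∀ i, ¬ toRootedMap.OnRootFace (rev (mark i))
  hole_ne : ∀ i j, i ≠ j → ¬ toRootedMap.SameFace (rev (mark i)) (rev (mark j))
  simple_disjoint : ∀ i j d d', toRootedMap.SameFace (rev (mark i)) d →
    toRootedMap.SameFace (rev (mark j)) d' → toRootedMap.SameVertex d d' → d = d'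
  faceDegree_eq : ∀ d, ¬ toRootedMap.OnRootFace d →
    (∀ i, ¬ toRootedMap.SameFace (rev (mark i)) d) → toRootedMap.faceDegree d = 4

namespace HoledQuad

variable {D : Type} {k : ℕ}

/-- The hole `i` is the face to the right of `d`. -/
def OnHole (q : HoledQuad D k) (i : Fin k) (d : D) : Prop :=
  q.SameFace (q.rev (q.mark i)) d

/-- The degree of the hole `i`. -/
noncomputable def holeDegree (q : HoledQuad D k) (i : Fin k) : ℕ :=
  q.faceDegree (q.rev (q.mark i))

/-- The `n`-th oriented edge met when following the boundary of the hole `i` from the marked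
edge, in the direction of the marked edge, with the hole on the left. -/
def holeEdge (q : HoledQuad D k) (i : Fin k) (n : ℕ) : D :=
  q.rev ((q.next.symm)^[n] (q.rev (q.mark i)))

/-- The rooted map `m` is obtained by gluing the rooted map `u i` into the hole `i` of `q`, for
all `i`. The maps `f` and `g i` send the oriented edges of `q` and of `u i` to the oriented
edges of `m` that they become.
* The root of `q` becomes the root of `m`, and orientation reversal is preserved.
* The root edge of `u i` is identified with the marked edge of the hole `i`, and the following
  edges along the boundaries are identified in order.
* The faces of `m` are the faces of `q` that are not holes and the faces of the `u i` that are
  not root faces: each oriented edge of `m` comes from exactly one oriented edge that has one of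
  these faces on its right, and the order along these faces is preserved. -/
def IsGluingMap (q : HoledQuad D k) {E : Fin k → Type} (u : ∀ i, RootedMap (E i))
    {D' : Type} (m : RootedMap D') : Prop :=
  ∃ (f : D → D') (g : ∀ i, E i → D'),
    f q.root = m.root ∧
    (∀ x, f (q.rev x) = m.rev (f x)) ∧
    (∀ i y, g i ((u i).rev y) = m.rev (g i y)) ∧
    (∀ i n, g i ((u i).next^[n] (u i).root) = f (q.holeEdge i n)) ∧
    (∀ x, (∀ i, ¬ q.OnHole i x) → f (q.next x) = m.next (f x)) ∧
    (∀ i y, ¬ (u i).OnRootFace y → g i ((u i).next y) = m.next (g i y)) ∧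
    Function.Bijective (Sum.elim
      (fun x : {x : D // ∀ i, ¬ q.OnHole i x} => f x.1)
      (fun y : (Σ i, {y : E i // ¬ (u i).OnRootFace y}) => g y.1 y.2.1))

/-- The quadrangulation `m` is obtained by gluing `u i` into the hole `i` of `q`, for all `i`. -/
def IsGluing (q : HoledQuad D k) {L : Fin k → ℕ+} (u : ∀ i, Quad (L i)) {ℓ : ℕ}
    (m : Quad ℓ) : Prop :=
  q.IsGluingMap (fun i => (u i).rep.map) m.rep.map

/-- The set of the quadrangulations of semi-perimeter `ℓ` that contain `q`, when the holes of `q`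
have semi-perimeters `L i`. -/
def containing (q : HoledQuad D k) (L : Fin k → ℕ+) (ℓ : ℕ) : Set (Quad ℓ) :=
  {m | ∃ u : ∀ i, Quad (L i), q.IsGluing u m}

end HoledQuad

/-- The Markov property of a family of laws: for every quadrangulation with holes `q`, the
conditional law under `P ℓ` given that `q` is contained in the random map is the law of the
gluing of `q` with independent maps of laws `P (L i)`, where `2 * L i` is the degree of the hole
`i`. (If a hole of `q` has odd degree, nothing can be glued into it, so `q` is contained in no
quadrangulation.) -/
def IsMarkov (P : ∀ ℓ : ℕ+, PMF (Quad ℓ)) : Prop :=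
  ∀ (D : Type) [Finite D] (k : ℕ) (q : HoledQuad D k) (L : Fin k → ℕ+),
    (∀ i, q.holeDegree i = 2 * (L i : ℕ)) →
    ∀ (ℓ : ℕ+) (hpos : ∃ m ∈ q.containing L ℓ, m ∈ (P ℓ).support) (m : Quad ℓ),
      (P ℓ).filter (q.containing L ℓ) hpos m =
        ∑' u : {u : ∀ i, Quad (L i) // q.IsGluing u m}, ∏ i, P (L i) (u.1 i)

/-- Each law gives the same mass to maps with the same number of internal faces. -/
def IsUniformGivenFaces (P : ∀ ℓ : ℕ+, PMF (Quad ℓ)) : Prop :=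
  ∀ (ℓ : ℕ+) (m₁ m₂ : Quad ℓ), m₁.numFaces = m₂.numFaces → P ℓ m₁ = P ℓ m₂

/-- Each law gives the same mass to maps that differ only by the position of the root edge. -/
def IsRerootingInvariant (P : ∀ ℓ : ℕ+, PMF (Quad ℓ)) : Prop :=
  ∀ (ℓ : ℕ+) (m₁ m₂ : Quad ℓ), m₁.rep.map.Rerooting m₂.rep.map → P ℓ m₁ = P ℓ m₂

/-- The Boltzmann partition function of semi-perimeter `ℓ`. -/
noncomputable def partitionFunction (q : ℝ≥0) (ℓ : ℕ) : ℝ≥0∞ :=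
  ∑' m : Quad ℓ, (q : ℝ≥0∞) ^ m.numFaces

/-- `P ℓ` is the `q`-Boltzmann law of semi-perimeter `ℓ`, for all `ℓ ≥ 1`. -/
def IsBoltzmann (q : ℝ≥0) (P : ∀ ℓ : ℕ+, PMF (Quad ℓ)) : Prop :=
  ∀ ℓ : ℕ+, partitionFunction q ℓ ≠ ⊤ ∧
    ∀ m : Quad ℓ, P ℓ m = (q : ℝ≥0∞) ^ m.numFaces / partitionFunction q ℓ

end PlanarQuad

/-! Write `F` for the number of internal faces. Gluing maps `u i` into the `k` holes of `q` gives a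
map with `F(q) - k + ∑ F(u i)` internal faces. A Boltzmann weight turns this sum into a product, so
the mass of a gluing is a constant times the product of the masses of the `u i`. Since gluing is a
bijection from the families `u` onto the maps that contain `q`, normalizing this product yields
exactly the law of independent fillings, which is the Markov property. The substance lies in that
bijection: the glued map exists and has genus zero (`HoledQuad.glue`), it is determined by the
fillings (`IsGluingPair.iso`), and it determines them (`IsGluingPair.left_unique`,
`IsGluingPair.filling_iso`). Uniformity given `F` implies invariance under rerooting because
rerooting preserves `F`.

Conversely, two kinds of maps with one hole suffice. One is a polygon of length `2ℓ` with a pendant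
root edge outside: filled with `u` of semi-perimeter `ℓ`, it gives a map of semi-perimeter `ℓ + 1`
with as many faces as `u`. The other is a polygon of length `2(ℓ + 1)` with a root edge outside that
cuts off a quadrangle: filled with `u` of semi-perimeter `ℓ + 1`, it gives a map of semi-perimeter
`ℓ` with one more face. By the Markov property (`IsMarkov.exists_const`) the mass of the result is
`d ℓ`, respectively `c ℓ`, times the mass of `u`, with constants that do not depend on `u`.

Up to rerooting, every map but the single edge arises in this way. If there is an internal face,
some boundary edge separates the root face from a quadrangle, and deleting it undoes the second
operation. If there is none, the map is a plane tree, and deleting a leaf edge undoes the first.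
Induction on `F`, then on `ℓ`, shows that the mass depends only on `F` and `ℓ`. The common mass
`K(n, ℓ)` of the maps with `n` faces then satisfies `K(n, ℓ + 1) = d ℓ * K(n, ℓ)` and `K(n + 1, 1) =
c 1 * K(n, 2) = c 1 * d 1 * K(n, 1)`, so it is geometric in `n` with the same ratio `c 1 * d 1` for
every `ℓ`. Total mass one identifies the prefactor with the inverse of the partition function. -/

namespace PlanarQuad

open Equiv Equiv.Perm

/-! ### Counting and comparing cycles of permutations -/

section Cycles

variable {α β : Type*}

/-- The number of cycles of a permutation, fixed points included. -/
noncomputable def numCycles (p : Perm α) : ℕ := Nat.card (Quotient (SameCycle.setoid p))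

theorem sameCycle_apply (p : Perm α) (x : α) : p.SameCycle x (p x) :=
  sameCycle_apply_right.2 SameCycle.rfl

theorem sameCycle_iterate (p : Perm α) (n : ℕ) (x : α) : p.SameCycle x (p^[n] x) := by
  rw [← coe_pow]; exact sameCycle_pow_right.2 SameCycle.rfl

theorem sameCycle_symm_iterate (p : Perm α) (n : ℕ) (x : α) : p.SameCycle x (p.symm^[n] x) := by
  have := sameCycle_iterate p.symm n x
  exact sameCycle_inv.1 this

theorem exists_iterate_of_sameCycle [Finite α] {p : Perm α} {x y : α} (h : p.SameCycle x y) :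
    ∃ n : ℕ, p^[n] x = y := by
  obtain ⟨n, hn⟩ := h.exists_nat_pow_eq
  exact ⟨n, by rw [← hn, coe_pow]⟩

theorem exists_symm_iterate_of_sameCycle [Finite α] {p : Perm α} {x y : α} (h : p.SameCycle x y) :
    ∃ n : ℕ, p.symm^[n] x = y := by
  have h' : SameCycle p.symm x y := sameCycle_inv.2 h
  exact exists_iterate_of_sameCycle h'

theorem sameCycle_induction [Finite α] {p : Perm α} {x y : α} (h : p.SameCycle x y)
    {C : α → Prop} (hx : C x) (hs : ∀ z, p.SameCycle x z → C z → C (p z)) : C y := by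
  obtain ⟨n, rfl⟩ := exists_iterate_of_sameCycle h
  clear h
  induction n with
  | zero => exact hx
  | succ n ih =>
    rw [Function.iterate_succ_apply']
    exact hs _ (sameCycle_iterate p n x) ih

theorem sameCycle_map [Finite α] {p : Perm α} {p' : Perm β} {φ : α → β}
    (hφ : ∀ x, p'.SameCycle (φ x) (φ (p x))) {x y : α} (h : p.SameCycle x y) :
    p'.SameCycle (φ x) (φ y) :=
  sameCycle_induction (C := fun y => p'.SameCycle (φ x) (φ y)) h SameCycle.rfl
    fun z _ hz => hz.trans (hφ z)

/-- The maps need not commute with the permutations: it is enough that the image of each step stays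
within one cycle, so that `φ` and `ψ` induce inverse bijections between cycles. This freedom allows
vertices and faces to be counted after darts have been removed or identified. -/
theorem numCycles_eq_of_maps [Finite α] [Finite β] {p : Perm α} {p' : Perm β}
    (φ : α → β) (ψ : β → α) (hφ : ∀ x, p'.SameCycle (φ x) (φ (p x)))
    (hψ : ∀ y, p.SameCycle (ψ y) (ψ (p' y)))
    (h1 : ∀ x, p.SameCycle (ψ (φ x)) x) (h2 : ∀ y, p'.SameCycle (φ (ψ y)) y) :
    numCycles p = numCycles p' := by
  refine Nat.card_congr ⟨Quotient.map φ fun x y h => sameCycle_map hφ h,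
    Quotient.map ψ fun x y h => sameCycle_map hψ h, ?_, ?_⟩
  · rintro ⟨x⟩; exact Quotient.sound (h1 x)
  · rintro ⟨x⟩; exact Quotient.sound (h2 x)

theorem numCycles_congr [Finite α] [Finite β] {p : Perm α} {p' : Perm β} (e : α ≃ β)
    (h : ∀ x, e (p x) = p' (e x)) : numCycles p = numCycles p' := by
  refine numCycles_eq_of_maps e e.symm (fun x => ?_) (fun y => ?_) (fun x => ?_) fun y => ?_
  · rw [h]; exact sameCycle_apply _ _
  · have : e.symm (p' y) = p (e.symm y) := by rw [symm_apply_eq, h, apply_symm_apply]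
    rw [this]; exact sameCycle_apply _ _
  · simp [SameCycle.rfl]
  · simp [SameCycle.rfl]

theorem numCycles_one : numCycles (1 : Perm α) = Nat.card α := by
  refine Nat.card_congr (Equiv.ofBijective (Quotient.mk _) ⟨fun x y h => ?_,
    Quotient.mk_surjective⟩).symm
  exact sameCycle_one.1 (Quotient.exact h)

/-- Cycles may be counted by a label that separates them. -/
theorem numCycles_eq_card_of_label [Finite α] [Finite β] {p : Perm α} (φ : α → β) (ψ : β → α)
    (hφ : ∀ x, φ (p x) = φ x) (h1 : ∀ x, p.SameCycle (ψ (φ x)) x) (h2 : ∀ y, φ (ψ y) = y) :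
    numCycles p = Nat.card β := by
  rw [← numCycles_one (α := β)]
  refine numCycles_eq_of_maps φ ψ (fun x => ?_) (fun y => SameCycle.rfl) h1 fun y => ?_
  · rw [hφ]
  · rw [h2]

theorem numCycles_sumCongr [Finite α] [Finite β] (p : Perm α) (p' : Perm β) :
    numCycles (Equiv.sumCongr p p') = numCycles p + numCycles p' := by
  have hl : ∀ {x y}, p.SameCycle x y → SameCycle (Equiv.sumCongr p p') (.inl x) (.inl y) :=
    fun h => sameCycle_map (φ := Sum.inl) (fun x => sameCycle_apply (Equiv.sumCongr p p') (.inl x)) h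
  have hr : ∀ {x y}, p'.SameCycle x y → SameCycle (Equiv.sumCongr p p') (.inr x) (.inr y) :=
    fun h => sameCycle_map (φ := Sum.inr) (fun x => sameCycle_apply (Equiv.sumCongr p p') (.inr x)) h
  rw [numCycles, numCycles, numCycles, ← Nat.card_sum]
  have key : ∀ a b, SameCycle (Equiv.sumCongr p p') a b →
      Sum.map (Quotient.mk (SameCycle.setoid p)) (Quotient.mk (SameCycle.setoid p')) a =
      Sum.map (Quotient.mk (SameCycle.setoid p)) (Quotient.mk (SameCycle.setoid p')) b := by
    intro a b h
    refine sameCycle_one.1 (sameCycle_map (p' := 1) (fun x => ?_) h)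
    rw [sameCycle_one]
    rcases x with x | x
    · simpa using Quotient.sound (s := SameCycle.setoid p) (sameCycle_apply p x)
    · simpa using Quotient.sound (s := SameCycle.setoid p') (sameCycle_apply p' x)
  refine Nat.card_congr ⟨Quotient.lift _ key,
    Sum.elim (Quotient.map Sum.inl fun _ _ => hl) (Quotient.map Sum.inr fun _ _ => hr), ?_, ?_⟩
  · rintro ⟨x | x⟩ <;> rfl
  · rintro (⟨⟨x⟩⟩ | ⟨⟨x⟩⟩) <;> rfl

theorem sameCycle_sigmaCongrRight {ι : Type*} {E : ι → Type*} [∀ i, Finite (E i)]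
    (p : ∀ i, Perm (E i)) {i : ι} {x y : E i} (h : (p i).SameCycle x y) :
    SameCycle (Equiv.sigmaCongrRight p) ⟨i, x⟩ ⟨i, y⟩ :=
  sameCycle_map (φ := fun x => (⟨i, x⟩ : Σ i, E i))
    (fun x => sameCycle_apply (Equiv.sigmaCongrRight p) ⟨i, x⟩) h

theorem numCycles_sigmaCongrRight {ι : Type*} [Fintype ι] {E : ι → Type*} [∀ i, Finite (E i)]
    (p : ∀ i, Perm (E i)) :
    numCycles (Equiv.sigmaCongrRight p) = ∑ i, numCycles (p i) := by
  have key : ∀ a b, SameCycle (Equiv.sigmaCongrRight p) a b →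
      (⟨a.1, Quotient.mk (SameCycle.setoid (p a.1)) a.2⟩ :
        Σ i, Quotient (SameCycle.setoid (p i))) =
      ⟨b.1, Quotient.mk (SameCycle.setoid (p b.1)) b.2⟩ := by
    intro a b h
    refine sameCycle_one.1 (sameCycle_map (p' := 1) (φ := fun a =>
      (⟨a.1, Quotient.mk (SameCycle.setoid (p a.1)) a.2⟩ :
        Σ i, Quotient (SameCycle.setoid (p i)))) (fun x => ?_) h)
    rw [sameCycle_one]
    rcases x with ⟨i, x⟩
    have := Quotient.sound (s := SameCycle.setoid (p i)) (sameCycle_apply (p i) x)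
    exact congrArg (Sigma.mk i) this
  simp only [numCycles]
  rw [← Nat.card_sigma]
  refine Nat.card_congr ⟨Quotient.lift _ key,
    fun a => Quotient.map (fun x => (⟨a.1, x⟩ : Σ i, E i))
      (fun _ _ => sameCycle_sigmaCongrRight p) a.2, ?_, ?_⟩
  · rintro ⟨x⟩; rfl
  · rintro ⟨i, ⟨x⟩⟩; rfl

theorem numCycles_subtype_add [Finite α] (p : Perm α) (P : α → Prop) (hP : ∀ x, P (p x) ↔ P x) :
    numCycles p = numCycles (p.subtypePerm hP) +
      numCycles (p.subtypePerm (p := fun x => ¬ P x) fun x => not_congr (hP x)) := by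
  classical
  rw [← numCycles_sumCongr]
  refine (numCycles_congr (Equiv.sumCompl P) ?_).symm
  rintro (x | x) <;> simp

theorem two_mul_numCycles_of_involutive [Finite α] (p : Perm α) (h : ∀ x, p (p x) = x)
    (hne : ∀ x, p x ≠ x) : 2 * numCycles p = Nat.card α := by
  have hsc : ∀ x y, p.SameCycle x y ↔ y = x ∨ y = p x := by
    intro x y
    constructor
    · intro hxy
      refine sameCycle_induction (C := fun y => y = x ∨ y = p x) hxy (Or.inl rfl) ?_
      rintro z - (rfl | rfl)
      · exact Or.inr rfl
      · exact Or.inl (h x)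
    · rintro (rfl | rfl)
      · exact SameCycle.rfl
      · exact sameCycle_apply p x
  -- An element is coded by its cycle and by whether it is the chosen representative of that cycle.
  have e : α ≃ Quotient (SameCycle.setoid p) × Bool := by
    classical
    refine Equiv.ofBijective (fun x => (Quotient.mk (SameCycle.setoid p) x,
      decide (Quotient.out (Quotient.mk (SameCycle.setoid p) x) = x))) ⟨?_, ?_⟩
    · intro x y hxy
      simp only [Prod.mk.injEq] at hxy
      obtain ⟨h1, h2⟩ := hxy
      have h3 : p.SameCycle x y := Quotient.exact h1
      have h4 : p.SameCycle x (Quotient.out (Quotient.mk (SameCycle.setoid p) x)) :=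
        SameCycle.symm (Quotient.mk_out (s := SameCycle.setoid p) x)
      rw [← h1] at h2
      rw [hsc] at h3 h4
      have := hne x
      rcases h3 with rfl | rfl
      · rfl
      · rcases h4 with h4 | h4 <;> rw [h4, decide_eq_decide] at h2
        · exact h2.1 rfl
        · exact (h2.2 rfl).symm
    · rintro ⟨c, b⟩
      have hc : Quotient.mk (SameCycle.setoid p) c.out = c := Quotient.out_eq c
      cases b
      · refine ⟨p c.out, ?_⟩
        have : Quotient.mk (SameCycle.setoid p) (p c.out) = c := by
          rw [← hc]
          refine (Quotient.sound ?_)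
          rw [hc]
          exact (sameCycle_apply p _).symm
        simp only [this, Prod.mk.injEq, true_and, decide_eq_false_iff_not]
        exact fun hh => hne _ hh.symm
      · exact ⟨c.out, by simp [hc]⟩
  rw [Nat.card_congr e, Nat.card_prod, numCycles]
  simp [mul_comm]

/-! ### Iterates along a cycle -/

theorem ncard_cycle_eq_minimalPeriod [Finite α] (p : Perm α) (x : α) :
    {y | p.SameCycle x y}.ncard = Function.minimalPeriod p x := by
  have : {y | p.SameCycle x y} = (p^[·] x) '' Set.Iio (Function.minimalPeriod p x) := by
    ext y
    constructor
    · intro h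
      obtain ⟨n, rfl⟩ := exists_iterate_of_sameCycle h
      refine ⟨n % Function.minimalPeriod p x, Nat.mod_lt _ ?_,
        Function.iterate_mod_minimalPeriod_eq⟩
      exact Function.minimalPeriod_pos_of_mem_periodicPts
        (Function.Injective.mem_periodicPts p.injective x)
    · rintro ⟨n, -, rfl⟩
      exact sameCycle_iterate p n x
  rw [this, Function.iterate_injOn_Iio_minimalPeriod.ncard_image,
    Set.ncard_eq_toFinset_card' ]
  simp

theorem ncard_cycle_pos [Finite α] (p : Perm α) (x : α) : 0 < {y | p.SameCycle x y}.ncard :=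
  (Set.ncard_pos).2 ⟨x, SameCycle.rfl⟩

theorem iterate_eq_iff_modEq [Finite α] (p : Perm α) (x : α) (m n : ℕ) :
    p^[m] x = p^[n] x ↔ m ≡ n [MOD {y | p.SameCycle x y}.ncard] := by
  have hpos := ncard_cycle_pos p x
  rw [ncard_cycle_eq_minimalPeriod] at *
  rw [← Function.iterate_mod_minimalPeriod_eq (n := m),
    ← Function.iterate_mod_minimalPeriod_eq (n := n),
    Function.iterate_eq_iterate_iff_of_lt_minimalPeriod (Nat.mod_lt _ hpos) (Nat.mod_lt _ hpos)]
  rfl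

theorem symm_iterate_eq_iff [Finite α] (p : Perm α) (x : α) (m n : ℕ) :
    p.symm^[m] x = p.symm^[n] x ↔ m ≡ n [MOD {y | p.SameCycle x y}.ncard] := by
  rw [iterate_eq_iff_modEq]
  have : {y | p.SameCycle x y} = {y | SameCycle p.symm x y} := by
    ext y; exact (sameCycle_inv (f := p)).symm
  rw [this]

/-- Equivariance and injectivity are asked only along the cycle of `x`, because gluing and edge
removal respect the order along some faces and not along others. -/
theorem ncard_cycle_map [Finite α] [Finite β] {p : Perm α} {p' : Perm β} {φ : α → β} {x : α}
    (h : ∀ z, p.SameCycle x z → φ (p z) = p' (φ z))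
    (hinj : ∀ y z, p.SameCycle x y → p.SameCycle x z → φ y = φ z → y = z) :
    {y | p'.SameCycle (φ x) y}.ncard = {y | p.SameCycle x y}.ncard := by
  have : {y | p'.SameCycle (φ x) y} = φ '' {y | p.SameCycle x y} := by
    ext y
    constructor
    · intro hy
      refine sameCycle_induction (C := fun y => y ∈ φ '' {y | p.SameCycle x y}) hy
        ⟨x, SameCycle.rfl, rfl⟩ ?_
      rintro _ - ⟨z, hz, rfl⟩
      exact ⟨p z, hz.trans (sameCycle_apply p z), h z hz⟩
    · rintro ⟨z, hz, rfl⟩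
      refine sameCycle_induction (C := fun z => p'.SameCycle (φ x) (φ z)) hz SameCycle.rfl ?_
      intro w hw hw'
      rw [h w hw]
      exact hw'.trans (sameCycle_apply p' _)
  rw [this, Set.InjOn.ncard_image]
  intro y hy z hz hyz
  exact hinj y z hy hz hyz

theorem sameCycle_map_iff [Finite α] [Finite β] {p : Perm α} {p' : Perm β} (e : α ≃ β)
    (h : ∀ x, e (p x) = p' (e x)) {x y : α} : p'.SameCycle (e x) (e y) ↔ p.SameCycle x y := by
  constructor
  · intro hxy
    have := sameCycle_map (p' := p) (φ := e.symm) (fun z => ?_) hxy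
    · simpa using this
    · have : e.symm (p' z) = p (e.symm z) := by rw [symm_apply_eq, h, apply_symm_apply]
      rw [this]; exact sameCycle_apply _ _
  · exact sameCycle_map (fun z => by rw [h]; exact sameCycle_apply _ _)

end Cycles

/-! ### Rooted maps: connectedness, relabelling, rerooting -/

namespace RootedMap

variable {D D' D'' : Type}

theorem sameFace_next (M : RootedMap D) (d : D) : M.SameFace d (M.next d) := sameCycle_apply _ _

/-- Connectedness as an induction principle. Inverses need no separate hypothesis: `rev` is an
involution, and on a finite set the inverse of `next` is reached by iterating `next`. -/
theorem induction [Finite D] (M : RootedMap D) {C : D → Prop} (h0 : C M.root)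
    (hrev : ∀ d, C d → C (M.rev d)) (hnext : ∀ d, C d → C (M.next d)) (d : D) : C d := by
  obtain ⟨g, hg, rfl⟩ := M.connected d
  suffices ∀ d, C d ↔ C (g d) from (this _).1 h0
  refine Subgroup.closure_induction (p := fun g _ => ∀ d, C d ↔ C (g d)) ?_ ?_ ?_ ?_ hg
  · rintro g (rfl | rfl) d
    · exact ⟨hrev d, fun h => by simpa [M.rev_rev] using hrev _ h⟩
    · exact ⟨hnext d, fun h => sameCycle_induction (sameCycle_apply M.next d).symm h
        fun z _ hz => hnext z hz⟩
  · exact fun d => Iff.rfl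
  · exact fun g g' _ _ h h' d => (h' d).trans (h _)
  · intro g _ h d
    have := h (g⁻¹ d)
    simpa using this.symm

theorem connected_of_induction {rev next : Perm D} {root : D}
    (h : ∀ C : D → Prop, C root → (∀ d, C d → C (rev d)) → (∀ d, C d → C (next d)) → ∀ d, C d)
    (d : D) : ∃ g ∈ Subgroup.closure ({rev, next} : Set (Perm D)), g root = d := by
  refine h (fun d => ∃ g ∈ Subgroup.closure ({rev, next} : Set (Perm D)), g root = d)
    ⟨1, one_mem _, rfl⟩ ?_ ?_ d
  · rintro _ ⟨g, hg, rfl⟩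
    exact ⟨rev * g, mul_mem (Subgroup.subset_closure (by simp)) hg, rfl⟩
  · rintro _ ⟨g, hg, rfl⟩
    exact ⟨next * g, mul_mem (Subgroup.subset_closure (by simp)) hg, rfl⟩

theorem euler_numCycles (M : RootedMap D) :
    (numCycles (M.next * M.rev) : ℤ) - numCycles M.rev + numCycles M.next = 2 := M.euler

theorem two_mul_numCycles_rev [Finite D] (M : RootedMap D) : 2 * numCycles M.rev = Nat.card D :=
  two_mul_numCycles_of_involutive _ M.rev_rev M.rev_ne

theorem numCycles_next [Finite D] (M : RootedMap D) :
    numCycles M.next = M.numInnerFaces + 1 := by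
  classical
  have := Fintype.ofFinite (Quotient (SameCycle.setoid M.next))
  rw [numCycles, numInnerFaces, Nat.card_eq_fintype_card, Nat.card_eq_fintype_card,
    Fintype.card_subtype_compl, Fintype.card_subtype_eq]
  have : 0 < Fintype.card (Quotient (SameCycle.setoid M.next)) :=
    Fintype.card_pos_iff.2 ⟨Quotient.mk _ M.root⟩
  omega

theorem perimeter_pos [Finite D] (M : RootedMap D) : 0 < M.perimeter := ncard_cycle_pos _ _

theorem next_iterate_eq_iff [Finite D] (M : RootedMap D) (m n : ℕ) :
    M.next^[m] M.root = M.next^[n] M.root ↔ m ≡ n [MOD M.perimeter] :=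
  iterate_eq_iff_modEq _ _ _ _

theorem onRootFace_iterate (M : RootedMap D) (n : ℕ) : M.OnRootFace (M.next^[n] M.root) :=
  sameCycle_iterate _ _ _

theorem onRootFace_next_iff (M : RootedMap D) {d : D} :
    M.OnRootFace (M.next d) ↔ M.OnRootFace d := sameCycle_apply_right

theorem OnRootFace.exists_iterate [Finite D] {M : RootedMap D} {d : D} (h : M.OnRootFace d) :
    ∃ n, M.next^[n] M.root = d := exists_iterate_of_sameCycle h

theorem Iso.symm {M : RootedMap D} {M' : RootedMap D'} (h : M.Iso M') : M'.Iso M := by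
  obtain ⟨e, h1, h2, h3⟩ := h
  refine ⟨e.symm, fun d => ?_, fun d => ?_, ?_⟩
  · rw [symm_apply_eq, h1, apply_symm_apply]
  · rw [symm_apply_eq, h2, apply_symm_apply]
  · rw [symm_apply_eq, h3]

theorem Iso.trans {M : RootedMap D} {M' : RootedMap D'} {M'' : RootedMap D''} (h : M.Iso M')
    (h' : M'.Iso M'') : M.Iso M'' := by
  obtain ⟨e, h1, h2, h3⟩ := h
  obtain ⟨e', h1', h2', h3'⟩ := h'
  exact ⟨e.trans e', fun d => by simp [h1, h1'], fun d => by simp [h2, h2'], by simp [h3, h3']⟩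

theorem Iso.rerooting [Finite D] [Finite D'] {M : RootedMap D} {M' : RootedMap D'} (h : M.Iso M') :
    M.Rerooting M' := by
  obtain ⟨e, h1, h2, h3⟩ := h
  exact ⟨e, h1, h2, h3 ▸ SameCycle.rfl⟩

theorem Rerooting.trans_iso {M : RootedMap D} {M' : RootedMap D'}
    {M'' : RootedMap D''} [Finite D'] [Finite D''] (h : M.Rerooting M') (h' : M'.Iso M'') :
    M.Rerooting M'' := by
  obtain ⟨e, h1, h2, h3⟩ := h
  obtain ⟨e', h1', h2', h3'⟩ := h'
  refine ⟨e.trans e', fun d => by simp [h1, h1'], fun d => by simp [h2, h2'], ?_⟩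
  have := (sameCycle_map_iff e' h2').2 h3
  rw [h3'] at this
  exact this

theorem Rerooting.numInnerFaces_eq [Finite D] [Finite D'] {M : RootedMap D} {M' : RootedMap D'}
    (h : M.Rerooting M') : M.numInnerFaces = M'.numInnerFaces := by
  obtain ⟨e, _, h2, _⟩ := h
  have := numCycles_congr e h2
  rw [numCycles_next, numCycles_next] at this
  omega

theorem faceDegree_congr [Finite D] [Finite D'] {M : RootedMap D} {M' : RootedMap D'} (e : D ≃ D')
    (h : ∀ d, e (M.next d) = M'.next (e d)) (d : D) : M'.faceDegree (e d) = M.faceDegree d :=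
  ncard_cycle_map (fun z _ => h z) fun _ _ _ _ h => e.injective h

theorem faceDegree_eq_of_sameFace (M : RootedMap D) {d d' : D} (h : M.SameFace d d') :
    M.faceDegree d = M.faceDegree d' := by
  have : {x | M.SameFace d x} = {x | M.SameFace d' x} := by
    ext x; exact ⟨fun hx => h.symm.trans hx, fun hx => h.trans hx⟩
  rw [faceDegree, faceDegree, this]

/-- Transport of a map along a bijection of its oriented edges. -/
def transport [Finite D] [Finite D'] (M : RootedMap D) (e : D ≃ D') : RootedMap D' where
  rev := e.permCongr M.rev
  next := e.permCongr M.next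
  root := e M.root
  rev_rev d := by simp [M.rev_rev]
  rev_ne d h := by
    rw [permCongr_apply, ← eq_symm_apply] at h
    exact M.rev_ne _ h
  connected := connected_of_induction fun C h0 h1 h2 d => by
    have := M.induction (C := fun d => C (e d)) h0 (fun d hd => by simpa using h1 _ hd)
      (fun d hd => by simpa using h2 _ hd) (e.symm d)
    simpa using this
  euler := by
    have h1 := numCycles_congr (p := M.rev) (p' := e.permCongr M.rev) e (by simp)
    have h2 := numCycles_congr (p := M.next) (p' := e.permCongr M.next) e (by simp)
    have h3 := numCycles_congr (p := M.next * M.rev)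
      (p' := e.permCongr M.next * e.permCongr M.rev) e (by simp)
    have := M.euler_numCycles
    rw [h1, h2, h3] at this
    exact this

theorem iso_transport [Finite D] [Finite D'] (M : RootedMap D) (e : D ≃ D') :
    M.Iso (M.transport e) := ⟨e, by simp [transport], by simp [transport], rfl⟩

/-- The same map with another root. -/
def reroot [Finite D] (M : RootedMap D) (r : D) : RootedMap D where
  rev := M.rev
  next := M.next
  root := r
  rev_rev := M.rev_rev
  rev_ne := M.rev_ne
  connected := connected_of_induction fun C h0 h1 h2 d => by
    have key : ∀ d, C d ↔ C r := by
      have h1' : ∀ d, C (M.rev d) ↔ C d := fun d =>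
        ⟨fun h => by simpa [M.rev_rev] using h1 _ h, h1 d⟩
      have h2' : ∀ d, C (M.next d) ↔ C d := fun d =>
        ⟨fun h => sameCycle_induction (sameCycle_apply M.next d).symm h fun z _ hz => h2 z hz, h2 d⟩
      have := M.induction (C := fun d => C d ↔ C M.root) Iff.rfl
        (fun d hd => (h1' d).trans hd) (fun d hd => (h2' d).trans hd)
      exact fun d => (this d).trans (this r).symm
    exact (key d).2 h0
  euler := M.euler

theorem rerooting_reroot [Finite D] (M : RootedMap D) {r : D} (hr : M.OnRootFace r) :
    M.Rerooting (M.reroot r) := ⟨Equiv.refl D, fun _ => rfl, fun _ => rfl, SameCycle.symm hr⟩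

/-- A map all of whose faces but the root face have degree `4`. -/
def IsQuad (M : RootedMap D) (ℓ : ℕ) : Prop :=
  M.perimeter = 2 * ℓ ∧ ∀ d, ¬ M.OnRootFace d → M.faceDegree d = 4

theorem IsQuad.reroot [Finite D] {M : RootedMap D} {ℓ : ℕ} (h : M.IsQuad ℓ) {r : D}
    (hr : M.OnRootFace r) : (M.reroot r).IsQuad ℓ := by
  refine ⟨?_, fun d hd => h.2 d fun hd' => hd ?_⟩
  · rw [← h.1]; exact (M.faceDegree_eq_of_sameFace hr).symm
  · exact SameCycle.trans (SameCycle.symm hr) hd'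

theorem IsQuad.congr [Finite D] [Finite D'] {M : RootedMap D} {M' : RootedMap D'} {ℓ : ℕ}
    (h : M.IsQuad ℓ) (hi : M.Iso M') : M'.IsQuad ℓ := by
  obtain ⟨e, h1, h2, h3⟩ := hi
  refine ⟨?_, fun d hd => ?_⟩
  · rw [perimeter, ← h3, faceDegree_congr e h2]; exact h.1
  · have := faceDegree_congr e h2 (e.symm d)
    rw [apply_symm_apply] at this
    rw [this]
    refine h.2 _ fun hh => hd ?_
    have := (sameCycle_map_iff e h2).2 hh
    rwa [h3, apply_symm_apply] at this

end RootedMap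

theorem LabelledQuad.isQuad {ℓ : ℕ} (m : LabelledQuad ℓ) : m.map.IsQuad ℓ :=
  ⟨m.perimeter_eq, m.faceDegree_eq⟩

namespace Quad

variable {ℓ : ℕ}

theorem eq_of_iso {m m' : Quad ℓ} (h : m.rep.map.Iso m'.rep.map) : m = m' := by
  rw [← Quotient.out_eq (s := LabelledQuad.setoid ℓ) m,
    ← Quotient.out_eq (s := LabelledQuad.setoid ℓ) m']
  exact Quotient.sound h

/-- Constructions produce maps on arbitrary finite types of darts; relabelling by `Fin` brings them
back into `Quad`. -/
theorem exists_iso_rep {D : Type} [Finite D] (M : RootedMap D) (h : M.IsQuad ℓ) :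
    ∃ m : Quad ℓ, M.Iso m.rep.map := by
  let e := Finite.equivFin D
  let N : LabelledQuad ℓ := ⟨Nat.card D, M.transport e, (h.congr (M.iso_transport e)).1,
    (h.congr (M.iso_transport e)).2⟩
  refine ⟨Quotient.mk (LabelledQuad.setoid ℓ) N, (M.iso_transport e).trans ?_⟩
  exact RootedMap.Iso.symm (Quotient.mk_out (s := LabelledQuad.setoid ℓ) N)

theorem exists_reroot (m : Quad ℓ) {r} (hr : m.rep.map.OnRootFace r) :
    ∃ m' : Quad ℓ, m.rep.map.Rerooting m'.rep.map ∧ (m.rep.map.reroot r).Iso m'.rep.map := by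
  obtain ⟨m', h⟩ := exists_iso_rep (m.rep.map.reroot r) (m.rep.isQuad.reroot hr)
  exact ⟨m', (m.rep.map.rerooting_reroot hr).trans_iso h, h⟩

end Quad

/-! ### Holes and gluings -/

namespace HoledQuad

variable {D : Type} {k : ℕ}

/-- The `n`-th oriented edge with the hole `i` on its right, against the order along the hole. -/
def holeDart (q : HoledQuad D k) (i : Fin k) (n : ℕ) : D :=
  (q.next.symm)^[n] (q.rev (q.mark i))

/-- The oriented edge `x` is on the boundary of no hole. -/
def OffHoles (q : HoledQuad D k) (x : D) : Prop := ∀ i, ¬ q.OnHole i x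

theorem rev_holeDart (q : HoledQuad D k) (i : Fin k) (n : ℕ) :
    q.rev (q.holeDart i n) = q.holeEdge i n := rfl

theorem rev_holeEdge (q : HoledQuad D k) (i : Fin k) (n : ℕ) :
    q.rev (q.holeEdge i n) = q.holeDart i n := q.rev_rev _

theorem onHole_holeDart (q : HoledQuad D k) (i : Fin k) (n : ℕ) : q.OnHole i (q.holeDart i n) :=
  sameCycle_symm_iterate _ _ _

theorem next_holeDart_succ (q : HoledQuad D k) (i : Fin k) (n : ℕ) :
    q.next (q.holeDart i (n + 1)) = q.holeDart i n := by
  rw [holeDart, Function.iterate_succ_apply', apply_symm_apply, holeDart]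

theorem OnHole.exists_holeDart [Finite D] {q : HoledQuad D k} {i : Fin k} {x : D}
    (h : q.OnHole i x) : ∃ n, q.holeDart i n = x := exists_symm_iterate_of_sameCycle h

theorem OnHole.unique {q : HoledQuad D k} {i j : Fin k} {x : D} (hi : q.OnHole i x)
    (hj : q.OnHole j x) : i = j := by
  by_contra h
  exact q.hole_ne i j h (SameCycle.trans hi (SameCycle.symm hj))

theorem onHole_next_iff (q : HoledQuad D k) {i : Fin k} {x : D} :
    q.OnHole i (q.next x) ↔ q.OnHole i x := sameCycle_apply_right

theorem offHoles_next_iff (q : HoledQuad D k) {x : D} :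
    q.OffHoles (q.next x) ↔ q.OffHoles x := forall_congr' fun _ => not_congr q.onHole_next_iff

theorem offHoles_of_onRootFace (q : HoledQuad D k) {x : D} (h : q.OnRootFace x) :
    q.OffHoles x :=
  fun i hi => q.hole_not_root i (SameCycle.trans h (SameCycle.symm hi))

theorem offHoles_root (q : HoledQuad D k) : q.OffHoles q.root :=
  q.offHoles_of_onRootFace SameCycle.rfl

theorem OnHole.eq_of_sameVertex {q : HoledQuad D k} {i j : Fin k} {x y : D} (hx : q.OnHole i x)
    (hy : q.OnHole j y) (h : q.SameVertex x y) : x = y := q.simple_disjoint i j x y hx hy h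

theorem sameVertex_next (q : HoledQuad D k) (x : D) : q.SameVertex (q.rev x) (q.next x) := by
  have := sameCycle_apply (q.next * q.rev) (q.rev x)
  rwa [Perm.mul_apply, q.rev_rev] at this

/-- No edge has holes on both sides. Otherwise simplicity and disjointness of the hole boundaries
force `x` and `rev x` to follow each other along their faces, so by connectedness the map is this
single edge, and its root is on a hole. -/
theorem OnHole.offHoles_rev [Finite D] {q : HoledQuad D k} {i : Fin k} {x : D}
    (hx : q.OnHole i x) : q.OffHoles (q.rev x) := by
  intro j hj
  have h1 : q.rev x = q.next x :=
    hj.eq_of_sameVertex (q.onHole_next_iff.2 hx) (q.sameVertex_next x)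
  have h2 : x = q.next (q.rev x) := by
    have := q.sameVertex_next (q.rev x)
    rw [q.rev_rev] at this
    exact hx.eq_of_sameVertex (q.onHole_next_iff.2 hj) this
  have := (q.toRootedMap.reroot x).induction (C := fun d => d = x ∨ d = q.rev x) (Or.inl rfl)
    (by
      rintro d (rfl | rfl)
      · exact Or.inr rfl
      · exact Or.inl (q.rev_rev x))
    (by
      rintro d (rfl | rfl)
      · exact Or.inr h1.symm
      · exact Or.inl h2.symm) q.root
  rcases this with h | h
  · exact q.offHoles_root i (h ▸ hx)
  · exact q.offHoles_root j (h ▸ hj)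

theorem offHoles_holeEdge [Finite D] (q : HoledQuad D k) (i : Fin k) (n : ℕ) :
    q.OffHoles (q.holeEdge i n) := (q.onHole_holeDart i n).offHoles_rev

theorem holeDart_eq_iff [Finite D] (q : HoledQuad D k) (i : Fin k) (m n : ℕ) :
    q.holeDart i m = q.holeDart i n ↔ m ≡ n [MOD q.holeDegree i] := symm_iterate_eq_iff _ _ _ _

theorem holeEdge_eq_iff [Finite D] (q : HoledQuad D k) (i : Fin k) (m n : ℕ) :
    q.holeEdge i m = q.holeEdge i n ↔ m ≡ n [MOD q.holeDegree i] := by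
  rw [← q.holeDart_eq_iff]; exact q.rev.injective.eq_iff

theorem exists_holeDart_of_not_offHoles [Finite D] (q : HoledQuad D k) {x : D}
    (h : ¬ q.OffHoles x) : ∃ i n, q.holeDart i n = x := by
  simp only [OffHoles, not_forall, not_not] at h
  obtain ⟨i, hi⟩ := h
  obtain ⟨n, hn⟩ := hi.exists_holeDart
  exact ⟨i, n, hn⟩

/-- A map with holes remains connected when the holes are not used to join oriented edges. -/
theorem induction_off_holes [Finite D] (q : HoledQuad D k) {C : D → Prop} (h0 : C q.root)
    (hrev : ∀ x, C x → C (q.rev x)) (hnext : ∀ x, q.OffHoles x → (C x ↔ C (q.next x))) (x : D) :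
    C x := by
  have hrev' : ∀ x, C (q.rev x) → C x := fun x h => by simpa [q.rev_rev] using hrev _ h
  refine q.toRootedMap.induction h0 hrev (fun x hx => ?_) x
  by_cases ho : q.OffHoles x
  · exact (hnext x ho).1 hx
  obtain ⟨i, n, rfl⟩ := q.exists_holeDart_of_not_offHoles ho
  set a := q.holeDart i n
  have ha : q.OnHole i (q.next a) := q.onHole_next_iff.2 (q.onHole_holeDart i n)
  by_contra hC
  -- Suppose that `C` fails at `next a` and turn around its starting vertex. A rotation step that
  -- crosses a hole lands on a hole dart at this vertex, which simplicity identifies with `next a`,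
  -- where `C` fails. All other steps preserve the failure. The rotation reaches `rev a`, where `C`
  -- holds.
  have := sameCycle_induction (C := fun z => ¬ C z) (q.sameVertex_next a).symm hC (fun z hz hCz => ?_)
  · exact this (hrev _ hx)
  · rw [Perm.mul_apply]
    by_cases hz' : q.OffHoles (q.rev z)
    · rw [← hnext _ hz']
      exact fun h => hCz (hrev' _ h)
    · simp only [OffHoles, not_forall, not_not] at hz'
      obtain ⟨j, hj⟩ := hz'
      have : q.next a = q.next (q.rev z) :=
        ha.eq_of_sameVertex (q.onHole_next_iff.2 hj) (hz.trans (sameCycle_apply _ z))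
      rwa [← this]

/-- The maps `f` and `g` identify `m` with the gluing of the `u i` into the holes of `q`. -/
structure IsGluingPair (q : HoledQuad D k) {E : Fin k → Type} (u : ∀ i, RootedMap (E i))
    {D' : Type} (m : RootedMap D') (f : D → D') (g : ∀ i, E i → D') : Prop where
  root : f q.root = m.root
  rev_left : ∀ x, f (q.rev x) = m.rev (f x)
  rev_right : ∀ i y, g i ((u i).rev y) = m.rev (g i y)
  boundary : ∀ i n, g i ((u i).next^[n] (u i).root) = f (q.holeEdge i n)
  next_left : ∀ x, q.OffHoles x → f (q.next x) = m.next (f x)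
  next_right : ∀ i y, ¬ (u i).OnRootFace y → g i ((u i).next y) = m.next (g i y)
  bijective : Function.Bijective (Sum.elim
      (fun x : {x : D // q.OffHoles x} => f x.1)
      (fun y : (Σ i, {y : E i // ¬ (u i).OnRootFace y}) => g y.1 y.2.1))

theorem isGluingMap_iff (q : HoledQuad D k) {E : Fin k → Type} (u : ∀ i, RootedMap (E i))
    {D' : Type} (m : RootedMap D') :
    q.IsGluingMap u m ↔ ∃ f g, q.IsGluingPair u m f g :=
  ⟨fun ⟨f, g, h1, h2, h3, h4, h5, h6, h7⟩ => ⟨f, g, h1, h2, h3, h4, h5, h6, h7⟩,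
    fun ⟨f, g, h1, h2, h3, h4, h5, h6, h7⟩ => ⟨f, g, h1, h2, h3, h4, h5, h6, h7⟩⟩

theorem numCycles_hole [Finite D] (q : HoledQuad D k) :
    numCycles (q.next.subtypePerm (p := fun x => ¬ q.OffHoles x)
      fun _ => not_congr q.offHoles_next_iff) = k := by
  have key : ∀ x : {x // ¬ q.OffHoles x}, ∃ i, q.OnHole i x.1 := fun x => by
    simpa [OffHoles] using x.2
  choose φ hφ using key
  have hm : ∀ i, ¬ q.OffHoles (q.rev (q.mark i)) := fun i h => h i SameCycle.rfl
  rw [numCycles_eq_card_of_label φ (fun i => ⟨q.rev (q.mark i), hm i⟩), Nat.card_fin]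
  · exact fun x => (hφ _).unique (q.onHole_next_iff.2 (hφ x))
  · intro x
    rw [sameCycle_subtypePerm]
    exact hφ x
  · exact fun i => (hφ _).unique SameCycle.rfl

end HoledQuad

theorem RootedMap.numCycles_rootFace {D : Type} [Finite D] (M : RootedMap D) :
    numCycles (M.next.subtypePerm (p := fun x => M.OnRootFace x)
      fun _ => M.onRootFace_next_iff) = 1 := by
  rw [numCycles_eq_card_of_label (fun _ => ()) (fun _ => ⟨M.root, SameCycle.rfl⟩)]
  · simp
  · simp
  · intro x
    rw [sameCycle_subtypePerm]
    exact x.2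
  · simp

theorem RootedMap.numCycles_innerFaces {D : Type} [Finite D] (M : RootedMap D) :
    numCycles (M.next.subtypePerm (p := fun x => ¬ M.OnRootFace x)
      fun _ => not_congr M.onRootFace_next_iff) = M.numInnerFaces := by
  have := numCycles_subtype_add M.next (fun x => M.OnRootFace x) fun _ => M.onRootFace_next_iff
  rw [M.numCycles_rootFace, M.numCycles_next] at this
  omega

namespace HoledQuad

variable {D : Type} {k : ℕ} {q : HoledQuad D k}
  {E : Fin k → Type} {u : ∀ i, RootedMap (E i)}
  {D' : Type} {m : RootedMap D'} {f : D → D'} {g : ∀ i, E i → D'}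

/-- The order along the faces of a gluing, on the oriented edges that are not glued away. -/
def glueNext (q : HoledQuad D k) (u : ∀ i, RootedMap (E i)) :
    Perm ({x : D // q.OffHoles x} ⊕ Σ i, {y : E i // ¬ (u i).OnRootFace y}) :=
  Equiv.sumCongr (q.next.subtypePerm (p := fun x => q.OffHoles x) fun _ => q.offHoles_next_iff)
    (Equiv.sigmaCongrRight fun i => (u i).next.subtypePerm (p := fun y => ¬ (u i).OnRootFace y)
      fun _ => not_congr (u i).onRootFace_next_iff)

namespace IsGluingPair

theorem left_injective (h : q.IsGluingPair u m f g) {x x' : D} (hx : q.OffHoles x)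
    (hx' : q.OffHoles x') (he : f x = f x') : x = x' := by
  have := h.bijective.1 (a₁ := (.inl ⟨x, hx⟩)) (a₂ := (.inl ⟨x', hx'⟩)) he
  simpa using this

theorem right_injective (h : q.IsGluingPair u m f g) {i : Fin k} {y y' : E i}
    (hy : ¬ (u i).OnRootFace y) (hy' : ¬ (u i).OnRootFace y') (he : g i y = g i y') : y = y' := by
  have := h.bijective.1 (a₁ := (.inr ⟨i, y, hy⟩)) (a₂ := (.inr ⟨i, y', hy'⟩)) he
  simpa using this

theorem left_ne_right (h : q.IsGluingPair u m f g) {x : D} (hx : q.OffHoles x) {i : Fin k}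
    {y : E i} (hy : ¬ (u i).OnRootFace y) : f x ≠ g i y := fun he => by
  have := h.bijective.1 (a₁ := (.inl ⟨x, hx⟩)) (a₂ := (.inr ⟨i, y, hy⟩)) he
  simp at this

theorem cases (h : q.IsGluingPair u m f g) (z : D') :
    (∃ x, q.OffHoles x ∧ f x = z) ∨ ∃ i y, ¬ (u i).OnRootFace y ∧ g i y = z := by
  obtain ⟨x | y, rfl⟩ := h.bijective.2 z
  · exact Or.inl ⟨x.1, x.2, rfl⟩
  · exact Or.inr ⟨y.1, y.2.1, y.2.2, rfl⟩

theorem left_holeDart (h : q.IsGluingPair u m f g) (i : Fin k) (n : ℕ) :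
    f (q.holeDart i n) = g i ((u i).rev ((u i).next^[n] (u i).root)) := by
  rw [← q.rev_holeEdge, h.rev_left, ← h.boundary, h.rev_right]

end IsGluingPair

variable [Finite D]

theorem numCycles_offHoles (q : HoledQuad D k) :
    numCycles q.next = numCycles (q.next.subtypePerm (p := fun x => q.OffHoles x)
      fun _ => q.offHoles_next_iff) + k := by
  have := numCycles_subtype_add q.next (fun x => q.OffHoles x) fun _ => q.offHoles_next_iff
  rwa [q.numCycles_hole] at this

theorem numCycles_glueNext [∀ i, Finite (E i)] (q : HoledQuad D k) (u : ∀ i, RootedMap (E i)) :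
    numCycles (q.glueNext u) + k = numCycles q.next + ∑ i, (u i).numInnerFaces := by
  rw [glueNext, numCycles_sumCongr, numCycles_sigmaCongrRight, q.numCycles_offHoles]
  simp only [RootedMap.numCycles_innerFaces]
  omega

namespace IsGluingPair

variable [∀ i, Finite (E i)] [Finite D']

/-- The bijection of the gluing carries `glueNext` to the order along the faces of `m`. Its cycles
are the faces of `q` that are not holes and the internal faces of the `u i`; the `k` on the left
compensates for the holes counted in `q.numInnerFaces`. -/
theorem numInnerFaces_add (h : q.IsGluingPair u m f g) :
    m.numInnerFaces + k = q.numInnerFaces + ∑ i, (u i).numInnerFaces := by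
  have h1 := q.numCycles_glueNext u
  have h2 := numCycles_congr (p := q.glueNext u) (p' := m.next)
    (Equiv.ofBijective _ h.bijective) (by
      rintro (x | ⟨i, y⟩)
      · exact h.next_left x.1 x.2
      · exact h.next_right i y.1 y.2)
  rw [h2, m.numCycles_next, q.toRootedMap.numCycles_next] at h1
  omega

theorem faceDegree_left (h : q.IsGluingPair u m f g) {x : D} (hx : q.OffHoles x) :
    m.faceDegree (f x) = q.faceDegree x := by
  have key : ∀ z, q.next.SameCycle x z → q.OffHoles z := fun z hz =>
    sameCycle_induction hz hx fun w _ hw => q.offHoles_next_iff.2 hw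
  exact ncard_cycle_map (fun z hz => h.next_left z (key z hz))
    fun y z hy hz => h.left_injective (key y hy) (key z hz)

theorem faceDegree_right (h : q.IsGluingPair u m f g) {i : Fin k} {y : E i}
    (hy : ¬ (u i).OnRootFace y) : m.faceDegree (g i y) = (u i).faceDegree y := by
  have key : ∀ z, (u i).next.SameCycle y z → ¬ (u i).OnRootFace z := fun z hz =>
    sameCycle_induction (C := fun z => ¬ (u i).OnRootFace z) hz hy fun w _ hw => mt ((u i).onRootFace_next_iff (d := w)).1 hw
  exact ncard_cycle_map (fun z hz => h.next_right i z (key z hz))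
    fun z w hz hw => h.right_injective (key z hz) (key w hw)

theorem perimeter_eq (h : q.IsGluingPair u m f g) : m.perimeter = q.perimeter := by
  rw [RootedMap.perimeter, ← h.root, h.faceDegree_left q.offHoles_root]; rfl

theorem isQuad (h : q.IsGluingPair u m f g) {ℓ : ℕ} (hq : q.perimeter = 2 * ℓ) {L : Fin k → ℕ}
    (hu : ∀ i, (u i).IsQuad (L i)) : m.IsQuad ℓ := by
  refine ⟨h.perimeter_eq.trans hq, fun z hz => ?_⟩
  rcases h.cases z with ⟨x, hx, rfl⟩ | ⟨i, y, hy, rfl⟩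
  · rw [h.faceDegree_left hx]
    refine q.faceDegree_eq x (fun hr => hz ?_) hx
    refine sameCycle_induction (C := fun x => m.OnRootFace (f x)) hr ?_ ?_
    · rw [h.root]; exact SameCycle.rfl
    · intro w hw hw'
      rw [h.next_left w (q.offHoles_of_onRootFace hw)]
      exact m.onRootFace_next_iff.2 hw'
  · rw [h.faceDegree_right hy]
    exact (hu i).2 y hy

end IsGluingPair

/-! ### Uniqueness of the gluing and of the fillings -/

variable [∀ i, Finite (E i)] [Finite D']

theorem IsGluingPair.congr {E' : Fin k → Type} [∀ i, Finite (E' i)] {u' : ∀ i, RootedMap (E' i)}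
    {D'' : Type} {m' : RootedMap D''} (h : q.IsGluingPair u m f g) (hu : ∀ i, (u' i).Iso (u i))
    (hm : m.Iso m') : q.IsGluingMap u' m' := by
  choose e e1 e2 e3 using hu
  obtain ⟨e', e1', e2', e3'⟩ := hm
  have hroot : ∀ i y, (u i).OnRootFace (e i y) ↔ (u' i).OnRootFace y := fun i y => by
    have := sameCycle_map_iff (e i) (e2 i) (x := (u' i).root) (y := y)
    rwa [e3] at this
  have hit : ∀ i n, e i ((u' i).next^[n] (u' i).root) = (u i).next^[n] (u i).root := fun i n => by
    induction n with
    | zero => exact e3 i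
    | succ n ih => rw [Function.iterate_succ_apply', e2, ih, Function.iterate_succ_apply']
  rw [isGluingMap_iff]
  refine ⟨fun x => e' (f x), fun i y => e' (g i (e i y)), ?_, ?_, ?_, ?_, ?_, ?_, ?_⟩
  · rw [h.root, e3']
  · intro x; rw [h.rev_left, e1']
  · intro i y; rw [e1, h.rev_right, e1']
  · intro i n; rw [hit, h.boundary]
  · intro x hx; rw [h.next_left x hx, e2']
  · intro i y hy; rw [e2, h.next_right i _ (mt (hroot i y).1 hy), e2']
  · let ε : ({x : D // q.OffHoles x} ⊕ Σ i, {y : E' i // ¬ (u' i).OnRootFace y}) ≃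
        ({x : D // q.OffHoles x} ⊕ Σ i, {y : E i // ¬ (u i).OnRootFace y}) :=
      Equiv.sumCongr (Equiv.refl _) (Equiv.sigmaCongrRight fun i =>
        (e i).subtypeEquiv fun y => not_congr (hroot i y).symm)
    convert e'.bijective.comp (h.bijective.comp ε.bijective) using 1
    funext z
    rcases z with x | ⟨i, y⟩ <;> rfl

/-- A gluing is determined by the maps that are glued. -/
theorem IsGluingPair.iso {D'' : Type} {m' : RootedMap D''} {f' : D → D''} {g' : ∀ i, E i → D''}
    (h : q.IsGluingPair u m f g) (h' : q.IsGluingPair u m' f' g') : m.Iso m' := by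
  -- The surviving darts index both gluings. The other values are forced: those of `g i` on the root
  -- face of `u i` through the hole edges, then those of `f` on the hole darts by reversal.
  let e := (Equiv.ofBijective _ h.bijective).symm.trans (Equiv.ofBijective _ h'.bijective)
  have ef : ∀ x, q.OffHoles x → e (f x) = f' x := by
    intro x hx
    have : (Equiv.ofBijective _ h.bijective).symm (f x) = .inl ⟨x, hx⟩ := by
      rw [symm_apply_eq]; rfl
    simp [e, this]
  have eg : ∀ i y, e (g i y) = g' i y := by
    intro i y
    by_cases hy : (u i).OnRootFace y
    · obtain ⟨n, rfl⟩ := hy.exists_iterate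
      rw [h.boundary, ef _ (q.offHoles_holeEdge i n), h'.boundary]
    · have : (Equiv.ofBijective _ h.bijective).symm (g i y) = .inr ⟨i, y, hy⟩ := by
        rw [symm_apply_eq]; rfl
      simp [e, this]
  have ef' : ∀ x, e (f x) = f' x := by
    intro x
    by_cases hx : q.OffHoles x
    · exact ef x hx
    · obtain ⟨i, n, rfl⟩ := q.exists_holeDart_of_not_offHoles hx
      rw [h.left_holeDart, eg, h'.left_holeDart]
  refine ⟨e, fun z => ?_, fun z => ?_, ?_⟩
  · rcases h.cases z with ⟨x, -, rfl⟩ | ⟨i, y, -, rfl⟩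
    · rw [← h.rev_left, ef', ef', h'.rev_left]
    · rw [← h.rev_right, eg, eg, h'.rev_right]
  · rcases h.cases z with ⟨x, hx, rfl⟩ | ⟨i, y, hy, rfl⟩
    · rw [← h.next_left x hx, ef', ef', h'.next_left x hx]
    · rw [← h.next_right i y hy, eg, eg, h'.next_right i y hy]
  · rw [← h.root, ef', h'.root]

/-- The map `q` is found in only one way in a map that contains it. -/
theorem IsGluingPair.left_unique {E' : Fin k → Type} {u' : ∀ i, RootedMap (E' i)} {f' : D → D'}
    {g' : ∀ i, E' i → D'} (h : q.IsGluingPair u m f g) (h' : q.IsGluingPair u' m f' g') (x : D) :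
    f x = f' x := by
  -- Values propagate from the root by `rev`, and by `next` off the holes only: along a hole, `f` is
  -- not assumed to commute with `next`.
  refine q.induction_off_holes (C := fun x => f x = f' x) ?_ ?_ ?_ x
  · rw [h.root, h'.root]
  · intro x hx
    rw [h.rev_left, h'.rev_left, hx]
  · intro x hx
    rw [h.next_left x hx, h'.next_left x hx]
    exact m.next.injective.eq_iff.symm

/-- Oriented edges of two maps, glued in the same hole of `q`, that become the same oriented edge
and have the same place on the boundary. -/
def FillingRel {F F' : Type} (M : RootedMap F) (M' : RootedMap F') (γ : F → D') (γ' : F' → D')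
    (y : F) (y' : F') : Prop :=
  γ y = γ' y' ∧ ((¬ M.OnRootFace y ∧ ¬ M'.OnRootFace y') ∨
    ∃ n, y = M.next^[n] M.root ∧ y' = M'.next^[n] M'.root)

theorem FillingRel.symm {F F' : Type} {M : RootedMap F} {M' : RootedMap F'} {γ : F → D'}
    {γ' : F' → D'} {y : F} {y' : F'} (h : FillingRel M M' γ γ' y y') :
    FillingRel M' M γ' γ y' y :=
  ⟨h.1.symm, h.2.imp And.symm fun ⟨n, h1, h2⟩ => ⟨n, h2, h1⟩⟩

section Filling

variable {E' : Fin k → Type} [∀ i, Finite (E' i)] {u' : ∀ i, RootedMap (E' i)} {f' : D → D'}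
  {g' : ∀ i, E' i → D'}

theorem IsGluingPair.fillingRel_iterate (h : q.IsGluingPair u m f g)
    (h' : q.IsGluingPair u' m f' g') (i : Fin k) (n : ℕ) :
    FillingRel (u i) (u' i) (g i) (g' i) ((u i).next^[n] (u i).root)
      ((u' i).next^[n] (u' i).root) :=
  ⟨by rw [h.boundary, h'.boundary, h.left_unique h'], Or.inr ⟨n, rfl, rfl⟩⟩

/-- The point is that a place on the boundary of the hole can be read off in `m`: images of darts
off the holes differ from images of internal darts of a filling, and two hole edges with the same
image have indices congruent modulo the degree of the hole. -/
theorem IsGluingPair.fillingRel_rev (h : q.IsGluingPair u m f g) (h' : q.IsGluingPair u' m f' g')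
    (hu' : ∀ i, (u' i).perimeter = q.holeDegree i) {i : Fin k} {y : E i} {y' : E' i}
    (hy : FillingRel (u i) (u' i) (g i) (g' i) y y') :
    FillingRel (u i) (u' i) (g i) (g' i) ((u i).rev y) ((u' i).rev y') := by
  have hr : g i ((u i).rev y) = g' i ((u' i).rev y') := by
    rw [h.rev_right, h'.rev_right, hy.1]
  refine ⟨hr, ?_⟩
  by_cases h1 : (u i).OnRootFace ((u i).rev y) <;> by_cases h2 : (u' i).OnRootFace ((u' i).rev y')
  · obtain ⟨n, hn⟩ := h1.exists_iterate
    obtain ⟨n', hn'⟩ := h2.exists_iterate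
    rw [← hn, ← hn', h.boundary, h'.boundary, ← h.left_unique h'] at hr
    have := h.left_injective (q.offHoles_holeEdge i n) (q.offHoles_holeEdge i n') hr
    rw [q.holeEdge_eq_iff, ← hu', ← RootedMap.next_iterate_eq_iff] at this
    exact Or.inr ⟨n, hn.symm, by rw [this, hn']⟩
  · obtain ⟨n, hn⟩ := h1.exists_iterate
    rw [← hn, h.boundary, h.left_unique h'] at hr
    exact absurd hr (h'.left_ne_right (q.offHoles_holeEdge i n) h2)
  · obtain ⟨n, hn⟩ := h2.exists_iterate
    rw [← hn, h'.boundary, ← h.left_unique h'] at hr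
    exact absurd hr.symm (h.left_ne_right (q.offHoles_holeEdge i n) h1)
  · exact Or.inl ⟨h1, h2⟩

theorem IsGluingPair.fillingRel_next (h : q.IsGluingPair u m f g) (h' : q.IsGluingPair u' m f' g')
    {i : Fin k} {y : E i} {y' : E' i} (hy : FillingRel (u i) (u' i) (g i) (g' i) y y') :
    FillingRel (u i) (u' i) (g i) (g' i) ((u i).next y) ((u' i).next y') := by
  rcases hy with ⟨hy, ⟨h1, h2⟩ | ⟨n, rfl, rfl⟩⟩
  · exact ⟨by rw [h.next_right i y h1, h'.next_right i y' h2, hy],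
      Or.inl ⟨mt (u i).onRootFace_next_iff.1 h1, mt (u' i).onRootFace_next_iff.1 h2⟩⟩
  · have := h.fillingRel_iterate h' i (n + 1)
    rwa [Function.iterate_succ_apply', Function.iterate_succ_apply'] at this

theorem IsGluingPair.exists_fillingRel (h : q.IsGluingPair u m f g)
    (h' : q.IsGluingPair u' m f' g') (hu' : ∀ i, (u' i).perimeter = q.holeDegree i)
    (i : Fin k) (y : E i) : ∃ y', FillingRel (u i) (u' i) (g i) (g' i) y y' :=
  (u i).induction (C := fun y => ∃ y', FillingRel (u i) (u' i) (g i) (g' i) y y')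
    ⟨_, h.fillingRel_iterate h' i 0⟩ (fun _ ⟨_, hy⟩ => ⟨_, h.fillingRel_rev h' hu' hy⟩)
    (fun _ ⟨_, hy⟩ => ⟨_, h.fillingRel_next h' hy⟩) y

theorem IsGluingPair.fillingRel_unique (h' : q.IsGluingPair u' m f' g')
    (hu : ∀ i, (u i).perimeter = q.holeDegree i) (hu' : ∀ i, (u' i).perimeter = q.holeDegree i)
    {i : Fin k} {y : E i} {y₁ y₂ : E' i} (h₁ : FillingRel (u i) (u' i) (g i) (g' i) y y₁)
    (h₂ : FillingRel (u i) (u' i) (g i) (g' i) y y₂) : y₁ = y₂ := by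
  rcases h₁ with ⟨h1, ⟨h2, h3⟩ | ⟨n, rfl, rfl⟩⟩ <;> rcases h₂ with ⟨h4, ⟨h5, h6⟩ | ⟨n', h5, rfl⟩⟩
  · exact h'.right_injective h3 h6 (h1.symm.trans h4)
  · exact absurd (h5 ▸ (u i).onRootFace_iterate n') h2
  · exact absurd ((u i).onRootFace_iterate n) h5
  · rwa [RootedMap.next_iterate_eq_iff, hu', ← hu, ← RootedMap.next_iterate_eq_iff]

/-- The map glued in a hole is determined by the gluing. -/
theorem IsGluingPair.filling_iso (h : q.IsGluingPair u m f g) (h' : q.IsGluingPair u' m f' g')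
    (hu : ∀ i, (u i).perimeter = q.holeDegree i) (hu' : ∀ i, (u' i).perimeter = q.holeDegree i)
    (i : Fin k) : (u i).Iso (u' i) := by
  choose φ hφ using h.exists_fillingRel h' hu' i
  have hbij : Function.Bijective φ := by
    refine ⟨fun y₁ y₂ he => ?_, fun y' => ?_⟩
    · exact h.fillingRel_unique hu' hu (hφ y₁).symm (he ▸ (hφ y₂).symm)
    · obtain ⟨y, hy⟩ := h'.exists_fillingRel h hu i y'
      exact ⟨y, h'.fillingRel_unique hu hu' (hφ y) hy.symm⟩
  refine ⟨Equiv.ofBijective φ hbij, fun y => ?_, fun y => ?_, ?_⟩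
  · exact h'.fillingRel_unique hu hu' (hφ _) (h.fillingRel_rev h' hu' (hφ y))
  · exact h'.fillingRel_unique hu hu' (hφ _) (h.fillingRel_next h' (hφ y))
  · exact h'.fillingRel_unique hu hu' (hφ _) (h.fillingRel_iterate h' i 0)

end Filling

end HoledQuad

/-! ### Existence and planarity of gluings -/

namespace HoledQuad

section VertexOffHoles

variable {D : Type} {k : ℕ} {q : HoledQuad D k}

/-- The starting vertex of `x` is on the boundary of no hole. -/
def VertexOffHoles (q : HoledQuad D k) (x : D) : Prop :=
  ∀ i n, ¬ q.SameVertex (q.holeDart i n) x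

theorem vertexOffHoles_iff (q : HoledQuad D k) (x : D) :
    q.VertexOffHoles ((q.next * q.rev) x) ↔ q.VertexOffHoles x :=
  forall_congr' fun _ => forall_congr' fun _ => not_congr sameCycle_apply_right

theorem exists_holeDart_of_not_vertexOffHoles {x : D} (h : ¬ q.VertexOffHoles x) :
    ∃ i n, q.SameVertex (q.holeDart i n) x := by
  simpa only [VertexOffHoles, not_forall, not_not] using h

variable [Finite D]

theorem VertexOffHoles.offHoles {x : D} (h : q.VertexOffHoles x) : q.OffHoles x := fun i hi => by
  obtain ⟨n, rfl⟩ := hi.exists_holeDart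
  exact h i n SameCycle.rfl

theorem VertexOffHoles.offHoles_rev {x : D} (h : q.VertexOffHoles x) : q.OffHoles (q.rev x) :=
  fun i hi => (((q.vertexOffHoles_iff x).2 h).offHoles) i (q.onHole_next_iff.2 hi)

/-- The vertices of the holes are as many as the oriented edges along the holes. -/
theorem numCycles_vertex_holes (q : HoledQuad D k) :
    numCycles ((q.next * q.rev).subtypePerm (p := fun x => ¬ q.VertexOffHoles x)
      fun x => not_congr (q.vertexOffHoles_iff x)) = Nat.card {x // ¬ q.OffHoles x} := by
  have key : ∀ x : {x // ¬ q.VertexOffHoles x}, ∃ a : {x // ¬ q.OffHoles x},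
      q.SameVertex a x.1 := fun ⟨x, hx⟩ => by
    simp only [VertexOffHoles, not_forall, not_not] at hx
    obtain ⟨i, n, h⟩ := hx
    exact ⟨⟨q.holeDart i n, fun h => h i (q.onHole_holeDart i n)⟩, h⟩
  choose φ hφ using key
  have uniq : ∀ a b : {x // ¬ q.OffHoles x}, q.SameVertex a b → a = b := by
    rintro ⟨a, ha⟩ ⟨b, hb⟩ h
    simp only [OffHoles, not_forall, not_not] at ha hb
    obtain ⟨i, hi⟩ := ha
    obtain ⟨j, hj⟩ := hb
    exact Subtype.ext (hi.eq_of_sameVertex hj h)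
  refine numCycles_eq_card_of_label φ (fun a => ⟨a.1, fun h => a.2 h.offHoles⟩)
    (fun x => ?_) (fun x => ?_) fun a => ?_
  · refine uniq _ _ ?_
    have h1 := hφ x
    have h2 := hφ (((q.next * q.rev).subtypePerm (p := fun x => ¬ q.VertexOffHoles x)
      fun x => not_congr (q.vertexOffHoles_iff x)) x)
    rw [subtypePerm_apply] at h2
    exact h2.trans (SameCycle.symm (h1.trans (sameCycle_apply _ _)))
  · rw [sameCycle_subtypePerm]
    exact hφ x
  · exact uniq _ _ (hφ _)

end VertexOffHoles

section Existence

variable {D : Type} [Finite D] {k : ℕ} (q : HoledQuad D k)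
  {E : Fin k → Type} [∀ i, Finite (E i)] (u : ∀ i, RootedMap (E i))

/-- The oriented edges of the gluing of the `u i` into the holes of `q`. -/
abbrev GluedDart : Type := {x : D // q.OffHoles x} ⊕ Σ i, {y : E i // ¬ (u i).OnRootFace y}

open Classical in
/-- The place in the gluing of an oriented edge of `u i`. -/
noncomputable def glueInner (i : Fin k) (y : E i) : q.GluedDart u :=
  if h : (u i).OnRootFace y then
    .inl ⟨q.holeEdge i h.exists_iterate.choose, q.offHoles_holeEdge i _⟩
  else .inr ⟨i, y, h⟩

open Classical in
/-- The place in the gluing of an oriented edge of `q`. -/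
noncomputable def glueOuter (x : D) : q.GluedDart u :=
  if h : q.OffHoles x then .inl ⟨x, h⟩
  else
    let i := (q.exists_holeDart_of_not_offHoles h).choose
    let n := (q.exists_holeDart_of_not_offHoles h).choose_spec.choose
    q.glueInner u i ((u i).rev ((u i).next^[n] (u i).root))

variable {q u}

theorem glueInner_of_not {i : Fin k} {y : E i} (h : ¬ (u i).OnRootFace y) :
    q.glueInner u i y = .inr ⟨i, y, h⟩ := dif_neg h

theorem glueOuter_of_offHoles {x : D} (h : q.OffHoles x) : q.glueOuter u x = .inl ⟨x, h⟩ :=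
  dif_pos h

theorem glueNext_glueOuter {x : D} (hx : q.OffHoles x) :
    q.glueNext u (q.glueOuter u x) = q.glueOuter u (q.next x) := by
  rw [glueOuter_of_offHoles hx, glueOuter_of_offHoles (q.offHoles_next_iff.2 hx)]; rfl

theorem glueNext_glueInner {i : Fin k} {y : E i} (hy : ¬ (u i).OnRootFace y) :
    q.glueNext u (q.glueInner u i y) = q.glueInner u i ((u i).next y) := by
  rw [glueInner_of_not hy, glueInner_of_not (mt (u i).onRootFace_next_iff.1 hy)]; rfl

theorem holeDart_eq_holeDart (hu : ∀ i, (u i).perimeter = q.holeDegree i) {i j : Fin k} {m n : ℕ}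
    (h : q.holeDart i m = q.holeDart j n) :
    (⟨i, (u i).next^[m] (u i).root⟩ : Σ i, E i) = ⟨j, (u j).next^[n] (u j).root⟩ := by
  obtain rfl : i = j := (q.onHole_holeDart i m).unique (h ▸ q.onHole_holeDart j n)
  rw [q.holeDart_eq_iff, ← hu, ← RootedMap.next_iterate_eq_iff] at h
  rw [h]

variable (hu : ∀ i, (u i).perimeter = q.holeDegree i)
include hu

theorem glueInner_iterate (i : Fin k) (n : ℕ) : q.glueInner u i ((u i).next^[n] (u i).root) =
    .inl ⟨q.holeEdge i n, q.offHoles_holeEdge i n⟩ := by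
  have h := (u i).onRootFace_iterate n
  rw [glueInner, dif_pos h]
  have := h.exists_iterate.choose_spec
  rw [RootedMap.next_iterate_eq_iff, hu, ← q.holeEdge_eq_iff] at this
  simp [this]

theorem glueOuter_holeDart (i : Fin k) (n : ℕ) : q.glueOuter u (q.holeDart i n) =
    q.glueInner u i ((u i).rev ((u i).next^[n] (u i).root)) := by
  have h : ¬ q.OffHoles (q.holeDart i n) := fun h => h i (q.onHole_holeDart i n)
  rw [glueOuter, dif_neg h]
  have := (q.exists_holeDart_of_not_offHoles h).choose_spec.choose_spec
  exact congrArg (fun z : Σ i, E i => q.glueInner u z.1 ((u z.1).rev z.2))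
    (holeDart_eq_holeDart hu this)

omit hu in
variable (q u) in
/-- The reversal of oriented edges in the gluing. -/
noncomputable def glueRev : q.GluedDart u → q.GluedDart u :=
  Sum.elim (fun x => q.glueOuter u (q.rev x.1)) (fun y => q.glueInner u y.1 ((u y.1).rev y.2.1))

theorem glueRev_glueInner (i : Fin k) (y : E i) :
    q.glueRev u (q.glueInner u i y) = q.glueInner u i ((u i).rev y) := by
  by_cases hy : (u i).OnRootFace y
  · obtain ⟨n, rfl⟩ := hy.exists_iterate
    rw [glueInner_iterate hu, glueRev, Sum.elim_inl, q.rev_holeEdge, glueOuter_holeDart hu]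
  · rw [glueInner_of_not hy]; rfl

theorem glueRev_glueOuter (x : D) : q.glueRev u (q.glueOuter u x) = q.glueOuter u (q.rev x) := by
  by_cases hx : q.OffHoles x
  · rw [glueOuter_of_offHoles hx]; rfl
  · obtain ⟨i, n, rfl⟩ := q.exists_holeDart_of_not_offHoles hx
    rw [glueOuter_holeDart hu, glueRev_glueInner hu, (u i).rev_rev, glueInner_iterate hu,
      q.rev_holeDart, glueOuter_of_offHoles]

theorem glueRev_glueRev (z : q.GluedDart u) : q.glueRev u (q.glueRev u z) = z := by
  rcases z with ⟨x, hx⟩ | ⟨i, y, hy⟩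
  · rw [← glueOuter_of_offHoles hx, glueRev_glueOuter hu, glueRev_glueOuter hu, q.rev_rev]
  · rw [← glueInner_of_not hy, glueRev_glueInner hu, glueRev_glueInner hu, (u i).rev_rev]

theorem glueInner_rev_ne (i : Fin k) (y : E i) :
    q.glueInner u i ((u i).rev y) ≠ q.glueInner u i y := by
  intro h
  apply (u i).rev_ne y
  by_cases h1 : (u i).OnRootFace ((u i).rev y) <;> by_cases h2 : (u i).OnRootFace y
  · obtain ⟨n, hn⟩ := h1.exists_iterate
    obtain ⟨m, hm⟩ := h2.exists_iterate
    rw [← hn, ← hm, glueInner_iterate hu, glueInner_iterate hu] at h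
    simp only [Sum.inl.injEq, Subtype.mk.injEq] at h
    rw [q.holeEdge_eq_iff, ← hu, ← RootedMap.next_iterate_eq_iff] at h
    rw [← hn, ← hm, h]
  · obtain ⟨n, hn⟩ := h1.exists_iterate
    rw [← hn, glueInner_iterate hu, glueInner_of_not h2] at h
    cases h
  · obtain ⟨m, hm⟩ := h2.exists_iterate
    rw [← hm, glueInner_iterate hu, hm, glueInner_of_not h1] at h
    cases h
  · rw [glueInner_of_not h1, glueInner_of_not h2] at h
    simpa using h

theorem glueRev_ne (z : q.GluedDart u) : q.glueRev u z ≠ z := by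
  rcases z with ⟨x, hx⟩ | ⟨i, y, hy⟩
  · by_cases hx' : q.OffHoles (q.rev x)
    · rw [glueRev, Sum.elim_inl, glueOuter_of_offHoles hx']
      simpa using q.rev_ne x
    · obtain ⟨i, n, hn⟩ := q.exists_holeDart_of_not_offHoles hx'
      have hx2 : x = q.holeEdge i n := by rw [← q.rev_holeDart, hn, q.rev_rev]
      subst hx2
      rw [← glueInner_iterate hu, glueRev_glueInner hu]
      exact glueInner_rev_ne hu i _
  · rw [← glueInner_of_not hy, glueRev_glueInner hu]
    exact glueInner_rev_ne hu i y

/-- The reversal of oriented edges in the gluing, as a permutation. -/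
noncomputable def glueRevPerm : Perm (q.GluedDart u) :=
  Function.Involutive.toPerm (q.glueRev u) (glueRev_glueRev hu)

theorem glueRevPerm_apply (z : q.GluedDart u) : glueRevPerm hu z = q.glueRev u z := rfl

/-- The rotation around a vertex of a hole goes on in the gluing up to the next edge of the
hole. -/
theorem sameCycle_glueOuter {i : Fin k} {n : ℕ} {x : D} (h : q.SameVertex (q.holeDart i n) x) :
    (q.glueNext u * glueRevPerm hu).SameCycle (q.glueOuter u x)
      (q.glueInner u i ((u i).next^[n + 1] (u i).root)) := by
  have key : ∀ x, q.SameVertex (q.holeDart i n) x → (q.glueNext u * glueRevPerm hu).SameCycle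
      (q.glueOuter u (q.holeDart i n)) (q.glueOuter u x) := by
    intro x hx
    refine sameCycle_induction (C := fun x => (q.glueNext u * glueRevPerm hu).SameCycle
      (q.glueOuter u (q.holeDart i n)) (q.glueOuter u x)) hx SameCycle.rfl ?_
    intro z hz hCz
    by_cases hz' : q.OffHoles (q.rev z)
    · have := sameCycle_apply (q.glueNext u * glueRevPerm hu) (q.glueOuter u z)
      rw [Perm.mul_apply, glueRevPerm_apply, glueRev_glueOuter hu, glueNext_glueOuter hz']
        at this
      exact hCz.trans this
    -- The rotation in `q` crosses a hole only to return to its starting dart, so nothing is to be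
    -- joined there.
    · obtain ⟨j, hj⟩ := by simpa [OffHoles] using hz'
      have : q.holeDart i n = q.next (q.rev z) :=
        (q.onHole_holeDart i n).eq_of_sameVertex (q.onHole_next_iff.2 hj)
          (hz.trans (sameCycle_apply _ z))
      rw [Perm.mul_apply, ← this]
  rw [glueInner_iterate hu, ← glueOuter_of_offHoles]
  refine (key x h).symm.trans (key _ ?_)
  have := q.sameVertex_next (q.holeDart i (n + 1))
  rw [q.next_holeDart_succ] at this
  exact SameCycle.symm this

/-- This is one step of the rotation in `u i`. Where it passes through the root face, the gluing
inserts the darts of `q` around the corresponding hole vertex, up to the next hole edge. -/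
theorem sameCycle_glueInner (i : Fin k) (y : E i) :
    (q.glueNext u * glueRevPerm hu).SameCycle (q.glueInner u i y)
      (q.glueInner u i ((u i).next ((u i).rev y))) := by
  have h := sameCycle_apply (q.glueNext u * glueRevPerm hu) (q.glueInner u i y)
  rw [Perm.mul_apply, glueRevPerm_apply, glueRev_glueInner hu] at h
  by_cases hy : (u i).OnRootFace ((u i).rev y)
  · obtain ⟨n, hn⟩ := hy.exists_iterate
    rw [← hn, glueInner_iterate hu, ← glueOuter_of_offHoles, glueNext_glueOuter
      (q.offHoles_holeEdge i n)] at h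
    rw [← hn, ← Function.iterate_succ_apply' (u i).next]
    refine h.trans (sameCycle_glueOuter hu ?_)
    have := sameCycle_apply (q.next * q.rev) (q.holeDart i n)
    exact this
  · rwa [glueNext_glueInner hy] at h

open Classical in
omit hu in
variable (q u) in
/-- The vertex of an oriented edge of the gluing, as a vertex of `q` that is on no hole or as
a vertex of one of the `u i`. -/
noncomputable def glueVertex : q.GluedDart u → {x : D // q.VertexOffHoles x} ⊕ Σ i, E i :=
  Sum.elim (fun x => if h : q.VertexOffHoles x.1 then .inl ⟨x.1, h⟩ else
    let i := (exists_holeDart_of_not_vertexOffHoles h).choose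
    let n := (exists_holeDart_of_not_vertexOffHoles h).choose_spec.choose
    -- The hole dart `n` starts where the hole edge `n` ends, that is, where the hole edge `n + 1`
    -- starts.
    .inr ⟨i, (u i).next^[n + 1] (u i).root⟩) fun y => .inr ⟨y.1, y.2.1⟩

omit hu in
theorem glueVertex_of_vertexOffHoles {x : D} (h : q.VertexOffHoles x) :
    q.glueVertex u (q.glueOuter u x) = .inl ⟨x, h⟩ := by
  rw [glueOuter_of_offHoles h.offHoles]; exact dif_pos h

theorem glueVertex_of_sameVertex {i : Fin k} {n : ℕ} {x : D} (hx : q.OffHoles x)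
    (h : q.SameVertex (q.holeDart i n) x) :
    q.glueVertex u (q.glueOuter u x) = .inr ⟨i, (u i).next^[n + 1] (u i).root⟩ := by
  have hv : ¬ q.VertexOffHoles x := fun hv => hv i n h
  rw [glueOuter_of_offHoles hx]
  refine (dif_neg hv).trans (congrArg Sum.inr ?_)
  have hs := (exists_holeDart_of_not_vertexOffHoles hv).choose_spec.choose_spec
  have := (q.onHole_holeDart _ _).eq_of_sameVertex (q.onHole_holeDart i n)
    (SameCycle.trans hs (SameCycle.symm h))
  simp only [Function.iterate_succ_apply']
  exact congrArg (fun z : Σ i, E i => (⟨z.1, (u z.1).next z.2⟩ : Σ i, E i))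
    (holeDart_eq_holeDart hu this)

theorem glueVertex_holeEdge (i : Fin k) (n : ℕ) :
    q.glueVertex u (q.glueOuter u (q.holeEdge i n)) =
      .inr ⟨i, (u i).next^[n] (u i).root⟩ := by
  have hpos : 0 < q.holeDegree i := (hu i) ▸ (u i).perimeter_pos
  -- Indices matter only modulo the degree of the hole, so `n = 0` also has a predecessor, one turn
  -- later.
  obtain ⟨n', hn'⟩ : ∃ n', n' + 1 ≡ n [MOD q.holeDegree i] :=
    ⟨n + q.holeDegree i - 1, by
      rw [Nat.sub_add_cancel (by omega)]; exact Nat.add_modEq_right⟩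
  rw [← (q.holeEdge_eq_iff i _ _).2 hn']
  rw [← hu, ← RootedMap.next_iterate_eq_iff] at hn'
  rw [← hn']
  refine glueVertex_of_sameVertex hu (q.offHoles_holeEdge i _) ?_
  have := q.sameVertex_next (q.holeDart i (n' + 1))
  rw [q.next_holeDart_succ] at this
  exact SameCycle.symm this

theorem glueVertex_glueInner (i : Fin k) (y : E i) :
    q.glueVertex u (q.glueInner u i y) = .inr ⟨i, y⟩ := by
  by_cases hy : (u i).OnRootFace y
  · obtain ⟨n, rfl⟩ := hy.exists_iterate
    rw [glueInner_iterate hu, ← glueOuter_of_offHoles, glueVertex_holeEdge hu]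
  · rw [glueInner_of_not hy]; rfl

theorem glueVertex_glueNext_glueInner (i : Fin k) (y : E i) :
    q.glueVertex u (q.glueNext u (q.glueInner u i y)) = .inr ⟨i, (u i).next y⟩ := by
  by_cases hy : (u i).OnRootFace y
  · obtain ⟨n, rfl⟩ := hy.exists_iterate
    have hn := q.offHoles_holeEdge i n
    rw [glueInner_iterate hu, ← glueOuter_of_offHoles, glueNext_glueOuter hn,
      glueVertex_of_sameVertex hu (q.offHoles_next_iff.2 hn) (i := i) (n := n),
      Function.iterate_succ_apply']
    exact sameCycle_apply (q.next * q.rev) (q.holeDart i n)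
  · rw [glueNext_glueInner hy, glueVertex_glueInner hu]

/-- The rotation around the vertices of a gluing, up to the insertion of edges of `q` around the
vertices of the `u i`. -/
def vertexModel (q : HoledQuad D k) (u : ∀ i, RootedMap (E i)) :
    Perm ({x : D // q.VertexOffHoles x} ⊕ Σ i, E i) :=
  Equiv.sumCongr ((q.next * q.rev).subtypePerm (p := fun x => q.VertexOffHoles x)
    fun x => q.vertexOffHoles_iff x) (Equiv.sigmaCongrRight fun i => (u i).next * (u i).rev)

theorem sameCycle_vertexModel (z : q.GluedDart u) :
    (q.vertexModel u).SameCycle (q.glueVertex u z)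
      (q.glueVertex u ((q.glueNext u * glueRevPerm hu) z)) := by
  have inner : ∀ i y, (q.vertexModel u).SameCycle (q.glueVertex u (q.glueInner u i y))
      (q.glueVertex u ((q.glueNext u * glueRevPerm hu) (q.glueInner u i y))) := fun i y => by
    rw [glueVertex_glueInner hu, Perm.mul_apply, glueRevPerm_apply, glueRev_glueInner hu,
      glueVertex_glueNext_glueInner hu]
    exact sameCycle_apply (q.vertexModel u) (.inr ⟨i, y⟩)
  rcases z with ⟨x, hx⟩ | ⟨i, y, hy⟩
  · by_cases hx' : q.OffHoles (q.rev x)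
    · rw [← glueOuter_of_offHoles hx, Perm.mul_apply, glueRevPerm_apply, glueRev_glueOuter hu,
        glueNext_glueOuter hx']
      by_cases hv : q.VertexOffHoles x
      · rw [glueVertex_of_vertexOffHoles hv,
          glueVertex_of_vertexOffHoles (x := q.next (q.rev x)) ((q.vertexOffHoles_iff x).2 hv)]
        exact sameCycle_apply (q.vertexModel u) (.inl ⟨x, hv⟩)
      · obtain ⟨i, n, h⟩ := exists_holeDart_of_not_vertexOffHoles hv
        rw [glueVertex_of_sameVertex hu hx h, glueVertex_of_sameVertex hu
          (q.offHoles_next_iff.2 hx') (h.trans (sameCycle_apply _ x))]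
    · obtain ⟨i, n, hn⟩ := q.exists_holeDart_of_not_offHoles hx'
      have hx2 : x = q.holeEdge i n := by rw [← q.rev_holeDart, hn, q.rev_rev]
      subst hx2
      rw [← glueInner_iterate hu]
      exact inner i _
  · rw [← glueInner_of_not hy]
    exact inner i y

/-- Each hole vertex is absorbed by a vertex of the map glued there; several may be absorbed by the
same one, as the boundary of `u i` need not be simple. What remains to be counted are the vertices
of `q` off the holes and the vertices of the `u i`. -/
theorem numCycles_vertexModel :
    numCycles (q.glueNext u * glueRevPerm hu) = numCycles (q.vertexModel u) := by
  refine numCycles_eq_of_maps (q.glueVertex u)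
    (Sum.elim (fun x => q.glueOuter u x.1) fun y => q.glueInner u y.1 y.2)
    (sameCycle_vertexModel hu) ?_ ?_ ?_
  · rintro (⟨x, hx⟩ | ⟨i, y⟩)
    · have := sameCycle_apply (q.glueNext u * glueRevPerm hu) (q.glueOuter u x)
      rwa [Perm.mul_apply, glueRevPerm_apply, glueRev_glueOuter hu,
        glueNext_glueOuter hx.offHoles_rev] at this
    · exact sameCycle_glueInner hu i y
  · rintro (⟨x, hx⟩ | ⟨i, y, hy⟩)
    · rw [← glueOuter_of_offHoles hx]
      by_cases hv : q.VertexOffHoles x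
      · rw [glueVertex_of_vertexOffHoles hv]; exact SameCycle.rfl
      · obtain ⟨i, n, h⟩ := exists_holeDart_of_not_vertexOffHoles hv
        rw [glueVertex_of_sameVertex hu hx h]
        exact (sameCycle_glueOuter hu h).symm
    · rw [← glueInner_of_not hy, glueVertex_glueInner hu]; exact SameCycle.rfl
  · rintro (⟨x, hx⟩ | ⟨i, y⟩)
    · rw [Sum.elim_inl, glueVertex_of_vertexOffHoles hx]
    · rw [Sum.elim_inr, glueVertex_glueInner hu]

theorem card_holes_eq : Nat.card {x // ¬ q.OffHoles x} =
    ∑ i, Nat.card {y : E i // (u i).OnRootFace y} := by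
  have h1 : Nat.card {x // ¬ q.OffHoles x} = Nat.card (Σ i, {x // q.OnHole i x}) := by
    refine (Nat.card_congr (Equiv.ofBijective
      (fun a : Σ i, {x // q.OnHole i x} =>
        (⟨a.2.1, fun h => h a.1 a.2.2⟩ : {x // ¬ q.OffHoles x})) ⟨?_, ?_⟩)).symm
    · rintro ⟨i, x, hx⟩ ⟨j, y, hy⟩ h
      obtain rfl : x = y := by simpa using h
      obtain rfl := hx.unique hy
      rfl
    · rintro ⟨x, hx⟩
      simp only [OffHoles, not_forall, not_not] at hx
      obtain ⟨i, hi⟩ := hx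
      exact ⟨⟨i, x, hi⟩, rfl⟩
  rw [h1, Nat.card_sigma]
  refine Finset.sum_congr rfl fun i _ => ?_
  exact (hu i).symm

variable (q u) in
/-- The gluing of the maps `u i` into the holes of `q`. -/
noncomputable def glue : RootedMap (q.GluedDart u) where
  rev := glueRevPerm hu
  next := q.glueNext u
  root := q.glueOuter u q.root
  rev_rev := glueRev_glueRev hu
  rev_ne := glueRev_ne hu
  connected := RootedMap.connected_of_induction fun C h0 h1 h2 => by
    have h2' : ∀ z, C (q.glueNext u z) → C z := fun z hz =>
      sameCycle_induction (sameCycle_apply (q.glueNext u) z).symm hz fun w _ hw => h2 w hw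
    have hf : ∀ x, C (q.glueOuter u x) := by
      refine q.induction_off_holes h0 (fun x hx => ?_) fun x hx => ?_
      · rw [← glueRev_glueOuter hu]; exact h1 _ hx
      · rw [← glueNext_glueOuter hx]
        exact ⟨h2 _, h2' _⟩
    have hb : ∀ i n, C (q.glueInner u i ((u i).next^[n] (u i).root)) := fun i n => by
      rw [glueInner_iterate hu, ← glueOuter_of_offHoles]; exact hf _
    have hg : ∀ i y, C (q.glueInner u i y) := by
      intro i
      refine (u i).induction (hb i 0) (fun y hy => ?_) fun y hy => ?_
      · rw [← glueRev_glueInner hu]; exact h1 _ hy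
      · by_cases hy' : (u i).OnRootFace y
        · obtain ⟨n, rfl⟩ := hy'.exists_iterate
          rw [← Function.iterate_succ_apply' (u i).next]; exact hb i _
        · rw [← glueNext_glueInner hy']; exact h2 _ hy
    rintro (⟨x, hx⟩ | ⟨i, y, hy⟩)
    · rw [← glueOuter_of_offHoles hx]; exact hf x
    · rw [← glueInner_of_not hy]; exact hg i y
  euler := by
    change (numCycles (q.glueNext u * glueRevPerm hu) : ℤ) - numCycles (glueRevPerm hu)
      + numCycles (q.glueNext u) = 2
    classical
    -- Let `p` be the total length of the holes. The holes have `p` vertices in all, so `V = V_q - p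
    -- + ∑ V_i`. Boundary edges are identified in pairs, so `E = E_q - p + ∑ E_i`. Finally `F = F_q
    -- - k + ∑ (F_i - 1)`. As `V_i - E_i + F_i - 1 = 1` for each of the `k` fillings, `V - E + F = 2
    -- - k + k`.
    have hV := numCycles_vertexModel hu
    rw [vertexModel, numCycles_sumCongr, numCycles_sigmaCongrRight] at hV
    have hVq := numCycles_subtype_add (q.next * q.rev) (fun x => q.VertexOffHoles x)
      fun x => q.vertexOffHoles_iff x
    rw [q.numCycles_vertex_holes] at hVq
    have hF := q.numCycles_glueNext u
    have hE := two_mul_numCycles_of_involutive (glueRevPerm hu) (glueRev_glueRev hu)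
      (glueRev_ne hu)
    have hEq := q.toRootedMap.two_mul_numCycles_rev
    have hD : Nat.card D = Nat.card {x // q.OffHoles x} + Nat.card {x // ¬ q.OffHoles x} := by
      rw [← Nat.card_sum]; exact Nat.card_congr (Equiv.sumCompl _).symm
    have hEi : ∀ i, 2 * numCycles (u i).rev = Nat.card {y // (u i).OnRootFace y} +
        Nat.card {y // ¬ (u i).OnRootFace y} := fun i => by
      rw [(u i).two_mul_numCycles_rev, ← Nat.card_sum]
      exact Nat.card_congr (Equiv.sumCompl _).symm
    have hS : 2 * ∑ i, numCycles (u i).rev = ∑ i, Nat.card {y // (u i).OnRootFace y} +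
        ∑ i, Nat.card {y // ¬ (u i).OnRootFace y} := by
      rw [Finset.mul_sum, ← Finset.sum_add_distrib]
      exact Finset.sum_congr rfl fun i _ => hEi i
    rw [Nat.card_sum, Nat.card_sigma] at hE
    have hH := card_holes_eq hu
    have hX := q.toRootedMap.euler_numCycles
    have hXi : ∑ i, ((numCycles ((u i).next * (u i).rev) : ℤ) - numCycles (u i).rev
        + ((u i).numInnerFaces : ℤ)) = k := by
      have : ∀ i, (numCycles ((u i).next * (u i).rev) : ℤ) - numCycles (u i).rev
        + ((u i).numInnerFaces : ℤ) = 1 := fun i => by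
        have h1 := (u i).euler_numCycles
        have h2 := (u i).numCycles_next
        omega
      simp [this]
    rw [Finset.sum_add_distrib, Finset.sum_sub_distrib] at hXi
    zify at *
    linarith

theorem isGluingPair_glue : q.IsGluingPair u (glue q u hu) (q.glueOuter u) (q.glueInner u) where
  root := rfl
  rev_left x := (glueRev_glueOuter hu x).symm
  rev_right i y := (glueRev_glueInner hu i y).symm
  boundary i n := by rw [glueInner_iterate hu, ← glueOuter_of_offHoles]
  next_left _ hx := (glueNext_glueOuter hx).symm
  next_right _ _ hy := (glueNext_glueInner hy).symm
  bijective := by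
    convert Function.bijective_id using 1
    funext z
    rcases z with ⟨x, hx⟩ | ⟨i, y, hy⟩
    · exact glueOuter_of_offHoles hx
    · exact glueInner_of_not hy

end Existence

end HoledQuad

/-! ### Gluing isomorphism classes of quadrangulations -/

namespace HoledQuad

variable {D : Type} [Finite D] {k : ℕ} {q : HoledQuad D k} {L : Fin k → ℕ+} {ℓ : ℕ}

theorem IsGluing.eq_right {u : ∀ i, Quad (L i)} {m m' : Quad ℓ} (h : q.IsGluing u m)
    (h' : q.IsGluing u m') : m = m' := by
  obtain ⟨f, g, hp⟩ := (q.isGluingMap_iff _ _).1 h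
  obtain ⟨f', g', hp'⟩ := (q.isGluingMap_iff _ _).1 h'
  exact Quad.eq_of_iso (hp.iso hp')

theorem IsGluing.perimeter_eq {u : ∀ i, Quad (L i)} {m : Quad ℓ} (h : q.IsGluing u m) :
    q.perimeter = 2 * ℓ := by
  obtain ⟨f, g, hp⟩ := (q.isGluingMap_iff _ _).1 h
  rw [← hp.perimeter_eq, m.rep.perimeter_eq]

theorem IsGluing.numFaces_add {u : ∀ i, Quad (L i)} {m : Quad ℓ} (h : q.IsGluing u m) :
    m.numFaces + k = q.numInnerFaces + ∑ i, (u i).numFaces := by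
  obtain ⟨f, g, hp⟩ := (q.isGluingMap_iff _ _).1 h
  exact hp.numInnerFaces_add

/-- The root face is not a hole. This makes the truncated subtraction `q.numInnerFaces - k` a
genuine one. -/
theorem le_numInnerFaces (q : HoledQuad D k) : k ≤ q.numInnerFaces := by
  have h1 := q.numCycles_offHoles
  have h2 := q.toRootedMap.numCycles_next
  have : 0 < numCycles (q.next.subtypePerm (p := fun x => q.OffHoles x)
      fun _ => q.offHoles_next_iff) :=
    (Nat.card_pos_iff).2 ⟨⟨Quotient.mk _ ⟨q.root, q.offHoles_root⟩⟩, inferInstance⟩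
  omega

variable (hL : ∀ i, q.holeDegree i = 2 * (L i : ℕ))
include hL

theorem IsGluing.eq_left {u u' : ∀ i, Quad (L i)} {m : Quad ℓ} (h : q.IsGluing u m)
    (h' : q.IsGluing u' m) : u = u' := by
  obtain ⟨f, g, hp⟩ := (q.isGluingMap_iff _ _).1 h
  obtain ⟨f', g', hp'⟩ := (q.isGluingMap_iff _ _).1 h'
  funext i
  exact Quad.eq_of_iso (hp.filling_iso hp' (fun i => (u i).rep.perimeter_eq.trans (hL i).symm)
    (fun i => (u' i).rep.perimeter_eq.trans (hL i).symm) i)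

theorem exists_isGluing (hq : q.perimeter = 2 * ℓ) (u : ∀ i, Quad (L i)) :
    ∃ m : Quad ℓ, q.IsGluing u m := by
  have hu : ∀ i, (u i).rep.map.perimeter = q.holeDegree i :=
    fun i => (u i).rep.perimeter_eq.trans (hL i).symm
  have hp := isGluingPair_glue hu
  obtain ⟨m, hm⟩ := Quad.exists_iso_rep _ (hp.isQuad hq fun i => (u i).rep.isQuad)
  exact ⟨m, hp.congr (fun i => ⟨Equiv.refl _, fun _ => rfl, fun _ => rfl, rfl⟩) hm⟩

end HoledQuad

theorem tsum_prod_fin {n : ℕ} {α : Fin n → Type*} (f : ∀ i, α i → ℝ≥0∞) :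
    ∑' u : ∀ i, α i, ∏ i, f i (u i) = ∏ i, ∑' a, f i a := by
  induction n with
  | zero => simp
  | succ n ih =>
    rw [← (Fin.consEquiv α).tsum_eq,
      ENNReal.tsum_prod (f := fun a v => ∏ i, f i (Fin.consEquiv α (a, v) i)),
      Fin.prod_univ_succ, ← ih, ← ENNReal.tsum_mul_right]
    refine tsum_congr fun a => ?_
    rw [← ENNReal.tsum_mul_left]
    refine tsum_congr fun v => ?_
    simp [Fin.prod_univ_succ]

/-! ### Boltzmann laws and the Markov property -/

section Markov

variable {P : ∀ ℓ : ℕ+, PMF (Quad ℓ)}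
  {D : Type} [Finite D] {k : ℕ} {q : HoledQuad D k} {L : Fin k → ℕ+}

theorem tsum_isGluing (hL : ∀ i, q.holeDegree i = 2 * (L i : ℕ)) {ℓ : ℕ} {m : Quad ℓ}
    {u : ∀ i, Quad (L i)} (h : q.IsGluing u m) :
    ∑' u : {u : ∀ i, Quad (L i) // q.IsGluing u m}, ∏ i, P (L i) (u.1 i) =
      ∏ i, P (L i) (u i) := by
  rw [tsum_eq_single ⟨u, h⟩]
  rintro ⟨u', h'⟩ hne
  exact absurd (Subtype.ext (h'.eq_left hL h)) hne

/-- Gluing is injective in the family `u`, and its range is the set of maps that contain `q`.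
Summing the product form over all families gives `κ`, as each `P (L i)` has mass one; conditioning
therefore divides by `κ` and leaves the product of the masses. -/
theorem filter_eq_of_forall_isGluing (hL : ∀ i, q.holeDegree i = 2 * (L i : ℕ)) {ℓ : ℕ+} {κ : ℝ≥0∞}
    (hκ : κ ≠ ⊤) (hP : ∀ u m, q.IsGluing u m → P ℓ m = κ * ∏ i, P (L i) (u i))
    (hpos : ∃ m ∈ q.containing L ℓ, m ∈ (P ℓ).support) (m : Quad ℓ) :
    (P ℓ).filter (q.containing L ℓ) hpos m =
      ∑' u : {u : ∀ i, Quad (L i) // q.IsGluing u m}, ∏ i, P (L i) (u.1 i) := by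
  obtain ⟨m₀, ⟨u₀, h₀⟩, hm₀⟩ := id hpos
  have hκ0 : κ ≠ 0 := by
    rintro rfl
    rw [PMF.mem_support_iff, hP _ _ h₀, zero_mul] at hm₀
    exact hm₀ rfl
  choose G hG using HoledQuad.exists_isGluing hL h₀.perimeter_eq
  have hGinj : Function.Injective G := fun u u' h => (hG u).eq_left hL (h ▸ hG u')
  have hrange : q.containing L ℓ = Set.range G := by
    ext m
    exact ⟨fun ⟨u, hu⟩ => ⟨u, (hG u).eq_right hu⟩, fun ⟨u, hu⟩ => ⟨u, hu ▸ hG u⟩⟩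
  have hZ : ∑' x, (q.containing L ℓ).indicator (P ℓ) x = κ := by
    rw [← tsum_subtype, hrange, tsum_range _ hGinj]
    simp only [hP _ _ (hG _)]
    rw [ENNReal.tsum_mul_left, tsum_prod_fin]
    simp [PMF.tsum_coe]
  rw [PMF.filter_apply, hZ]
  by_cases hm : m ∈ q.containing L ℓ
  · obtain ⟨u, hu⟩ := id hm
    rw [Set.indicator_of_mem hm, tsum_isGluing hL hu, hP _ _ hu, mul_comm κ, mul_assoc,
      ENNReal.mul_inv_cancel hκ0 hκ, mul_one]
  · have : IsEmpty {u : ∀ i, Quad (L i) // q.IsGluing u m} := ⟨fun u => hm ⟨u.1, u.2⟩⟩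
    rw [Set.indicator_of_notMem hm, zero_mul, tsum_empty]

theorem IsBoltzmann.partitionFunction_ne_zero {x : ℝ≥0} (h : IsBoltzmann x P) (ℓ : ℕ+) :
    partitionFunction x ℓ ≠ 0 := by
  intro h0
  have h1 := (P ℓ).tsum_coe
  have h2 : ∀ m : Quad ℓ, (x : ℝ≥0∞) ^ m.numFaces = 0 := ENNReal.tsum_eq_zero.1 h0
  simp [(h ℓ).2, h2] at h1

theorem IsBoltzmann.isMarkov {x : ℝ≥0} (h : IsBoltzmann x P) : IsMarkov P := by
  intro D _ k q L hL ℓ hpos m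
  -- The factor collects the weight of the internal faces of `q` that are not holes and the change
  -- of normalization from the `P (L i)` to `P ℓ`.
  refine filter_eq_of_forall_isGluing hL (κ := (x : ℝ≥0∞) ^ (q.numInnerFaces - k) *
    (∏ i, partitionFunction x (L i)) / partitionFunction x ℓ) ?_ ?_ hpos m
  · refine ENNReal.div_ne_top (ENNReal.mul_ne_top (by simp) ?_) (h.partitionFunction_ne_zero ℓ)
    exact ENNReal.prod_ne_top fun i _ => (h (L i)).1
  · intro u m hu
    have hn : m.numFaces = (q.numInnerFaces - k) + ∑ i, (u i).numFaces := by
      have := hu.numFaces_add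
      have := q.le_numInnerFaces
      omega
    have hprod : (∏ i, P (L i) (u i)) * ∏ i, partitionFunction x (L i) =
        (x : ℝ≥0∞) ^ ∑ i, (u i).numFaces := by
      rw [← Finset.prod_mul_distrib, ← Finset.prod_pow_eq_pow_sum]
      refine Finset.prod_congr rfl fun i _ => ?_
      rw [(h (L i)).2, ENNReal.div_mul_cancel (h.partitionFunction_ne_zero _) (h (L i)).1]
    rw [(h ℓ).2, hn, pow_add, ← hprod]
    simp only [div_eq_mul_inv]
    ring

theorem IsBoltzmann.isUniformGivenFaces {x : ℝ≥0} (h : IsBoltzmann x P) :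
    IsUniformGivenFaces P := fun ℓ m₁ m₂ hm => by rw [(h ℓ).2, (h ℓ).2, hm]

theorem IsUniformGivenFaces.isRerootingInvariant (h : IsUniformGivenFaces P) :
    IsRerootingInvariant P := fun ℓ m₁ m₂ hm => h ℓ m₁ m₂ hm.numInnerFaces_eq

/-- Under the Markov property, the mass of a gluing is proportional to the mass of what is
glued. -/
theorem IsMarkov.exists_const (h : IsMarkov P) {q : HoledQuad D 1} {L : ℕ+}
    (hL : q.holeDegree 0 = 2 * (L : ℕ)) (ℓ : ℕ+) :
    ∃ c : ℝ≥0, ∀ (u : Quad L) (m : Quad ℓ), q.IsGluing (L := fun _ => L) (fun _ => u) m →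
      P ℓ m = c * P L u := by
  have hL' : ∀ i : Fin 1, q.holeDegree i = 2 * (((fun _ => L) i : ℕ+) : ℕ) := fun i => by
    rw [Subsingleton.elim i 0]; exact hL
  set S := q.containing (fun _ => L) ℓ
  have htop : ∑' x, S.indicator (P ℓ) x ≠ ⊤ := (P ℓ).tsum_coe_indicator_ne_top S
  -- The constant is the probability of containing `q`. When it vanishes, so does the mass of every
  -- gluing, and no conditioning is needed.
  refine ⟨(∑' x, S.indicator (P ℓ) x).toNNReal, fun u m hu => ?_⟩
  rw [ENNReal.coe_toNNReal htop]
  have hm : m ∈ S := ⟨_, hu⟩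
  by_cases hpos : ∃ m ∈ S, m ∈ (P ℓ).support
  · have h1 := h D 1 q (fun _ => L) hL' ℓ hpos m
    rw [tsum_isGluing hL' hu, PMF.filter_apply, Set.indicator_of_mem hm] at h1
    have h0 : ∑' x, S.indicator (P ℓ) x ≠ 0 := by
      obtain ⟨m', hm', hs⟩ := hpos
      intro h0
      have := ENNReal.tsum_eq_zero.1 h0 m'
      rw [Set.indicator_of_mem hm'] at this
      exact (PMF.mem_support_iff _ _).1 hs this
    simp only [Finset.univ_unique, Finset.prod_singleton] at h1
    rw [← h1, mul_comm, mul_assoc, ENNReal.inv_mul_cancel h0 htop, mul_one]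
  · have hz : ∀ m ∈ S, P ℓ m = 0 := fun m hm => by
      by_contra h'
      exact hpos ⟨m, hm, (PMF.mem_support_iff _ _).2 h'⟩
    have : ∑' x, S.indicator (P ℓ) x = 0 := by
      refine ENNReal.tsum_eq_zero.2 fun x => ?_
      by_cases hx : x ∈ S
      · rw [Set.indicator_of_mem hx, hz x hx]
      · exact Set.indicator_of_notMem hx _
    rw [this, hz m hm, zero_mul]

end Markov

/-! ### Removing the root edge -/

namespace RootedMap

variable {D : Type} {M : RootedMap D}

theorem next_rev_ne_next (M : RootedMap D) (x : D) : M.next (M.rev x) ≠ M.next x :=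
  fun h => M.rev_ne x (M.next.injective h)

/-- The root edge may be removed: it is a pendant edge that ends at a leaf and is not the only edge,
or it separates two faces, neither of degree `1`. -/
structure RootRemovable (M : RootedMap D) : Prop where
  next_root : M.next M.root ≠ M.root
  next_rev : M.next (M.rev M.root) ≠ M.rev M.root
  next_rev_ne : M.next (M.rev M.root) ≠ M.root
  leaf_or_separating : M.next M.root = M.rev M.root ∨ ¬ M.OnRootFace (M.rev M.root)

/-- The oriented edges that remain when the root edge is removed. -/
abbrev Rest (M : RootedMap D) : Type := {x : D // x ≠ M.root ∧ x ≠ M.rev M.root}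

open Classical in
/-- The oriented edge that follows `x` along its face when the root edge is removed. -/
noncomputable def skipRoot (M : RootedMap D) (x : D) : D :=
  -- A dart that led to one side of the root edge goes on with the dart that follows the other side.
  -- At a leaf, the first branch jumps over both sides at once.
  if M.next x = M.root then M.next (M.rev M.root)
  else if M.next x = M.rev M.root then M.next M.root else M.next x

theorem skipRoot_of_eq_root {x : D} (h : M.next x = M.root) :
    M.skipRoot x = M.next (M.rev M.root) := if_pos h

theorem skipRoot_of_eq_rev {x : D} (h : M.next x = M.rev M.root) :
    M.skipRoot x = M.next M.root := by
  rw [skipRoot, if_neg (fun h' => M.rev_ne _ (h.symm.trans h')), if_pos h]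

theorem skipRoot_of_ne {x : D} (h : M.next x ≠ M.root) (h' : M.next x ≠ M.rev M.root) :
    M.skipRoot x = M.next x := by rw [skipRoot, if_neg h, if_neg h']

theorem skipRoot_cases (M : RootedMap D) (x : D) :
    (M.next x = M.root ∧ M.skipRoot x = M.next (M.rev M.root)) ∨
    (M.next x = M.rev M.root ∧ M.skipRoot x = M.next M.root) ∨
    (M.next x ≠ M.root ∧ M.next x ≠ M.rev M.root ∧ M.skipRoot x = M.next x) := by
  by_cases h1 : M.next x = M.root
  · exact Or.inl ⟨h1, skipRoot_of_eq_root h1⟩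
  · by_cases h2 : M.next x = M.rev M.root
    · exact Or.inr (Or.inl ⟨h2, skipRoot_of_eq_rev h2⟩)
    · exact Or.inr (Or.inr ⟨h1, h2, skipRoot_of_ne h1 h2⟩)

namespace RootRemovable

theorem skipRoot_mem (h : M.RootRemovable) (x : M.Rest) :
    M.skipRoot x.1 ≠ M.root ∧ M.skipRoot x.1 ≠ M.rev M.root := by
  rcases M.skipRoot_cases x.1 with ⟨_, h2⟩ | ⟨h1, h2⟩ | ⟨h1, h1', h2⟩ <;> rw [h2]
  · exact ⟨h.next_rev_ne, h.next_rev⟩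
  · exact ⟨h.next_root, fun h3 => x.2.1 (M.next.injective (h1.trans h3.symm))⟩
  · exact ⟨h1, h1'⟩

theorem skipRoot_injective (x y : M.Rest) (hxy : M.skipRoot x.1 = M.skipRoot y.1) : x = y := by
  have inj : ∀ {a b : D}, M.next a = M.next b → a = b := fun h => M.next.injective h
  apply Subtype.ext
  rcases M.skipRoot_cases x.1 with ⟨h1, h2⟩ | ⟨h1, h2⟩ | ⟨-, -, h2⟩ <;>
    rcases M.skipRoot_cases y.1 with ⟨h3, h4⟩ | ⟨h3, h4⟩ | ⟨-, -, h4⟩ <;> rw [h2, h4] at hxy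
  · exact inj (h1.trans h3.symm)
  · exact absurd hxy (M.next_rev_ne_next _)
  · exact absurd (inj hxy).symm y.2.2
  · exact absurd hxy.symm (M.next_rev_ne_next _)
  · exact inj (h1.trans h3.symm)
  · exact absurd (inj hxy).symm y.2.1
  · exact absurd (inj hxy) x.2.2
  · exact absurd (inj hxy) x.2.1
  · exact inj hxy

variable [Finite D] (h : M.RootRemovable)

/-- The order along the faces when the root edge is removed. -/
noncomputable def next : Perm M.Rest :=
  Equiv.ofBijective (fun x => ⟨M.skipRoot x.1, h.skipRoot_mem x⟩)
    (Finite.injective_iff_bijective.1 fun x y hxy =>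
      skipRoot_injective x y (congrArg Subtype.val hxy))

theorem coe_next (x : M.Rest) : (h.next x : D) = M.skipRoot x.1 := rfl

theorem rev_mem (x : M.Rest) : M.rev x.1 ≠ M.root ∧ M.rev x.1 ≠ M.rev M.root :=
  ⟨fun hx => x.2.2 (by simpa [M.rev_rev] using congrArg M.rev hx), fun hx => x.2.1 (M.rev.injective hx)⟩

/-- The reversal of the oriented edges that remain when the root edge is removed. -/
def rev (M : RootedMap D) : Perm M.Rest :=
  Function.Involutive.toPerm (fun x => ⟨M.rev x.1, rev_mem x⟩)
    fun x => Subtype.ext (M.rev_rev x.1)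

theorem coe_rev (x : M.Rest) : (rev M x : D) = M.rev x.1 := rfl

/-- The root when the root edge is removed. -/
def root : M.Rest := ⟨M.next (M.rev M.root), h.next_rev_ne, h.next_rev⟩

/-- What remains of the faces of the former root edge stays on the face of the new root from one
oriented edge to the next. -/
theorem sameCycle_step (hd : ∀ hm, h.next.SameCycle h.root ⟨M.next M.root, hm⟩) {z : D}
    (hz : ∀ hm, h.next.SameCycle h.root ⟨z, hm⟩) (hm) :
    h.next.SameCycle h.root ⟨M.next z, hm⟩ := by
  by_cases h1 : z = M.root
  · subst h1; exact hd hm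
  by_cases h2 : z = M.rev M.root
  · subst h2; exact SameCycle.rfl
  have := (hz ⟨h1, h2⟩).trans (sameCycle_apply h.next _)
  have he : h.next ⟨z, h1, h2⟩ = ⟨M.next z, hm⟩ := Subtype.ext (skipRoot_of_ne hm.1 hm.2)
  rwa [he] at this

/-- The two faces of a separating edge merge: from the new root, the face of `rev root` is followed
up to its last dart `w`, and the next step enters the former root face. For a leaf, `next root` is
`rev root`, which does not remain. -/
theorem sameCycle_next_root (hm) : h.next.SameCycle h.root ⟨M.next M.root, hm⟩ := by
  rcases h.leaf_or_separating with hl | hs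
  · exact absurd hl hm.2
  have key : ∀ z, M.SameFace (M.rev M.root) z → ∀ hm, h.next.SameCycle h.root ⟨z, hm⟩ := by
    intro z hz
    refine sameCycle_induction (C := fun z => ∀ hm, h.next.SameCycle h.root ⟨z, hm⟩) hz
      (fun hm => absurd rfl hm.2) fun z hz hCz hm => ?_
    by_cases h1 : z = M.root
    · exact absurd (SameCycle.symm (h1 ▸ hz)) hs
    by_cases h2 : z = M.rev M.root
    · subst h2; exact SameCycle.rfl
    have := (hCz ⟨h1, h2⟩).trans (sameCycle_apply h.next _)
    have he : h.next ⟨z, h1, h2⟩ = ⟨M.next z, hm⟩ := Subtype.ext (skipRoot_of_ne hm.1 hm.2)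
    rwa [he] at this
  set w := M.next.symm (M.rev M.root) with hw
  have hnw : M.next w = M.rev M.root := by rw [hw, apply_symm_apply]
  have hwf : M.SameFace (M.rev M.root) w := by
    rw [← hnw]; exact SameCycle.symm (M.sameFace_next w)
  have hwm : w ≠ M.root ∧ w ≠ M.rev M.root :=
    ⟨fun h1 => hs (SameCycle.symm (h1 ▸ hwf)), fun h1 => h.next_rev (h1 ▸ hnw)⟩
  have := (key w hwf hwm).trans (sameCycle_apply h.next _)
  have he : h.next ⟨w, hwm⟩ = ⟨M.next M.root, hm⟩ := Subtype.ext (skipRoot_of_eq_rev hnw)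
  rwa [he] at this

theorem sameCycle_root_iff (x : M.Rest) :
    h.next.SameCycle h.root x ↔ M.SameFace M.root x.1 ∨ M.SameFace (M.rev M.root) x.1 := by
  constructor
  · intro hx
    refine sameCycle_induction (C := fun x : M.Rest => M.SameFace M.root x.1 ∨
      M.SameFace (M.rev M.root) x.1) hx (Or.inr (M.sameFace_next _)) fun z _ hz => ?_
    rw [coe_next]
    rcases M.skipRoot_cases z.1 with ⟨_, h2⟩ | ⟨_, h2⟩ | ⟨_, _, h2⟩ <;> rw [h2]
    · exact Or.inr (M.sameFace_next _)
    · exact Or.inl (M.sameFace_next _)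
    · exact hz.imp (fun h => h.trans (M.sameFace_next _)) fun h => h.trans (M.sameFace_next _)
  · rintro (hx | hx)
    · exact sameCycle_induction (C := fun z => ∀ hm, h.next.SameCycle h.root ⟨z, hm⟩) hx
        (fun hm => absurd rfl hm.1) (fun z _ hz => h.sameCycle_step h.sameCycle_next_root hz) x.2
    · exact sameCycle_induction (C := fun z => ∀ hm, h.next.SameCycle h.root ⟨z, hm⟩) hx
        (fun hm => absurd rfl hm.2) (fun z _ hz => h.sameCycle_step h.sameCycle_next_root hz) x.2

theorem connected (C : M.Rest → Prop) (h0 : C h.root) (h1 : ∀ x, C x → C (rev M x))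
    (h2 : ∀ x, C x → C (h.next x)) (x : M.Rest) : C x := by
  have hface : ∀ x, h.next.SameCycle h.root x → C x := fun x hx =>
    sameCycle_induction hx h0 fun z _ hz => h2 z hz
  refine M.induction (C := fun z => ∀ hm, C ⟨z, hm⟩) (fun hm => absurd rfl hm.1) ?_ ?_ x.1 x.2
  · intro z hz hm
    have := h1 _ (hz ⟨fun he => hm.2 (he ▸ rfl), fun he => hm.1 (by rw [he, M.rev_rev])⟩)
    exact this
  · intro z hz hm
    by_cases hz1 : z = M.root
    · subst hz1; exact hface _ (h.sameCycle_next_root hm)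
    by_cases hz2 : z = M.rev M.root
    · subst hz2; exact h0
    have := h2 _ (hz ⟨hz1, hz2⟩)
    have he : h.next ⟨z, hz1, hz2⟩ = ⟨M.next z, hm⟩ := Subtype.ext (skipRoot_of_ne hm.1 hm.2)
    rwa [he] at this

theorem card_rest : Nat.card M.Rest + 2 = Nat.card D := by
  have h1 : {x | x ≠ M.root ∧ x ≠ M.rev M.root} = ({M.root, M.rev M.root} : Set D)ᶜ := by
    ext x; simp
  have h2 := Set.ncard_add_ncard_compl ({M.root, M.rev M.root} : Set D)
  rw [Set.ncard_pair (M.rev_ne _).symm, ← h1] at h2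
  have h3 : Nat.card M.Rest = {x | x ≠ M.root ∧ x ≠ M.rev M.root}.ncard := rfl
  omega

theorem sameVertex_coe (x : M.Rest) :
    (M.next * M.rev).SameCycle x.1 ((h.next * rev M) x).1 := by
  have s := fun x => sameCycle_apply (M.next * M.rev) x
  have h0 := s x.1
  rw [Perm.mul_apply] at h0
  rw [Perm.mul_apply, coe_next, coe_rev]
  rcases M.skipRoot_cases (M.rev x.1) with ⟨h1, h2⟩ | ⟨h1, h2⟩ | ⟨-, -, h2⟩ <;> rw [h2]
  · rw [h1] at h0; exact h0.trans (s _)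
  · rw [h1] at h0
    have := s (M.rev M.root)
    rw [Perm.mul_apply, M.rev_rev] at this
    exact h0.trans this
  · exact h0

/-- The lost vertex is the leaf, whose only dart is `rev root`; it is matched with the cycle of
`Unit`. -/
theorem numCycles_vertex_of_leaf (hl : M.next M.root = M.rev M.root) :
    numCycles (M.next * M.rev) = numCycles (h.next * rev M) + 1 := by
  classical
  have hu : numCycles (1 : Perm Unit) = 1 := by rw [numCycles_one]; simp
  rw [← hu, ← numCycles_sumCongr]
  let φ : D → M.Rest ⊕ Unit := fun x => if hm : x ≠ M.root ∧ x ≠ M.rev M.root then .inl ⟨x, hm⟩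
    else if x = M.root then .inl h.root else .inr ()
  have φ1 : ∀ x : M.Rest, φ x.1 = .inl x := fun x => dif_pos x.2
  have φ2 : φ M.root = .inl h.root := by simp [φ]
  have φ3 : φ (M.rev M.root) = .inr () := by simp [φ, M.rev_ne]
  have s := fun x => sameCycle_apply (M.next * M.rev) x
  refine numCycles_eq_of_maps φ (Sum.elim Subtype.val fun _ => M.rev M.root) ?_ ?_ ?_ ?_
  · intro x
    by_cases h1 : x = M.root
    · rw [h1, φ2]
      have : φ ((M.next * M.rev) M.root) = .inl h.root := φ1 h.root
      rw [this]
    by_cases h2 : x = M.rev M.root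
    · rw [h2, Perm.mul_apply, M.rev_rev, hl]
    lift x to M.Rest using ⟨h1, h2⟩
    have := sameCycle_apply (Equiv.sumCongr (h.next * rev M) (1 : Perm Unit)) (.inl x)
    rw [φ1]
    convert this
    have hx : M.next (M.rev x.1) ≠ M.rev M.root := fun he =>
      (rev_mem x).1 (M.next.injective (he.trans hl.symm))
    by_cases h3 : M.next (M.rev x.1) = M.root
    · rw [Perm.mul_apply, h3, φ2]
      exact congrArg Sum.inl (Subtype.ext (skipRoot_of_eq_root h3).symm)
    · rw [Perm.mul_apply]
      refine (φ1 ⟨_, h3, hx⟩).trans ?_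
      exact congrArg Sum.inl (Subtype.ext (skipRoot_of_ne h3 hx).symm)
  · rintro (x | x)
    · exact h.sameVertex_coe x
    · exact SameCycle.rfl
  · intro x
    by_cases h1 : x = M.root
    · rw [h1, φ2]; exact (s M.root).symm
    by_cases h2 : x = M.rev M.root
    · rw [h2, φ3]; exact SameCycle.rfl
    lift x to M.Rest using ⟨h1, h2⟩
    rw [φ1]; exact SameCycle.rfl
  · rintro (x | x)
    · rw [Sum.elim_inl, φ1]
    · rw [Sum.elim_inr, φ3]

theorem numCycles_face_of_leaf (hl : M.next M.root = M.rev M.root) :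
    numCycles M.next = numCycles h.next := by
  classical
  let φ : D → M.Rest := fun x => if hm : x ≠ M.root ∧ x ≠ M.rev M.root then ⟨x, hm⟩ else h.root
  have φ1 : ∀ x : M.Rest, φ x.1 = x := fun x => dif_pos x.2
  have φ2 : φ M.root = h.root := by simp [φ]
  have φ3 : φ (M.rev M.root) = h.root := by simp [φ]
  have s := fun x => sameCycle_apply M.next x
  refine numCycles_eq_of_maps φ Subtype.val ?_ ?_ ?_ ?_
  · intro x
    by_cases h1 : x = M.root
    · rw [h1, hl, φ2, φ3]
    by_cases h2 : x = M.rev M.root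
    · have : φ (M.next (M.rev M.root)) = h.root := φ1 h.root
      rw [h2, this, φ3]
    lift x to M.Rest using ⟨h1, h2⟩
    have := sameCycle_apply h.next x
    rw [φ1]
    convert this
    have hx : M.next x.1 ≠ M.rev M.root := fun he => h1 (M.next.injective (he.trans hl.symm))
    by_cases h3 : M.next x.1 = M.root
    · rw [h3, φ2]
      exact Subtype.ext (skipRoot_of_eq_root h3).symm
    · exact (φ1 ⟨_, h3, hx⟩).trans (Subtype.ext (skipRoot_of_ne h3 hx).symm)
  · intro x
    rw [coe_next]
    rcases M.skipRoot_cases x.1 with ⟨h1, h2⟩ | ⟨h1, h2⟩ | ⟨-, -, h2⟩ <;> rw [h2]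
    · have h3 := s x.1
      have h4 := s M.root
      rw [h1] at h3
      rw [hl] at h4
      exact (h3.trans h4).trans (s _)
    · exact absurd (M.next.injective (h1.trans hl.symm)) x.2.1
    · exact s _
  · intro x
    have h4 := s M.root
    rw [hl] at h4
    by_cases h1 : x = M.root
    · rw [h1, φ2]; exact (h4.trans (s _)).symm
    by_cases h2 : x = M.rev M.root
    · rw [h2, φ3]; exact (s _).symm
    lift x to M.Rest using ⟨h1, h2⟩
    rw [φ1]
  · intro x
    rw [φ1]

/-- No vertex is lost: each removed dart can be replaced by its successor in the rotation around its
starting vertex, which remains. -/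
theorem numCycles_vertex_of_separating (hs : ¬ M.OnRootFace (M.rev M.root)) :
    numCycles (M.next * M.rev) = numCycles (h.next * rev M) := by
  classical
  have hr : M.next M.root ≠ M.root ∧ M.next M.root ≠ M.rev M.root :=
    ⟨h.next_root, fun he => hs (he ▸ M.sameFace_next M.root)⟩
  let φ : D → M.Rest := fun x => if hm : x ≠ M.root ∧ x ≠ M.rev M.root then ⟨x, hm⟩
    else if x = M.root then h.root else ⟨_, hr⟩
  have φ1 : ∀ x : M.Rest, φ x.1 = x := fun x => dif_pos x.2
  have φ2 : φ M.root = h.root := by simp [φ]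
  have φ3 : φ (M.rev M.root) = ⟨_, hr⟩ := by simp [φ, M.rev_ne]
  have s := fun x => sameCycle_apply (M.next * M.rev) x
  refine numCycles_eq_of_maps φ Subtype.val ?_ h.sameVertex_coe ?_ ?_
  · intro x
    by_cases h1 : x = M.root
    · rw [h1, φ2]
      have : φ ((M.next * M.rev) M.root) = h.root := φ1 h.root
      rw [this]
    by_cases h2 : x = M.rev M.root
    · rw [h2, φ3, Perm.mul_apply, M.rev_rev]
      have : φ (M.next M.root) = ⟨_, hr⟩ := φ1 ⟨_, hr⟩
      rw [this]
    lift x to M.Rest using ⟨h1, h2⟩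
    have := sameCycle_apply (h.next * rev M) x
    rw [φ1]
    convert this
    rw [Perm.mul_apply]
    rcases M.skipRoot_cases (M.rev x.1) with ⟨h3, h4⟩ | ⟨h3, h4⟩ | ⟨h3, h3', h4⟩
    · rw [h3, φ2]; exact Subtype.ext h4.symm
    · rw [h3, φ3]; exact Subtype.ext h4.symm
    · exact (φ1 ⟨_, h3, h3'⟩).trans (Subtype.ext h4.symm)
  · intro x
    by_cases h1 : x = M.root
    · rw [h1, φ2]; exact (s M.root).symm
    by_cases h2 : x = M.rev M.root
    · have := s (M.rev M.root)
      rw [Perm.mul_apply, M.rev_rev] at this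
      rw [h2, φ3]; exact this.symm
    lift x to M.Rest using ⟨h1, h2⟩
    rw [φ1]
  · intro x
    rw [φ1]

/-- The merged face is matched with the face of `rev root`, and the former root face with the cycle
of `Unit`. Hence `φ` sends the whole root face to `Unit`, while `ψ` moves the remaining darts of the
root face, which now lie on the merged face, to `rev root`. -/
theorem numCycles_face_of_separating (hs : ¬ M.OnRootFace (M.rev M.root)) :
    numCycles M.next = numCycles h.next + 1 := by
  classical
  have hu : numCycles (1 : Perm Unit) = 1 := by rw [numCycles_one]; simp
  rw [← hu, ← numCycles_sumCongr]
  have s := fun x => sameCycle_apply M.next x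
  have hroot : ¬ M.OnRootFace h.root.1 := mt M.onRootFace_next_iff.1 hs
  let φ : D → M.Rest ⊕ Unit := fun x => if M.OnRootFace x then .inr ()
    else if hm : x ≠ M.root ∧ x ≠ M.rev M.root then .inl ⟨x, hm⟩ else .inl h.root
  have φ1 : ∀ x : M.Rest, ¬ M.OnRootFace x.1 → φ x.1 = .inl x := fun x hx => by
    simp only [φ, if_neg hx, dif_pos x.2]
  have φ2 : ∀ x, M.OnRootFace x → φ x = .inr () := fun x hx => if_pos hx
  have φ3 : φ (M.rev M.root) = .inl h.root := by simp [φ, hs]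
  have p1 : ∀ {x y : M.Rest}, h.next.SameCycle x y →
      SameCycle (Equiv.sumCongr h.next (1 : Perm Unit)) (.inl x) (.inl y) :=
    fun hxy => sameCycle_map (φ := Sum.inl)
      (fun x => sameCycle_apply (Equiv.sumCongr h.next (1 : Perm Unit)) (.inl x)) hxy
  let ψ : M.Rest ⊕ Unit → D := Sum.elim
    (fun x => if M.OnRootFace x.1 then M.rev M.root else x.1) fun _ => M.root
  have ψ1 : ∀ x : M.Rest, M.OnRootFace x.1 → ψ (.inl x) = M.rev M.root := fun x hx => if_pos hx
  have ψ2 : ∀ x : M.Rest, ¬ M.OnRootFace x.1 → ψ (.inl x) = x.1 := fun x hx => if_neg hx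
  refine numCycles_eq_of_maps φ ψ ?_ ?_ ?_ ?_
  · intro x
    by_cases h0 : M.OnRootFace x
    · rw [φ2 x h0, φ2 _ (M.onRootFace_next_iff.2 h0)]
    have h1 : x ≠ M.root := fun he => h0 (he ▸ SameCycle.rfl)
    by_cases h2 : x = M.rev M.root
    · have : φ (M.next (M.rev M.root)) = .inl h.root := φ1 h.root hroot
      rw [h2, this, φ3]
    lift x to M.Rest using ⟨h1, h2⟩
    have hn := mt M.onRootFace_next_iff.1 h0
    have h3 : M.next x.1 ≠ M.root := fun he => hn (by rw [he]; exact SameCycle.rfl)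
    rw [φ1 x h0]
    by_cases h4 : M.next x.1 = M.rev M.root
    · rw [h4, φ3]
      refine p1 (SameCycle.symm ((h.sameCycle_root_iff x).2 (Or.inr ?_)))
      have := s x.1
      rw [h4] at this
      exact this.symm
    · have : φ (M.next x.1) = .inl ⟨_, h3, h4⟩ := φ1 ⟨_, h3, h4⟩ hn
      rw [this]
      refine p1 ?_
      have he : h.next x = ⟨M.next x.1, h3, h4⟩ := Subtype.ext (skipRoot_of_ne h3 h4)
      rw [← he]; exact sameCycle_apply _ _
  · rintro (x | x)
    · rw [Equiv.sumCongr_apply, Sum.map_inl]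
      by_cases h0 : M.OnRootFace x.1
      · rw [ψ1 x h0]
        rcases M.skipRoot_cases x.1 with ⟨h1, h2⟩ | ⟨h1, h2⟩ | ⟨h1, h1', h2⟩
        · have he : h.next x = h.root := Subtype.ext h2
          rw [he, ψ2 _ hroot]; exact s _
        · exact absurd (h1 ▸ M.onRootFace_next_iff.2 h0) hs
        · rw [ψ1 (h.next x) (by rw [coe_next, h2]; exact M.onRootFace_next_iff.2 h0)]
      · rw [ψ2 x h0]
        rcases M.skipRoot_cases x.1 with ⟨h1, h2⟩ | ⟨h1, h2⟩ | ⟨h1, h1', h2⟩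
        · exact absurd (M.onRootFace_next_iff.1 (by rw [h1]; exact SameCycle.rfl)) h0
        · rw [ψ1 (h.next x) (by rw [coe_next, h2]; exact M.sameFace_next _)]
          have := s x.1
          rwa [h1] at this
        · rw [ψ2 (h.next x) (by rw [coe_next, h2]; exact mt M.onRootFace_next_iff.1 h0),
            coe_next, h2]
          exact s _
    · exact SameCycle.rfl
  · intro x
    by_cases h0 : M.OnRootFace x
    · rw [φ2 x h0]; exact h0
    have h1 : x ≠ M.root := fun he => h0 (he ▸ SameCycle.rfl)
    by_cases h2 : x = M.rev M.root
    · rw [h2, φ3, ψ2 _ hroot]; exact (s _).symm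
    lift x to M.Rest using ⟨h1, h2⟩
    rw [φ1 x h0, ψ2 x h0]
  · rintro (x | x)
    · by_cases h0 : M.OnRootFace x.1
      · rw [ψ1 x h0, φ3]
        exact p1 ((h.sameCycle_root_iff x).2 (Or.inl h0))
      · rw [ψ2 x h0, φ1 x h0]
    · have : φ (ψ (.inr x)) = .inr x := φ2 M.root SameCycle.rfl
      rw [this]

/-- The map without its root edge. -/
noncomputable def delete : RootedMap M.Rest where
  rev := rev M
  next := h.next
  root := h.root
  rev_rev x := Subtype.ext (M.rev_rev x.1)
  rev_ne x hx := M.rev_ne x.1 (congrArg Subtype.val hx)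
  connected := connected_of_induction h.connected
  euler := by
    change (numCycles (h.next * rev M) : ℤ) - numCycles (rev M) + numCycles h.next = 2
    have h1 := M.euler_numCycles
    have h2 := M.two_mul_numCycles_rev
    have h3 := two_mul_numCycles_of_involutive (rev M) (fun x => Subtype.ext (M.rev_rev x.1))
      fun x hx => M.rev_ne x.1 (congrArg Subtype.val hx)
    have h4 := card_rest (M := M)
    -- Along with the edge, a leaf takes away one vertex and a separating edge takes away one face.
    rcases h.leaf_or_separating with hl | hs
    · have h5 := h.numCycles_vertex_of_leaf hl
      have h6 := h.numCycles_face_of_leaf hl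
      omega
    · have h5 := h.numCycles_vertex_of_separating hs
      have h6 := h.numCycles_face_of_separating hs
      omega

theorem delete_onRootFace_iff (x : M.Rest) :
    h.delete.OnRootFace x ↔ M.SameFace M.root x.1 ∨ M.SameFace (M.rev M.root) x.1 :=
  h.sameCycle_root_iff x

theorem delete_faceDegree {x : M.Rest} (hx : ¬ h.delete.OnRootFace x) :
    h.delete.faceDegree x = M.faceDegree x.1 := by
  have key : ∀ z, h.next.SameCycle x z → ¬ h.delete.OnRootFace z := fun z hz hz' =>
    hx (SameCycle.trans hz' (SameCycle.symm hz))
  refine (ncard_cycle_map (φ := Subtype.val) (fun z hz => ?_)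
    fun _ _ _ _ h => Subtype.ext h).symm
  have hz' := key z hz
  rw [delete_onRootFace_iff, not_or] at hz'
  have hn := SameCycle.symm (M.sameFace_next z.1)
  exact skipRoot_of_ne (fun he => hz'.1 (by rwa [he] at hn)) fun he => hz'.2 (by rwa [he] at hn)

theorem delete_perimeter : h.delete.perimeter =
    ({x | M.SameFace M.root x ∨ M.SameFace (M.rev M.root) x} \ {M.root, M.rev M.root}).ncard := by
  rw [perimeter, faceDegree, ← Set.ncard_image_of_injective _ Subtype.val_injective]
  congr 1
  ext x
  constructor
  · rintro ⟨x, hx, rfl⟩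
    exact ⟨(h.delete_onRootFace_iff x).1 hx, by simpa using x.2⟩
  · rintro ⟨hx, hx'⟩
    have hm : x ≠ M.root ∧ x ≠ M.rev M.root := by simpa using hx'
    exact ⟨⟨x, hm⟩, (h.delete_onRootFace_iff ⟨x, hm⟩).2 hx, rfl⟩

theorem delete_perimeter_of_leaf (hl : M.next M.root = M.rev M.root) :
    h.delete.perimeter + 2 = M.perimeter := by
  have hr : M.SameFace M.root (M.rev M.root) := hl ▸ M.sameFace_next M.root
  have hset : {x | M.SameFace M.root x ∨ M.SameFace (M.rev M.root) x} =
      {x | M.SameFace M.root x} := by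
    ext x; exact ⟨fun hx => hx.elim id fun hx => hr.trans hx, Or.inl⟩
  rw [delete_perimeter, hset, ← Set.ncard_pair (M.rev_ne M.root).symm,
    Set.ncard_sdiff_add_ncard_of_subset]
  · rfl
  · rintro x (rfl | rfl)
    · exact SameCycle.rfl
    · exact hr

theorem delete_perimeter_of_separating (hs : ¬ M.OnRootFace (M.rev M.root)) :
    h.delete.perimeter + 2 = M.perimeter + M.faceDegree (M.rev M.root) := by
  rw [delete_perimeter, ← Set.ncard_pair (M.rev_ne M.root).symm,
    Set.ncard_sdiff_add_ncard_of_subset, Set.ofPred_or, Set.ncard_union_eq]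
  · rfl
  · rw [Set.disjoint_left]
    intro x hx hx'
    exact hs (SameCycle.trans hx (SameCycle.symm hx'))
  · rintro x (rfl | rfl)
    · exact Or.inl SameCycle.rfl
    · exact Or.inr SameCycle.rfl

end RootRemovable

end RootedMap

/-! ### Two explicit maps with one hole: a polygon with a pendant edge, a polygon with a quadrangle
-/

theorem label_eq_of_sameCycle {α β : Type*} [Finite α] {p : Perm α} {φ : α → β}
    (h : ∀ x, φ (p x) = φ x) {x y : α} (hxy : p.SameCycle x y) : φ x = φ y :=
  sameCycle_one.1 (sameCycle_map (p' := 1) (fun x => sameCycle_one.2 (h x).symm) hxy)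

/-- The oriented edges of a polygon with `N` edges and of one more edge. The edge `n` of the polygon
has the polygon on the left when it is oriented as `outer n`, on the right when it is
oriented as `inner n`. -/
inductive PolygonDart (N : ℕ) : Type
  | outer (n : ZMod N)
  | inner (n : ZMod N)
  | out
  | back

namespace PolygonDart

variable {N : ℕ}

instance [NeZero N] : Finite (PolygonDart N) := by
  refine Finite.of_surjective (α := (ZMod N ⊕ ZMod N) ⊕ Bool)
    (Sum.elim (Sum.elim outer inner) fun b => if b then out else back) ?_
  rintro (n | n | _ | _)
  · exact ⟨.inl (.inl n), rfl⟩
  · exact ⟨.inl (.inr n), rfl⟩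
  · exact ⟨.inr true, rfl⟩
  · exact ⟨.inr false, rfl⟩

/-- The other orientation. -/
def flip : PolygonDart N → PolygonDart N
  | outer n => inner n
  | inner n => outer n
  | out => back
  | back => out

theorem flip_flip : ∀ x : PolygonDart N, flip (flip x) = x
  | outer _ | inner _ | out | back => rfl

/-- The orientation reversal. -/
def rev (N : ℕ) : Perm (PolygonDart N) := Function.Involutive.toPerm flip flip_flip

@[simp] theorem rev_outer (n : ZMod N) : rev N (outer n) = inner n := rfl
@[simp] theorem rev_inner (n : ZMod N) : rev N (inner n) = outer n := rfl

theorem rev_ne : ∀ x : PolygonDart N, rev N x ≠ x := by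
  rintro (_ | _ | _ | _) h <;> cases h

theorem numCycles_rev [NeZero N] : numCycles (rev N) = N + 1 := by
  rw [numCycles_eq_card_of_label (β := Option (ZMod N))
    (fun | outer n => some n | inner n => some n | out => none | back => none)
    (fun | some n => outer n | none => out)]
  · simp
  · rintro (_ | _ | _ | _) <;> rfl
  · have s := fun x => sameCycle_apply (rev N) x
    rintro (n | n | _ | _)
    · exact SameCycle.rfl
    · exact s (outer n)
    · exact SameCycle.rfl
    · exact s out
  · rintro (_ | _) <;> rfl

/-- The order along the faces of a polygon with a pendant edge outside. -/
def pendantNext (N : ℕ) : Perm (PolygonDart N) where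
  toFun
    -- With vertex `n` the start of `outer n`, the pendant edge is attached at the vertex `0`,
    -- between `outer (-1)` and `outer 0`; `out` leads to its leaf and `back` returns.
    | outer n => if n = -1 then out else outer (n + 1)
    | inner n => inner (n - 1)
    | out => back
    | back => outer 0
  invFun
    | outer n => if n = 0 then back else outer (n - 1)
    | inner n => inner (n + 1)
    | out => outer (-1)
    | back => out
  left_inv := by
    rintro (n | n | _ | _)
    · by_cases h : n = -1
      · simp [h]
      · have : n + 1 ≠ 0 := fun h' => h (eq_neg_of_add_eq_zero_left h')
        simp [h, this]
    all_goals simp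
  right_inv := by
    rintro (n | n | _ | _)
    · by_cases h : n = 0
      · simp [h]
      · simp [h]
    all_goals simp

@[simp] theorem pendantNext_outer (n : ZMod N) :
    pendantNext N (outer n) = if n = -1 then out else outer (n + 1) := rfl
@[simp] theorem pendantNext_inner (n : ZMod N) : pendantNext N (inner n) = inner (n - 1) := rfl
@[simp] theorem pendantNext_back : pendantNext N back = outer 0 := rfl

theorem forall_zmod_of_succ [NeZero N] {C : ZMod N → Prop} (h0 : C 0) (h : ∀ n, C n → C (n + 1))
    (n : ZMod N) : C n := by
  have : ∀ k : ℕ, C (k : ZMod N) := fun k => by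
    induction k with
    | zero => simpa using h0
    | succ k ih => simpa using h _ ih
  simpa using this n.val

theorem forall_zmod_of_pred [NeZero N] {C : ZMod N → Prop} {a : ZMod N} (h0 : C a)
    (h : ∀ n, C n → C (n - 1)) (n : ZMod N) : C n := by
  have := forall_zmod_of_succ (C := fun n => C (a - n)) (by simpa using h0)
    (fun n hn => by rw [← sub_sub]; exact h _ hn) (a - n)
  simpa using this

variable [NeZero N]

theorem connected {next : Perm (PolygonDart N)} (h1 : ∀ n, next (inner n) = inner (n - 1))
    {C : PolygonDart N → Prop} (h0 : C out) (hrev : ∀ x, C x → C (rev N x))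
    (hnext : ∀ x, C x → C (next x)) {a : ZMod N} (ha : next out = outer a ∨ next back = outer a)
    (x : PolygonDart N) : C x := by
  have hb : C back := hrev out h0
  have hC : C (outer a) := ha.elim (fun h => h ▸ hnext _ h0) fun h => h ▸ hnext _ hb
  have ho : ∀ n, C (outer n) := forall_zmod_of_pred hC fun n hn => by
    have := hrev _ (hnext _ (hrev _ hn))
    rwa [rev_outer, h1, rev_inner] at this
  rcases x with n | n | _ | _
  · exact ho n
  · exact hrev _ (ho n)
  · exact h0
  · exact hb

theorem sameCycle_inner {next : Perm (PolygonDart N)} (h1 : ∀ n, next (inner n) = inner (n - 1))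
    (n : ZMod N) : next.SameCycle (inner 0) (inner n) :=
  forall_zmod_of_pred (C := fun n => next.SameCycle (inner 0) (inner n)) (a := 0) SameCycle.rfl
    (fun n hn => by rw [← h1]; exact hn.trans (sameCycle_apply _ _)) n

theorem symm_iterate_inner {next : Perm (PolygonDart N)} (h1 : ∀ n, next (inner n) = inner (n - 1))
    (n : ℕ) : next.symm^[n] (inner 0) = inner (n : ZMod N) := by
  induction n with
  | zero => simp
  | succ n ih => rw [Function.iterate_succ_apply', ih, symm_apply_eq, h1]; simp

theorem sameCycle_vertex {next : Perm (PolygonDart N)} (h1 : ∀ n, next (inner n) = inner (n - 1))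
    (n : ZMod N) : (next * rev N).SameCycle (outer (n + 1)) (inner n) := by
  have := sameCycle_apply (next * rev N) (outer (n + 1))
  rwa [Perm.mul_apply, rev_outer, h1, add_sub_cancel_right] at this

/-! ### A polygon with a pendant edge -/

/-- The starting vertices of the oriented edges of a polygon with a pendant edge. -/
def pendantVertex : PolygonDart N → Option (ZMod N)
  | outer n => some n
  | inner n => some (n + 1)
  | out => some 0
  | back => none

theorem pendantVertex_apply (x : PolygonDart N) :
    pendantVertex ((pendantNext N * rev N) x) = pendantVertex x := by
  rcases x with n | n | _ | _
  · simp [pendantVertex]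
  · by_cases h : n = -1 <;> simp [pendantVertex, h]
  · rfl
  · rfl

theorem numCycles_pendantVertex : numCycles (pendantNext N * rev N) = N + 1 := by
  rw [numCycles_eq_card_of_label pendantVertex
    (fun | some n => outer n | none => back) pendantVertex_apply]
  · simp
  · rintro (n | n | _ | _)
    · exact SameCycle.rfl
    · exact sameCycle_vertex pendantNext_inner n
    · exact (sameCycle_apply (pendantNext N * rev N) out).symm
    · exact SameCycle.rfl
  · rintro (_ | _) <;> rfl

/-- Whether an oriented edge has the polygon on its right. -/
def isInner : PolygonDart N → Bool
  | inner _ => true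
  | _ => false

theorem isInner_pendantNext (x : PolygonDart N) : isInner (pendantNext N x) = isInner x := by
  rcases x with n | n | _ | _
  · by_cases h : n = -1 <;> simp [isInner, h]
  all_goals rfl

theorem sameCycle_pendantNext {x : PolygonDart N} (hx : isInner x = false) :
    (pendantNext N).SameCycle out x := by
  have s := fun x => sameCycle_apply (pendantNext N) x
  have h0 : (pendantNext N).SameCycle out (outer 0) := (s out).trans (s back)
  rcases x with n | n | _ | _
  · refine forall_zmod_of_succ (C := fun n => (pendantNext N).SameCycle out (outer n)) h0
      (fun n hn => ?_) n
    by_cases h : n = -1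
    · simpa [h] using h0
    · have := s (outer n)
      rw [pendantNext_outer, if_neg h] at this
      exact hn.trans this
  · cases hx
  · exact SameCycle.rfl
  · exact s out

theorem numCycles_pendantNext : numCycles (pendantNext N) = 2 := by
  rw [numCycles_eq_card_of_label isInner (fun b => if b then inner 0 else out)
    isInner_pendantNext]
  · simp
  · intro x
    cases hx : isInner x
    · exact sameCycle_pendantNext hx
    · rcases x with n | n | _ | _
      · cases hx
      · exact sameCycle_inner pendantNext_inner n
      · cases hx
      · cases hx
  · intro b; cases b <;> rfl

variable (N) in
/-- The polygon with `N` edges, which is a hole, with a pendant root edge outside. -/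
def pendant : HoledQuad (PolygonDart N) 1 where
  rev := rev N
  next := pendantNext N
  root := out
  rev_rev := flip_flip
  rev_ne := rev_ne
  connected := RootedMap.connected_of_induction fun _ h0 h1 h2 =>
    connected pendantNext_inner h0 h1 h2 (Or.inr pendantNext_back)
  euler := by
    change (numCycles (pendantNext N * rev N) : ℤ) - numCycles (rev N) +
      numCycles (pendantNext N) = 2
    rw [numCycles_pendantVertex, numCycles_rev, numCycles_pendantNext]
    simp
  mark _ := outer 0
  hole_not_root _ h := by
    have := label_eq_of_sameCycle isInner_pendantNext h
    cases this
  hole_ne i j h := absurd (Subsingleton.elim i j) h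
  simple_disjoint := by
    intro _ _ x y hx hy hxy
    have hx' := label_eq_of_sameCycle isInner_pendantNext hx
    have hy' := label_eq_of_sameCycle isInner_pendantNext hy
    have h := label_eq_of_sameCycle pendantVertex_apply hxy
    rcases x with n | n | _ | _ <;> cases hx'
    rcases y with n' | n' | _ | _ <;> cases hy'
    simpa [pendantVertex] using h
  faceDegree_eq x h1 h2 := by
    exfalso
    cases hx : isInner x
    · exact h1 (sameCycle_pendantNext hx)
    · rcases x with n | n | _ | _ <;> cases hx
      exact h2 0 (sameCycle_inner pendantNext_inner n)

theorem ncard_inner : {x : PolygonDart N | isInner x = true}.ncard = N := by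
  have : {x : PolygonDart N | isInner x = true} = Set.range inner := by
    ext x
    rcases x with n | n | _ | _ <;> simp [isInner]
  rw [this, ← Set.image_univ, Set.ncard_image_of_injective _ (fun _ _ h => inner.inj h),
    Set.ncard_univ, Nat.card_zmod]

theorem pendant_holeDegree : (pendant N).holeDegree 0 = N := by
  refine Eq.trans ?_ ncard_inner
  refine congrArg Set.ncard (Set.ext fun x => ⟨fun h => ?_, fun h => ?_⟩)
  · exact (label_eq_of_sameCycle isInner_pendantNext h).symm
  · rcases x with n | n | _ | _ <;> cases h
    exact sameCycle_inner pendantNext_inner n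

theorem pendant_perimeter : (pendant N).perimeter = N + 2 := by
  have h1 : {x | (pendant N).SameFace (pendant N).root x} =
      insert out (insert back (Set.range outer)) := by
    ext x
    have : (pendant N).SameFace (pendant N).root x ↔ isInner x = false :=
      ⟨fun h => (label_eq_of_sameCycle isInner_pendantNext h).symm, sameCycle_pendantNext⟩
    rw [Set.mem_ofPred_eq, this]
    rcases x with n | n | _ | _ <;> simp [isInner]
  rw [RootedMap.perimeter, RootedMap.faceDegree, h1, Set.ncard_insert_of_notMem (by simp),
    Set.ncard_insert_of_notMem (by simp), ← Set.image_univ,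
    Set.ncard_image_of_injective _ (fun _ _ h => outer.inj h), Set.ncard_univ, Nat.card_zmod]

theorem pendant_numInnerFaces : (pendant N).numInnerFaces = 1 := by
  have h := (pendant N).toRootedMap.numCycles_next
  have h' : numCycles (pendant N).next = 2 := numCycles_pendantNext
  omega

/-! ### A polygon with a quadrangle -/

omit [NeZero N] in
theorem natCast_ne_zero_of_lt {k : ℕ} (h0 : 0 < k) (h : k < N) : (k : ZMod N) ≠ 0 := by
  rw [Ne, ZMod.natCast_eq_zero_iff]
  exact Nat.not_dvd_of_pos_of_lt h0 h

section Chord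

variable (hN : 4 ≤ N)
include hN

omit [NeZero N] in
theorem one_two_three_ne_zero :
    (1 : ZMod N) ≠ 0 ∧ (2 : ZMod N) ≠ 0 ∧ (3 : ZMod N) ≠ 0 := by
  refine ⟨?_, ?_, ?_⟩
  · simpa using natCast_ne_zero_of_lt (N := N) (k := 1) (by omega) (by omega)
  · simpa using natCast_ne_zero_of_lt (N := N) (k := 2) (by omega) (by omega)
  · simpa using natCast_ne_zero_of_lt (N := N) (k := 3) (by omega) (by omega)

/-- The order along the faces of a polygon with an edge outside that cuts a quadrangle. -/
def chordNext : Perm (PolygonDart N) where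
  toFun
    -- The edge `out` goes from the vertex `0` to the vertex `3`, so the quadrangle is `back`,
    -- `outer 0`, `outer 1`, `outer 2`. The two tests exclude each other, since `3 ≠ 0` when `4 ≤
    -- N`.
    | outer n => if n = 2 then back else if n = -1 then out else outer (n + 1)
    | inner n => inner (n - 1)
    | out => outer 3
    | back => outer 0
  invFun
    | outer n => if n = 3 then out else if n = 0 then back else outer (n - 1)
    | inner n => inner (n + 1)
    | out => outer (-1)
    | back => outer 2
  left_inv := by
    obtain ⟨-, -, h3⟩ := one_two_three_ne_zero hN
    rintro (n | n | _ | _)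
    · by_cases h : n = 2
      · simp [h]
      by_cases h' : n = -1
      · subst h'
        simp [h]
      · have h4 : n + 1 ≠ 0 := fun h'' => h' (eq_neg_of_add_eq_zero_left h'')
        have h5 : n + 1 ≠ 3 := fun h'' => h (by linear_combination h'')
        simp [h, h', h4, h5]
    all_goals simp [h3.symm]
  right_inv := by
    obtain ⟨-, -, h3⟩ := one_two_three_ne_zero hN
    have h4 : (-1 : ZMod N) ≠ 2 := fun h => h3 (by linear_combination -h)
    rintro (n | n | _ | _)
    · by_cases h : n = 3
      · simp [h]
      by_cases h' : n = 0
      · subst h'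
        simp [h]
      · have h5 : n - 1 ≠ 2 := fun h'' => h (by linear_combination h'')
        have h6 : n - 1 ≠ -1 := fun h'' => h' (by linear_combination h'')
        simp [h, h', h5, h6]
    all_goals simp [h4]

omit [NeZero N] in
theorem chordNext_outer (n : ZMod N) : chordNext hN (outer n) =
    if n = 2 then back else if n = -1 then out else outer (n + 1) := rfl
omit [NeZero N] in
theorem chordNext_inner (n : ZMod N) : chordNext hN (inner n) = inner (n - 1) := rfl
omit [NeZero N] in
theorem chordNext_out : chordNext hN out = outer 3 := rfl
omit [NeZero N] in
theorem chordNext_back : chordNext hN back = outer 0 := rfl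

omit hN [NeZero N] in
/-- The starting vertices of the oriented edges of a polygon with a quadrangle. -/
def chordVertex : PolygonDart N → ZMod N
  | outer n => n
  | inner n => n + 1
  | out => 0
  | back => 3

omit [NeZero N] in
theorem chordVertex_apply (x : PolygonDart N) :
    chordVertex ((chordNext hN * rev N) x) = chordVertex x := by
  rcases x with n | n | _ | _
  · simp [chordVertex, chordNext_inner]
  · rw [Perm.mul_apply, rev_inner, chordNext_outer]
    split_ifs with h h'
    · subst h; simp only [chordVertex]; norm_num
    · subst h'; simp [chordVertex]
    · rfl
  · rfl
  · rfl

theorem numCycles_chordVertex : numCycles (chordNext hN * rev N) = N := by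
  rw [numCycles_eq_card_of_label chordVertex outer (chordVertex_apply hN), Nat.card_zmod]
  · rintro (n | n | _ | _)
    · exact SameCycle.rfl
    · exact sameCycle_vertex (chordNext_inner hN) n
    · exact (sameCycle_apply (chordNext hN * rev N) out).symm
    · exact (sameCycle_apply (chordNext hN * rev N) back).symm
  · exact fun _ => rfl

omit hN [NeZero N] in
open Classical in
/-- The faces of a polygon with a quadrangle: `0` is the quadrangle, `1` is the root face, `2` is
the polygon. -/
noncomputable def chordFace : PolygonDart N → Fin 3
  | outer n => if n = 0 ∨ n = 1 ∨ n = 2 then 0 else 1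
  | inner _ => 2
  | out => 1
  | back => 0

omit [NeZero N] in
theorem chordFace_apply (x : PolygonDart N) : chordFace (chordNext hN x) = chordFace x := by
  obtain ⟨h1, h2, h3⟩ := one_two_three_ne_zero hN
  rcases x with n | n | _ | _
  · rw [chordNext_outer]
    by_cases h : n = 2
    · simp [h, chordFace]
    by_cases h' : n = -1
    · subst h'
      have h4 : (-1 : ZMod N) ≠ 1 := fun h => h2 (by linear_combination -h)
      simp [chordFace, h, h4, h1]
    · rw [if_neg h, if_neg h']
      have h4 : n + 1 = 0 ↔ False := iff_false_intro fun h'' => h' (eq_neg_of_add_eq_zero_left h'')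
      have h5 : n + 1 = 1 ↔ n = 0 := by simp
      have h6 : n + 1 = 2 ↔ n = 1 :=
        ⟨fun h => by linear_combination h, fun h => by linear_combination h⟩
      simp only [chordFace, h4, h5, h6, h, false_or, or_false]
  · rfl
  · have h4 : (3 : ZMod N) ≠ 1 := fun h => h2 (by linear_combination h)
    have h5 : (3 : ZMod N) ≠ 2 := fun h => h1 (by linear_combination h)
    simp [chordNext_out, chordFace, h3, h4, h5]
  · simp [chordNext_back, chordFace]

theorem sameCycle_chord_outer (n : ZMod N) :
    (((n = 0 ∨ n = 1 ∨ n = 2) ∧ (chordNext hN).SameCycle back (outer n)) ∨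
      (chordNext hN).SameCycle out (outer n)) := by
  have s := fun x => sameCycle_apply (chordNext hN) x
  have h0 : (chordNext hN).SameCycle back (outer 0) := s back
  refine forall_zmod_of_succ (C := fun n => ((n = 0 ∨ n = 1 ∨ n = 2) ∧
    (chordNext hN).SameCycle back (outer n)) ∨ (chordNext hN).SameCycle out (outer n))
    (Or.inl ⟨Or.inl rfl, h0⟩) ?_ n
  intro n hn
  by_cases h' : n = -1
  · subst h'
    exact Or.inl ⟨Or.inl (by simp), by simpa using h0⟩
  by_cases h : n = 2
  · subst h
    refine Or.inr ?_
    have := s out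
    rw [chordNext_out] at this
    convert this using 2
    norm_num
  have hs := s (outer n)
  rw [chordNext_outer, if_neg h, if_neg h'] at hs
  rcases hn with ⟨rfl | rfl | h2, hn⟩ | hn
  · exact Or.inl ⟨by simp, hn.trans hs⟩
  · exact Or.inl ⟨Or.inr (Or.inr (by norm_num)), hn.trans hs⟩
  · exact absurd h2 h
  · exact Or.inr (hn.trans hs)

theorem sameCycle_chordFace (x : PolygonDart N) :
    (chordNext hN).SameCycle (![back, out, inner 0] (chordFace x)) x := by
  rcases x with n | n | _ | _
  · rcases sameCycle_chord_outer hN n with ⟨h, hn⟩ | hn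
    · simpa [chordFace, h] using hn
    · have := label_eq_of_sameCycle (chordFace_apply hN) hn
      rw [← this]; exact hn
  · exact sameCycle_inner (chordNext_inner hN) n
  · exact SameCycle.rfl
  · exact SameCycle.rfl

theorem sameCycle_chord_iff (x y : PolygonDart N) :
    (chordNext hN).SameCycle x y ↔ chordFace x = chordFace y := by
  refine ⟨label_eq_of_sameCycle (chordFace_apply hN), fun h => ?_⟩
  have := sameCycle_chordFace hN y
  rw [← h] at this
  exact (sameCycle_chordFace hN x).symm.trans this

theorem numCycles_chordNext : numCycles (chordNext hN) = 3 := by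
  rw [numCycles_eq_card_of_label chordFace ![back, out, inner 0] (chordFace_apply hN)
    (sameCycle_chordFace hN), Nat.card_fin]
  intro i
  fin_cases i <;> rfl

theorem ncard_chord_quad : {x : PolygonDart N | chordFace (back : PolygonDart N) = chordFace x}.ncard = 4 := by
  obtain ⟨h1, h2, h3⟩ := one_two_three_ne_zero hN
  have h4 : (1 : ZMod N) ≠ 2 := fun h => h1 (by linear_combination -h)
  have : {x : PolygonDart N | chordFace (back : PolygonDart N) = chordFace x} =
      {back, outer 0, outer 1, outer 2} := by
    ext x
    rcases x with n | n | _ | _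
    · by_cases h : n = 0 ∨ n = 1 ∨ n = 2 <;> simp [chordFace, h]
    all_goals simp [chordFace]
  rw [this, Set.ncard_insert_of_notMem (by simp), Set.ncard_insert_of_notMem (by
    simp [h1.symm, h2.symm]), Set.ncard_pair (by simpa using h4)]

theorem ncard_chord_out : {x : PolygonDart N | chordFace (out : PolygonDart N) = chordFace x}.ncard + 2 = N := by
  obtain ⟨h1, h2, h3⟩ := one_two_three_ne_zero hN
  have h4 : (1 : ZMod N) ≠ 2 := fun h => h1 (by linear_combination -h)
  have : {x : PolygonDart N | chordFace (out : PolygonDart N) = chordFace x} =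
      insert out (outer '' ({0, 1, 2} : Set (ZMod N))ᶜ) := by
    ext x
    rcases x with n | n | _ | _
    · by_cases h : n = 0 ∨ n = 1 ∨ n = 2
      · simp only [Set.mem_ofPred_eq, chordFace, if_pos h]
        simpa [not_or] using fun h0 h1 => (h.resolve_left h0).resolve_left h1
      · simp only [Set.mem_ofPred_eq, chordFace, if_neg h]
        simpa using h
    all_goals simp [chordFace]
  have hc := Set.ncard_add_ncard_compl ({0, 1, 2} : Set (ZMod N))
  rw [Set.ncard_insert_of_notMem (by simp [h1.symm, h2.symm]), Set.ncard_pair h4,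
    Nat.card_zmod] at hc
  rw [this, Set.ncard_insert_of_notMem (by simp),
    Set.ncard_image_of_injective _ (fun _ _ h => outer.inj h)]
  omega

/-- The polygon with `N` edges, which is a hole, with a root edge outside that cuts a
quadrangle. -/
def chord : HoledQuad (PolygonDart N) 1 where
  rev := rev N
  next := chordNext hN
  root := out
  rev_rev := flip_flip
  rev_ne := rev_ne
  connected := RootedMap.connected_of_induction fun _ h0 h1 h2 =>
    connected (chordNext_inner hN) h0 h1 h2 (Or.inr (chordNext_back hN))
  euler := by
    change (numCycles (chordNext hN * rev N) : ℤ) - numCycles (rev N) +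
      numCycles (chordNext hN) = 2
    rw [numCycles_chordVertex, numCycles_rev, numCycles_chordNext]
    push_cast
    ring
  mark _ := outer 0
  hole_not_root _ h := by
    have := label_eq_of_sameCycle (chordFace_apply hN) h
    cases this
  hole_ne i j h := absurd (Subsingleton.elim i j) h
  simple_disjoint := by
    intro _ _ x y hx hy hxy
    have key : ∀ z : PolygonDart N, (chordNext hN).SameCycle (inner 0) z → ∃ n, z = inner n := by
      intro z hz
      have h := label_eq_of_sameCycle (chordFace_apply hN) hz
      rcases z with n | n | _ | _
      · by_cases hn : n = 0 ∨ n = 1 ∨ n = 2 <;> simp [chordFace, hn] at h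
      · exact ⟨n, rfl⟩
      all_goals simp [chordFace] at h
    obtain ⟨n, rfl⟩ := key x hx
    obtain ⟨n', rfl⟩ := key y hy
    have h := label_eq_of_sameCycle (chordVertex_apply hN) hxy
    simpa [chordVertex] using h
  faceDegree_eq x h1 h2 := by
    have h1' : ¬ (chordNext hN).SameCycle out x := h1
    have h2' : ¬ (chordNext hN).SameCycle (inner 0) x := h2 0
    rw [sameCycle_chord_iff] at h1' h2'
    have hx : chordFace x = chordFace (back : PolygonDart N) := by
      change ¬ (1 : Fin 3) = _ at h1'
      change ¬ (2 : Fin 3) = _ at h2'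
      change _ = (0 : Fin 3)
      omega
    refine Eq.trans ?_ (ncard_chord_quad hN)
    refine congrArg Set.ncard (Set.ext fun y => ?_)
    exact (sameCycle_chord_iff hN x y).trans (by rw [hx]; rfl)

theorem chord_holeDegree : (chord hN).holeDegree 0 = N := by
  refine Eq.trans ?_ ncard_inner
  refine congrArg Set.ncard (Set.ext fun x => (sameCycle_chord_iff hN (inner 0) x).trans ?_)
  rcases x with n | n | _ | _
  · by_cases hn : n = 0 ∨ n = 1 ∨ n = 2 <;> simp [chordFace, hn, isInner]
  all_goals simp [chordFace, isInner]

theorem chord_perimeter : (chord hN).perimeter + 2 = N := by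
  refine Eq.trans ?_ (ncard_chord_out hN)
  refine congrArg (fun s : Set (PolygonDart N) => s.ncard + 2) (Set.ext fun x => ?_)
  exact sameCycle_chord_iff hN out x

theorem chord_numInnerFaces : (chord hN).numInnerFaces = 2 := by
  have h := (chord hN).toRootedMap.numCycles_next
  have h' : numCycles (chord hN).next = 3 := numCycles_chordNext hN
  omega

end Chord

end PolygonDart

/-! ### A map as a polygon filled with the map without its root edge -/

namespace RootedMap

variable {D : Type} [Finite D] {M : RootedMap D}

namespace RootRemovable

variable (h : M.RootRemovable) {N : ℕ} (hN : h.delete.perimeter = N)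

/-- The oriented edges along the root face of the map without its root edge. -/
noncomputable def boundary (n : ZMod N) : M.Rest := h.next^[n.val] h.root

variable [NeZero N]

include hN in
theorem boundary_natCast (n : ℕ) : h.boundary (n : ZMod N) = h.next^[n] h.root := by
  have := h.delete.next_iterate_eq_iff (n : ZMod N).val n
  rw [hN, ZMod.val_natCast] at this
  rw [boundary, ZMod.val_natCast]
  exact this.2 (Nat.mod_modEq n N)

include hN in
theorem boundary_succ (n : ZMod N) : h.boundary (n + 1) = h.next (h.boundary n) := by
  have h1 : n = (n.val : ZMod N) := by simp
  have h2 : n + 1 = ((n.val + 1 : ℕ) : ZMod N) := by simp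
  rw [h2, h.boundary_natCast hN, Function.iterate_succ_apply', ← h.boundary_natCast hN, ← h1]

omit [NeZero N] in
theorem boundary_zero : h.boundary (0 : ZMod N) = h.root := by simp [boundary]

include hN in
theorem boundary_injective : Function.Injective (h.boundary (N := N)) := by
  intro a b hab
  have := (h.delete.next_iterate_eq_iff a.val b.val).1 hab
  rw [hN] at this
  have := (ZMod.natCast_eq_natCast_iff _ _ _).2 this
  simpa using this

include hN in
theorem exists_boundary {x : M.Rest} (hx : h.delete.OnRootFace x) :
    ∃ n : ZMod N, h.boundary n = x := by
  obtain ⟨n, rfl⟩ := hx.exists_iterate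
  exact ⟨n, h.boundary_natCast hN n⟩

-- The boundary starts at `next (rev root)`, the dart that `skipRoot` puts after the predecessor of
-- the root; this predecessor therefore closes the boundary.
include hN in
theorem next_boundary_eq_root_iff (n : ZMod N) :
    M.next (h.boundary n).1 = M.root ↔ n = -1 := by
  have hs := congrArg Subtype.val (h.boundary_succ hN n)
  rw [coe_next] at hs
  constructor
  · intro hn
    rw [skipRoot_of_eq_root hn] at hs
    have : h.boundary (n + 1) = h.boundary (0 : ZMod N) := by rw [boundary_zero]; exact Subtype.ext hs
    exact eq_neg_of_add_eq_zero_left (h.boundary_injective hN this)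
  · rintro rfl
    rw [neg_add_cancel, boundary_zero] at hs
    rcases M.skipRoot_cases (h.boundary (-1 : ZMod N)).1 with ⟨h1, -⟩ | ⟨-, h2⟩ | ⟨-, -, h2⟩
    · exact h1
    · rw [h2] at hs; exact absurd hs (M.next_rev_ne_next _)
    · rw [h2] at hs; exact absurd (M.next.injective hs).symm (h.boundary _).2.2

/-- The place in `M` of the oriented edges of a polygon around the map without its root edge,
and of the root edge. -/
noncomputable def polygonMap : PolygonDart N → D
  | .outer n => (h.boundary n).1
  | .inner n => M.rev (h.boundary n).1
  | .out => M.root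
  | .back => M.rev M.root

-- Common to the leaf and the separating case. The darts off the hole are the outer sides of the
-- polygon, sent to the boundary of `h.delete`, and the two sides of the root edge; all other darts
-- of `M` are internal in `h.delete`. Only `hnext`, the order along the faces outside the polygon,
-- depends on the case.
include hN in
theorem isGluingPair {q : HoledQuad (PolygonDart N) 1} (hrev : q.rev = PolygonDart.rev N)
    (hroot : q.root = .out) (hmark : q.mark 0 = .outer 0)
    (hinner : ∀ n, q.next (.inner n) = .inner (n - 1))
    (hoff : ∀ x : PolygonDart N, q.OnHole 0 x → x.isInner = true)
    (hnext : ∀ x : PolygonDart N, x.isInner = false →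
      h.polygonMap (q.next x) = M.next (h.polygonMap x)) :
    q.IsGluingPair (fun _ => h.delete) M h.polygonMap (fun _ => Subtype.val) := by
  have hon : ∀ x : PolygonDart N, q.OffHoles x ↔ x.isInner = false := by
    intro x
    constructor
    · intro hx
      rcases x with n | n | _ | _
      · rfl
      · refine absurd ?_ (hx 0)
        rw [HoledQuad.OnHole, hmark, hrev]
        exact PolygonDart.sameCycle_inner hinner n
      · rfl
      · rfl
    · intro hx i hi
      rw [Subsingleton.elim i 0] at hi
      rw [hoff x hi] at hx
      cases hx
  have hedge : ∀ i n, q.holeEdge i n = .outer (n : ZMod N) := by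
    intro i n
    rw [HoledQuad.holeEdge, Subsingleton.elim i 0, hmark, hrev, PolygonDart.rev_outer,
      PolygonDart.symm_iterate_inner hinner, PolygonDart.rev_inner]
  have hne : ∀ x : PolygonDart N, x.isInner = false → ∀ y, ¬ h.delete.OnRootFace y →
      h.polygonMap x ≠ y.1 := by
    rintro (n | n | _ | _) hx y hy he
    · have : h.boundary n = y := Subtype.ext he
      exact hy (this ▸ sameCycle_iterate _ _ _)
    · cases hx
    · exact y.2.1 he.symm
    · exact y.2.2 he.symm
  refine ⟨?_, ?_, fun _ _ => rfl, ?_, fun x hx => hnext x ((hon x).1 hx), ?_, ?_, ?_⟩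
  · rw [hroot]; rfl
  · rw [hrev]
    rintro (n | n | _ | _)
    · rfl
    · exact (M.rev_rev _).symm
    · rfl
    · exact (M.rev_rev _).symm
  · intro i n
    rw [hedge]
    exact congrArg Subtype.val (h.boundary_natCast hN n).symm
  · intro _ y hy
    rw [delete_onRootFace_iff, not_or] at hy
    have hn := SameCycle.symm (M.sameFace_next y.1)
    exact skipRoot_of_ne (fun he => hy.1 (by rwa [he] at hn)) fun he => hy.2 (by rwa [he] at hn)
  · rintro (⟨x, hx⟩ | ⟨i, y, hy⟩) (⟨x', hx'⟩ | ⟨i', y', hy'⟩) he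
    · rw [hon] at hx hx'
      simp only [Sum.elim_inl] at he
      have hb := fun n : ZMod N => (h.boundary n).2
      have hr := M.rev_ne M.root
      congr 1
      apply Subtype.ext
      rcases x with n | n | _ | _ <;> rcases x' with n' | n' | _ | _ <;>
        first
        | exact Bool.noConfusion (show true = false from hx)
        | exact Bool.noConfusion (show true = false from hx')
        | rfl
        | exact congrArg PolygonDart.outer (h.boundary_injective hN (Subtype.ext he))
        | exact absurd he (hb _).1
        | exact absurd he (hb _).2
        | exact absurd he.symm (hb _).1
        | exact absurd he.symm (hb _).2
        | exact absurd he hr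
        | exact absurd he.symm hr
    · exact absurd he (hne x ((hon x).1 hx) y' hy')
    · exact absurd he.symm (hne x' ((hon x').1 hx') y hy)
    · obtain rfl : y = y' := Subtype.ext he
      rw [Subsingleton.elim i i']
  · intro z
    by_cases h1 : z = M.root
    · exact ⟨.inl ⟨.out, (hon _).2 rfl⟩, h1.symm⟩
    by_cases h2 : z = M.rev M.root
    · exact ⟨.inl ⟨.back, (hon _).2 rfl⟩, h2.symm⟩
    by_cases h3 : h.delete.OnRootFace ⟨z, h1, h2⟩
    · obtain ⟨n, hn⟩ := h.exists_boundary hN h3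
      exact ⟨.inl ⟨.outer n, (hon _).2 rfl⟩, congrArg Subtype.val hn⟩
    · exact ⟨.inr ⟨0, ⟨z, h1, h2⟩, h3⟩, rfl⟩

include hN in
theorem isGluingPair_pendant (hl : M.next M.root = M.rev M.root) :
    (PolygonDart.pendant N).IsGluingPair (fun _ => h.delete) M h.polygonMap
      (fun _ => Subtype.val) := by
  refine h.isGluingPair hN rfl rfl rfl PolygonDart.pendantNext_inner (fun x hx => ?_) ?_
  · exact (label_eq_of_sameCycle PolygonDart.isInner_pendantNext hx).symm
  · rintro (n | n | _ | _) hx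
    · change h.polygonMap (PolygonDart.pendantNext N (.outer n)) = M.next (h.boundary n).1
      have hr := h.next_boundary_eq_root_iff hN n
      rw [PolygonDart.pendantNext_outer]
      split_ifs with hn
      · exact (hr.2 hn).symm
      · have he : M.next (h.boundary n).1 ≠ M.rev M.root := fun he =>
          (h.boundary n).2.1 (M.next.injective (he.trans hl.symm))
        rw [← skipRoot_of_ne (mt hr.1 hn) he, ← h.coe_next, ← h.boundary_succ hN]
        rfl
    · cases hx
    · exact hl.symm
    · exact congrArg Subtype.val h.boundary_zero

include hN in
theorem isGluingPair_chord (hs : ¬ M.OnRootFace (M.rev M.root))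
    (h4 : M.faceDegree (M.rev M.root) = 4) (hN4 : 4 ≤ N) :
    (PolygonDart.chord hN4).IsGluingPair (fun _ => h.delete) M h.polygonMap
      (fun _ => Subtype.val) := by
  obtain ⟨h1, h2, h3⟩ := PolygonDart.one_two_three_ne_zero hN4
  have hr := h.next_boundary_eq_root_iff hN
  -- the face of `M.rev M.root` is a quadrangle
  have hit := iterate_eq_iff_modEq M.next (M.rev M.root)
  have hdeg : {y | M.next.SameCycle (M.rev M.root) y}.ncard = 4 := h4
  rw [hdeg] at hit
  have hne : ∀ k, M.next^[k] (M.rev M.root) ≠ M.root := fun k hk =>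
    hs (SameCycle.symm (by
      have := sameCycle_iterate M.next k (M.rev M.root)
      rwa [hk] at this))
  -- The boundary starts just after `rev root`, so its first three darts are the other sides of the
  -- quadrangle.
  have hq : ∀ k : ℕ, k < 3 → (h.boundary (k : ZMod N)).1 = M.next^[k + 1] (M.rev M.root) := by
    intro k hk
    induction k with
    | zero => simp [boundary_zero]; rfl
    | succ k ih =>
      have := congrArg Subtype.val (h.boundary_succ hN (k : ZMod N))
      rw [h.coe_next, skipRoot_of_ne, ih (by omega), ← Function.iterate_succ_apply' M.next] at this
      · simpa using this
      · rw [ih (by omega), ← Function.iterate_succ_apply' M.next]; exact hne _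
      · rw [ih (by omega), ← Function.iterate_succ_apply' M.next]
        intro he
        have := (hit _ 0).1 he
        rw [Nat.modEq_zero_iff_dvd] at this
        omega
  have hq2 : M.next (h.boundary (2 : ZMod N)).1 = M.rev M.root := by
    have := hq 2 (by omega)
    rw [Nat.cast_ofNat] at this
    rw [this, ← Function.iterate_succ_apply' M.next]
    exact (hit 4 0).2 rfl
  -- After the last side of the quadrangle the boundary jumps over the root edge into the former
  -- root face, which matches `chordNext` at `out`.
  have hq3 : (h.boundary (3 : ZMod N)).1 = M.next M.root := by
    have := congrArg Subtype.val (h.boundary_succ hN (2 : ZMod N))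
    rw [h.coe_next, skipRoot_of_eq_rev hq2] at this
    rw [← this]
    congr 2
    norm_num
  refine h.isGluingPair hN (q := PolygonDart.chord hN4) rfl rfl rfl (PolygonDart.chordNext_inner hN4) (fun x hx => ?_) ?_
  · have := label_eq_of_sameCycle (PolygonDart.chordFace_apply hN4) hx
    rcases x with n | n | _ | _
    · by_cases hn : n = 0 ∨ n = 1 ∨ n = 2 <;>
        simp [PolygonDart.chordFace, hn, PolygonDart.chord] at this
    · rfl
    all_goals simp [PolygonDart.chordFace, PolygonDart.chord] at this
  · rintro (n | n | _ | _) hx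
    · change h.polygonMap (PolygonDart.chordNext hN4 (.outer n)) = M.next (h.boundary n).1
      rw [PolygonDart.chordNext_outer]
      split_ifs with hn hn'
      · rw [hn, hq2]; rfl
      · exact ((hr n).2 hn').symm
      · have he : M.next (h.boundary n).1 ≠ M.rev M.root := fun he =>
          hn (h.boundary_injective hN (Subtype.ext (M.next.injective (he.trans hq2.symm))))
        rw [← skipRoot_of_ne (mt (hr n).1 hn') he, ← h.coe_next, ← h.boundary_succ hN]
        rfl
    · cases hx
    · exact hq3
    · exact congrArg Subtype.val h.boundary_zero

omit [NeZero N] in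
theorem delete_isQuad {ℓ ℓ' : ℕ} (hM : M.IsQuad ℓ) (hp : h.delete.perimeter = 2 * ℓ') :
    h.delete.IsQuad ℓ' := by
  refine ⟨hp, fun x hx => ?_⟩
  rw [h.delete_faceDegree hx]
  rw [delete_onRootFace_iff, not_or] at hx
  exact hM.2 x.1 hx.1

end RootRemovable

/-! ### Separating edges, leaves, and the map with one edge -/

theorem faceDegree_eq_one {d : D} (h : M.next d = d) : M.faceDegree d = 1 := by
  have : {x | M.SameFace d x} = {d} := by
    ext x
    exact ⟨fun hx => (SameCycle.eq_of_left hx h).symm, fun hx => hx ▸ SameCycle.rfl⟩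
  rw [faceDegree, this, Set.ncard_singleton]

theorem onRootFace_of_numInnerFaces_eq_zero (h : M.numInnerFaces = 0) (d : D) :
    M.OnRootFace d := by
  have h1 := M.numCycles_next
  rw [h, numCycles, Nat.card_eq_one_iff_unique] at h1
  obtain ⟨h1, -⟩ := h1
  exact Quotient.exact (h1.elim (Quotient.mk (SameCycle.setoid M.next) M.root) (Quotient.mk _ d))

/-- Otherwise the root face is closed under `rev` as well as `next`, and by connectedness it is the
only face. -/
theorem exists_separating (h : M.numInnerFaces ≠ 0) :
    ∃ d, M.OnRootFace d ∧ ¬ M.OnRootFace (M.rev d) := by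
  by_contra! hc
  have hall := M.induction (C := M.OnRootFace) SameCycle.rfl hc
    fun d hd => M.onRootFace_next_iff.2 hd
  have h1 := M.numCycles_innerFaces
  have : IsEmpty {d // ¬ M.OnRootFace d} := ⟨fun d => d.2 (hall d.1)⟩
  rw [numCycles, Nat.card_eq_zero.2 (Or.inl inferInstance)] at h1
  exact h h1.symm

/-- A map with only one face has a leaf. -/
theorem exists_leaf (h : M.numInnerFaces = 0) : ∃ d, M.next d = M.rev d := by
  by_contra! hc
  have hc' : ∀ x, (M.next * M.rev) x ≠ x := fun x hx => hc (M.rev x) (by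
    rw [M.rev_rev]; exact hx)
  -- Without a leaf the rotation has no fixed dart, so every vertex has at least two darts and `V ≤
  -- E`. With one face, Euler's relation gives `V = E + 1`.
  have hle : 2 * numCycles (M.next * M.rev) ≤ Nat.card D := by
    have := Nat.card_le_card_of_injective
      (fun c : Quotient (SameCycle.setoid (M.next * M.rev)) × Bool =>
        if c.2 then (M.next * M.rev) c.1.out else c.1.out) ?_
    · rw [Nat.card_prod] at this
      simpa [mul_comm, numCycles] using this
    · have key : ∀ c : Quotient (SameCycle.setoid (M.next * M.rev)) × Bool,
          Quotient.mk (SameCycle.setoid (M.next * M.rev))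
            (if c.2 then (M.next * M.rev) c.1.out else c.1.out) = c.1 := by
        rintro ⟨c, b⟩
        cases b
        · exact Quotient.out_eq c
        · refine Eq.trans ?_ (Quotient.out_eq c)
          exact Quotient.sound (sameCycle_apply _ _).symm
      rintro ⟨c, b⟩ ⟨c', b'⟩ hcc
      obtain rfl : c = c' := by
        have h1 := key (c, b)
        have h2 := key (c', b')
        simp only at hcc h1 h2
        rw [← h1, ← h2, hcc]
      cases b <;> cases b'
      · rfl
      · exact absurd hcc.symm (hc' _)
      · exact absurd hcc (hc' _)
      · rfl
  have h1 := M.euler_numCycles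
  have h2 := M.two_mul_numCycles_rev
  have h3 := M.numCycles_next
  omega

theorem rootRemovable_of_leaf (hl : M.next M.root = M.rev M.root) (hp : 2 < M.perimeter) :
    M.RootRemovable where
  next_root h := M.rev_ne _ (hl.symm.trans h)
  next_rev h := M.next_rev_ne_next _ (h.trans hl.symm)
  next_rev_ne h := by
    have : {x | M.SameFace M.root x} ⊆ {M.root, M.rev M.root} := fun x hx => by
      refine sameCycle_induction (C := fun x => x ∈ ({M.root, M.rev M.root} : Set D)) hx
        (Or.inl rfl) ?_
      rintro z - (rfl | rfl)
      · exact Or.inr hl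
      · exact Or.inl h
    have := Set.ncard_le_ncard this
    rw [Set.ncard_pair (M.rev_ne _).symm] at this
    exact absurd hp (not_lt.2 this)
  leaf_or_separating := Or.inl hl

theorem rootRemovable_of_separating {ℓ : ℕ} (hM : M.IsQuad ℓ)
    (hs : ¬ M.OnRootFace (M.rev M.root)) : M.RootRemovable where
  next_root h := by
    have h1 := M.faceDegree_eq_one h
    have h2 := hM.1
    rw [perimeter] at h2
    omega
  next_rev h := by
    have h1 := M.faceDegree_eq_one h
    have h2 := hM.2 _ hs
    omega
  next_rev_ne h := hs (M.onRootFace_next_iff.1 (by rw [h]; exact SameCycle.rfl))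
  leaf_or_separating := Or.inr hs

/-- The map with one edge. -/
def edge : RootedMap Bool where
  rev := Equiv.boolNot
  next := Equiv.boolNot
  root := true
  rev_rev := by decide
  rev_ne := by decide
  connected := connected_of_induction fun C h0 h1 _ d => by
    cases d
    · exact h1 true h0
    · exact h0
  euler := by
    have h1 : Equiv.boolNot * Equiv.boolNot = (1 : Perm Bool) := by decide
    have h2 := two_mul_numCycles_of_involutive Equiv.boolNot (by decide) (by decide)
    change (numCycles (Equiv.boolNot * Equiv.boolNot) : ℤ) - numCycles Equiv.boolNot +
      numCycles Equiv.boolNot = 2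
    rw [h1, numCycles_one]
    simp

theorem edge_onRootFace (d : Bool) : edge.OnRootFace d := by
  cases d
  · exact edge.sameFace_next true
  · exact SameCycle.rfl

theorem edge_isQuad : edge.IsQuad 1 := by
  refine ⟨?_, fun d hd => absurd (edge_onRootFace d) hd⟩
  have : {x | edge.SameFace edge.root x} = Set.univ := Set.eq_univ_of_forall edge_onRootFace
  rw [perimeter, faceDegree, this, Set.ncard_univ]
  simp

theorem edge_numInnerFaces : edge.numInnerFaces = 0 := by
  have h := edge.numCycles_next
  have h2 : 2 * numCycles edge.next = Nat.card Bool := edge.two_mul_numCycles_rev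
  rw [Nat.card_eq_fintype_card, Fintype.card_bool] at h2
  omega

/-- With a single face the perimeter counts all darts, so only the root and its reversal exist;
`next` exchanges them, as a fixed dart would make a face of degree one. -/
theorem edge_iso (hp : M.perimeter = 2) (h : M.numInnerFaces = 0) : edge.Iso M := by
  have hall : {x | M.SameFace M.root x} = Set.univ :=
    Set.eq_univ_of_forall (M.onRootFace_of_numInnerFaces_eq_zero h)
  have hcard : ({M.root, M.rev M.root} : Set D) = Set.univ := by
    refine Set.eq_of_subset_of_ncard_le (Set.subset_univ _) ?_
    rw [← hall, Set.ncard_pair (M.rev_ne _).symm]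
    exact hp.le
  have hc : ∀ x, x = M.root ∨ x = M.rev M.root := fun x => by
    have : x ∈ ({M.root, M.rev M.root} : Set D) := hcard ▸ Set.mem_univ x
    simpa using this
  have hn : M.next M.root = M.rev M.root := (hc _).resolve_left fun hh => by
    have := M.faceDegree_eq_one hh
    rw [perimeter] at hp
    omega
  have hn' : M.next (M.rev M.root) = M.root := (hc _).resolve_right fun hh =>
    M.next_rev_ne_next _ (hh.trans hn.symm)
  refine ⟨Equiv.ofBijective (fun b => if b then M.root else M.rev M.root) ⟨?_, ?_⟩, ?_, ?_, rfl⟩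
  · rintro (_ | _) (_ | _) hbb
    · rfl
    · exact absurd hbb (M.rev_ne _)
    · exact absurd hbb.symm (M.rev_ne _)
    · rfl
  · intro x
    rcases hc x with rfl | rfl
    · exact ⟨true, rfl⟩
    · exact ⟨false, rfl⟩
  · rintro (_ | _)
    · exact (M.rev_rev _).symm
    · rfl
  · rintro (_ | _)
    · exact hn'.symm
    · exact hn.symm

end RootedMap
-- Adding a leaf, adding a quadrangle
instance neZero_two_mul (ℓ : ℕ+) : NeZero (2 * (ℓ : ℕ)) := ⟨by have := ℓ.pos; omega⟩

theorem four_le_two_mul_succ (ℓ : ℕ+) : 4 ≤ 2 * ((ℓ + 1 : ℕ+) : ℕ) := by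
  have := ℓ.pos
  rw [PNat.add_coe, PNat.one_coe]
  omega

/-- The polygon of length `2 * ℓ` with a pendant edge. -/
abbrev pendantQuad (ℓ : ℕ+) : HoledQuad (PolygonDart (2 * (ℓ : ℕ))) 1 :=
  PolygonDart.pendant (2 * (ℓ : ℕ))

/-- The polygon of length `2 * (ℓ + 1)` with a quadrangle. -/
noncomputable abbrev chordQuad (ℓ : ℕ+) : HoledQuad (PolygonDart (2 * ((ℓ + 1 : ℕ+) : ℕ))) 1 :=
  PolygonDart.chord (four_le_two_mul_succ ℓ)

/-- `m` is `u` with a pendant root edge. -/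
def AddsLeaf (ℓ : ℕ+) (u : Quad ℓ) (m : Quad (ℓ + 1 : ℕ+)) : Prop :=
  (pendantQuad ℓ).IsGluing (L := fun _ => ℓ) (fun _ => u) m

/-- `m` is `u` with a root edge that cuts a quadrangle. -/
def AddsFace (ℓ : ℕ+) (u : Quad (ℓ + 1 : ℕ+)) (m : Quad ℓ) : Prop :=
  (chordQuad ℓ).IsGluing (L := fun _ => ℓ + 1) (fun _ => u) m

theorem AddsLeaf.numFaces_eq {ℓ : ℕ+} {u : Quad ℓ} {m : Quad (ℓ + 1 : ℕ+)} (h : AddsLeaf ℓ u m) :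
    m.numFaces = u.numFaces := by
  have h1 : m.numFaces + 1 = (pendantQuad ℓ).numInnerFaces + u.numFaces :=
    (HoledQuad.IsGluing.numFaces_add h).trans (by rw [Fin.sum_univ_one])
  rw [PolygonDart.pendant_numInnerFaces] at h1
  omega

theorem AddsFace.numFaces_eq {ℓ : ℕ+} {u : Quad (ℓ + 1 : ℕ+)} {m : Quad ℓ} (h : AddsFace ℓ u m) :
    m.numFaces = u.numFaces + 1 := by
  have h1 : m.numFaces + 1 = (chordQuad ℓ).numInnerFaces + u.numFaces :=
    (HoledQuad.IsGluing.numFaces_add h).trans (by rw [Fin.sum_univ_one])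
  rw [PolygonDart.chord_numInnerFaces] at h1
  omega

theorem pendantQuad_holeDegree (ℓ : ℕ+) (i : Fin 1) :
    (pendantQuad ℓ).holeDegree i = 2 * (ℓ : ℕ) := by
  rw [Subsingleton.elim i 0]; exact PolygonDart.pendant_holeDegree

theorem chordQuad_holeDegree (ℓ : ℕ+) (i : Fin 1) :
    (chordQuad ℓ).holeDegree i = 2 * ((ℓ + 1 : ℕ+) : ℕ) := by
  rw [Subsingleton.elim i 0]; exact PolygonDart.chord_holeDegree _

theorem exists_addsLeaf (ℓ : ℕ+) (u : Quad ℓ) : ∃ m, AddsLeaf ℓ u m :=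
  HoledQuad.exists_isGluing (L := fun _ => ℓ) (pendantQuad_holeDegree ℓ)
    (by rw [PolygonDart.pendant_perimeter, PNat.add_coe, PNat.one_coe]; ring) fun _ => u

theorem exists_addsFace (ℓ : ℕ+) (u : Quad (ℓ + 1 : ℕ+)) : ∃ m, AddsFace ℓ u m :=
  HoledQuad.exists_isGluing (L := fun _ => ℓ + 1) (chordQuad_holeDegree ℓ)
    (by
      have := PolygonDart.chord_perimeter (four_le_two_mul_succ ℓ)
      have hℓ : ((ℓ + 1 : ℕ+) : ℕ) = ℓ + 1 := by rw [PNat.add_coe, PNat.one_coe]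
      change (chordQuad ℓ).perimeter + 2 = _ at this
      omega) fun _ => u

/-- The map is a plane tree with at least two edges. All its darts lie on the root face, so it can
be rerooted at a leaf edge, and `u` is what remains when that edge is removed. -/
theorem exists_rerooting_addsLeaf (ℓ : ℕ+) (m : Quad (ℓ + 1 : ℕ+)) (hm : m.numFaces = 0) :
    ∃ u m', m.rep.map.Rerooting m'.rep.map ∧ AddsLeaf ℓ u m' := by
  obtain ⟨d, hd⟩ := m.rep.map.exists_leaf hm
  have hr := m.rep.map.onRootFace_of_numInnerFaces_eq_zero hm d
  obtain ⟨m', h1, h2⟩ := m.exists_reroot hr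
  set M := m.rep.map.reroot d
  have hM : M.IsQuad _ := m.rep.isQuad.reroot hr
  have hp : M.perimeter = 2 * (ℓ : ℕ) + 2 := by
    rw [hM.1, PNat.add_coe, PNat.one_coe]; ring
  have h : M.RootRemovable := M.rootRemovable_of_leaf hd (by have := ℓ.pos; omega)
  have hN : h.delete.perimeter = 2 * (ℓ : ℕ) := by
    have := h.delete_perimeter_of_leaf hd
    omega
  obtain ⟨u, hu⟩ := Quad.exists_iso_rep _ (h.delete_isQuad hM hN)
  exact ⟨u, m', h1, (h.isGluingPair_pendant hN hd).congr (fun _ => hu.symm) h2⟩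

/-- The map is rerooted at a boundary edge with a quadrangle on the other side. Removing this edge
merges the two faces into a root face of degree `2ℓ + 4 - 2 = 2(ℓ + 1)`. -/
theorem exists_rerooting_addsFace (ℓ : ℕ+) (m : Quad ℓ) (hm : m.numFaces ≠ 0) :
    ∃ u m', m.rep.map.Rerooting m'.rep.map ∧ AddsFace ℓ u m' := by
  obtain ⟨d, hr, hd⟩ := m.rep.map.exists_separating hm
  obtain ⟨m', h1, h2⟩ := m.exists_reroot hr
  set M := m.rep.map.reroot d
  have hM : M.IsQuad _ := m.rep.isQuad.reroot hr
  have hs : ¬ M.OnRootFace (M.rev M.root) := fun h => hd (SameCycle.trans hr h)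
  have h : M.RootRemovable := M.rootRemovable_of_separating hM hs
  have hN : h.delete.perimeter = 2 * ((ℓ + 1 : ℕ+) : ℕ) := by
    have := h.delete_perimeter_of_separating hs
    rw [hM.1, hM.2 _ hs] at this
    rw [PNat.add_coe, PNat.one_coe]
    omega
  obtain ⟨u, hu⟩ := Quad.exists_iso_rep _ (h.delete_isQuad hM hN)
  exact ⟨u, m', h1, (h.isGluingPair_chord hN hs (hM.2 _ hs) (four_le_two_mul_succ ℓ)).congr
    (fun _ => hu.symm) h2⟩

theorem Quad.eq_of_numFaces_eq_zero {m m' : Quad (1 : ℕ+)} (h : m.numFaces = 0)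
    (h' : m'.numFaces = 0) : m = m' :=
  Quad.eq_of_iso ((RootedMap.edge_iso m.rep.perimeter_eq h).symm.trans
    (RootedMap.edge_iso m'.rep.perimeter_eq h'))

/-- This makes the common mass of the maps with `n` faces the mass of an actual map, for all `n` and
`ℓ`. The semi-perimeter varies in the induction because a face is added to a map of semi-perimeter
`ℓ + 1`. -/
theorem Quad.exists_numFaces_eq (n : ℕ) (ℓ : ℕ+) : ∃ m : Quad ℓ, m.numFaces = n := by
  induction n generalizing ℓ with
  | zero =>
    induction ℓ using PNat.recOn with
    | one =>
      obtain ⟨m, hm⟩ := Quad.exists_iso_rep _ RootedMap.edge_isQuad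
      exact ⟨m, hm.rerooting.numInnerFaces_eq.symm.trans RootedMap.edge_numInnerFaces⟩
    | succ ℓ ih =>
      obtain ⟨u, hu⟩ := ih
      obtain ⟨m, hm⟩ := exists_addsLeaf ℓ u
      exact ⟨m, hm.numFaces_eq.trans hu⟩
  | succ n ih =>
    obtain ⟨u, hu⟩ := ih (ℓ + 1)
    obtain ⟨m, hm⟩ := exists_addsFace ℓ u
    exact ⟨m, by rw [hm.numFaces_eq, hu]⟩

/-! ### From the Markov property to Boltzmann laws -/

section Characterization

variable {P : ∀ ℓ : ℕ+, PMF (Quad ℓ)}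

theorem IsMarkov.exists_addsLeaf_const (h : IsMarkov P) :
    ∃ d : ℕ+ → ℝ≥0, ∀ ℓ u m, AddsLeaf ℓ u m → P (ℓ + 1) m = d ℓ * P ℓ u := by
  choose d hd using fun ℓ : ℕ+ => h.exists_const (pendantQuad_holeDegree ℓ 0) (ℓ + 1)
  exact ⟨d, hd⟩

theorem IsMarkov.exists_addsFace_const (h : IsMarkov P) :
    ∃ c : ℕ+ → ℝ≥0, ∀ ℓ u m, AddsFace ℓ u m → P ℓ m = c ℓ * P (ℓ + 1) u := by
  choose c hc using fun ℓ : ℕ+ => h.exists_const (chordQuad_holeDegree ℓ 0) ℓ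
  exact ⟨c, hc⟩

/-- After rerooting, two maps with equally many faces are obtained by the same operation, with the
same constant, from smaller maps that again have equally many faces. Removing a quadrangle raises
the semi-perimeter, so the outer induction is on the number of faces, for all `ℓ` at once; trees are
settled by the inner induction on `ℓ`. -/
theorem IsMarkov.isUniformGivenFaces (h : IsMarkov P) (hr : IsRerootingInvariant P) :
    IsUniformGivenFaces P := by
  obtain ⟨d, hd⟩ := h.exists_addsLeaf_const
  obtain ⟨c, hc⟩ := h.exists_addsFace_const
  suffices ∀ (n : ℕ) (ℓ : ℕ+) (m₁ m₂ : Quad ℓ), m₁.numFaces = n → m₂.numFaces = n →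
      P ℓ m₁ = P ℓ m₂ from fun ℓ m₁ m₂ h12 => this _ ℓ m₁ m₂ rfl h12.symm
  intro n
  induction n with
  | zero =>
    intro ℓ
    induction ℓ using PNat.recOn with
    | one => exact fun m₁ m₂ h1 h2 => by rw [Quad.eq_of_numFaces_eq_zero h1 h2]
    | succ ℓ ih =>
      intro m₁ m₂ h1 h2
      obtain ⟨u₁, m₁', hm₁, hu₁⟩ := exists_rerooting_addsLeaf ℓ m₁ h1
      obtain ⟨u₂, m₂', hm₂, hu₂⟩ := exists_rerooting_addsLeaf ℓ m₂ h2
      rw [hr _ _ _ hm₁, hr _ _ _ hm₂, hd _ _ _ hu₁, hd _ _ _ hu₂, ih u₁ u₂]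
      · rw [← hu₁.numFaces_eq]; exact hm₁.numInnerFaces_eq.symm.trans h1
      · rw [← hu₂.numFaces_eq]; exact hm₂.numInnerFaces_eq.symm.trans h2
  | succ n ih =>
    intro ℓ m₁ m₂ h1 h2
    obtain ⟨u₁, m₁', hm₁, hu₁⟩ := exists_rerooting_addsFace ℓ m₁ (by omega)
    obtain ⟨u₂, m₂', hm₂, hu₂⟩ := exists_rerooting_addsFace ℓ m₂ (by omega)
    rw [hr _ _ _ hm₁, hr _ _ _ hm₂, hc _ _ _ hu₁, hc _ _ _ hu₂, ih _ u₁ u₂]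
    · have h3 : m₁'.numFaces = n + 1 := hm₁.numInnerFaces_eq.symm.trans h1
      have := hu₁.numFaces_eq
      omega
    · have h3 : m₂'.numFaces = n + 1 := hm₂.numInnerFaces_eq.symm.trans h2
      have := hu₂.numFaces_eq
      omega

/-- At semi-perimeter `1`, adding a leaf and then a quadrangle returns to semi-perimeter `1` with
one more face, at the cost of the factor `c 1 * d 1`. Adding leaves carries this geometric law to
every `ℓ`, since `d ℓ` does not depend on the number of faces. -/
theorem IsMarkov.exists_mass (h : IsMarkov P) (hu : IsUniformGivenFaces P) :
    ∃ (x : ℝ≥0) (a : ℕ+ → ℝ≥0∞), ∀ ℓ m, P ℓ m = a ℓ * (x : ℝ≥0∞) ^ m.numFaces := by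
  obtain ⟨d, hd⟩ := h.exists_addsLeaf_const
  obtain ⟨c, hc⟩ := h.exists_addsFace_const
  choose M hM using Quad.exists_numFaces_eq
  have hK : ∀ ℓ m, P ℓ m = P ℓ (M m.numFaces ℓ) := fun ℓ m => hu _ _ _ (hM _ _).symm
  have hleaf : ∀ n ℓ, P (ℓ + 1) (M n (ℓ + 1)) = d ℓ * P ℓ (M n ℓ) := fun n ℓ => by
    obtain ⟨m, hm⟩ := exists_addsLeaf ℓ (M n ℓ)
    rw [← hd _ _ _ hm]
    exact hu _ _ _ ((hM _ _).trans (hm.numFaces_eq.trans (hM _ _)).symm)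
  have hface : ∀ n ℓ, P ℓ (M (n + 1) ℓ) = c ℓ * P (ℓ + 1) (M n (ℓ + 1)) := fun n ℓ => by
    obtain ⟨m, hm⟩ := exists_addsFace ℓ (M n (ℓ + 1))
    rw [← hc _ _ _ hm]
    exact hu _ _ _ ((hM _ _).trans (by rw [hm.numFaces_eq, hM]))
  have hone : ∀ n, P 1 (M n 1) = P 1 (M 0 1) * ((c 1 * d 1 : ℝ≥0) : ℝ≥0∞) ^ n := fun n => by
    induction n with
    | zero => simp
    | succ n ih =>
      rw [hface, hleaf, ih, ENNReal.coe_mul]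
      ring
  refine ⟨c 1 * d 1, fun ℓ => P ℓ (M 0 ℓ), fun ℓ m => ?_⟩
  rw [hK]
  generalize m.numFaces = n
  induction ℓ using PNat.recOn with
  | one => exact hone n
  | succ ℓ ih =>
    change _ = P (ℓ + 1) (M 0 (ℓ + 1)) * _
    rw [hleaf, hleaf, ih (M n ℓ), mul_assoc]

/-- Total mass one reads `a ℓ * partitionFunction x ℓ = 1`, which forces the partition function to
be finite and `a ℓ` to be its inverse. -/
theorem isBoltzmann_of_mass {x : ℝ≥0} {a : ℕ+ → ℝ≥0∞}
    (h : ∀ ℓ m, P ℓ m = a ℓ * (x : ℝ≥0∞) ^ m.numFaces) : IsBoltzmann x P := by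
  intro ℓ
  have h1 : a ℓ * partitionFunction x ℓ = 1 := by
    rw [partitionFunction, ← ENNReal.tsum_mul_left, ← (P ℓ).tsum_coe]
    exact tsum_congr fun m => (h ℓ m).symm
  have ha : a ℓ ≠ 0 := fun h0 => by simp [h0] at h1
  refine ⟨fun ht => ?_, fun m => ?_⟩
  · rw [ht, ENNReal.mul_top ha] at h1
    exact ENNReal.top_ne_one h1
  · rw [h, ENNReal.eq_inv_of_mul_eq_one_left h1, div_eq_mul_inv, mul_comm]

end Characterization

end PlanarQuad

theorem theoremt (P : ∀ ℓ : ℕ+, PMF (PlanarQuad.Quad ℓ)) :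
    List.TFAE [
      ∃ q : ℝ≥0, PlanarQuad.IsBoltzmann q P,
      PlanarQuad.IsMarkov P ∧ PlanarQuad.IsUniformGivenFaces P,
      PlanarQuad.IsMarkov P ∧ PlanarQuad.IsRerootingInvariant P] := by
  tfae_have 1 → 2 := fun ⟨_, h⟩ => ⟨h.isMarkov, h.isUniformGivenFaces⟩
  tfae_have 2 → 3 := fun ⟨h, hu⟩ => ⟨h, hu.isRerootingInvariant⟩
  tfae_have 3 → 1 := fun ⟨h, hr⟩ =>
    let ⟨x, _, ha⟩ := h.exists_mass (h.isUniformGivenFaces hr)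
    ⟨x, PlanarQuad.isBoltzmann_of_mass ha⟩
  tfae_finish
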